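/- **Theorem 4.7 (global Levi-Civita characterization).** Let $M$ be a (connected and) simply connected smooth finite-dimensional Hausdorff manifold, let $\nabla$ be a smooth symmetric (torsion-free) connection on $TM$ with curvature tensor $R(X,Y)Z=\nabla_X\nabla_YZ-\nabla_Y\nabla_XZ-\nabla_{[X,Y]}Z$, let $m_0\in M$, and let $g_0$ be a nondegenerate symmetric bilinear form on $T_{m_0}M$. Let $\mathcal S$ be a spray on $M$, that is, a smooth vector field $\mathcal S:TM\to TTM$ with $\mathrm d\pi_v(\mathcal S(v))=v$ and $a\,\mathrm d\mathfrak m_a(v)\,\mathcal S(v)=\mathcal S(av)$ for all $v\in TM$ and $a\in\mathbb R$, where $\pi:TM\to M$ is the projection and $\mathfrak m_a:TM\to TM$ is multiplication by $a$. A piecewise solution of $\mathcal S$ is a curve $\gamma:[a,b]\to M$ with a partition $a=t_0<t_1<\dots<t_k=b$ such that, for every $i$, the velocity $(\gamma|_{[t_i,t_{i+1}]})'$ is an integral curve of $\mathcal S$. Assume that for every piecewise solution $\gamma:[a,b]\to M$ of $\mathcal S$ with $\gamma(a)=m_0$ and all $v,w\in T_{\gamma(b)}M$, the linear operator $$P_\gamma^{-1}\,R_{\gamma(b)}(v,w)\,P_\gamma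 : T_{m_0}M\to T_{m_0}M$$ is anti-symmetric with respect to $g_0$, where $P_\gamma:T_{m_0}M\to T_{\gamma(b)}M$ denotes $\nabla$-parallel transport along $\gamma$. Then there is a semi-Riemannian metric $g$ on $M$ (a smooth field of nondegenerate symmetric bilinear forms on the tangent spaces) with $g_{m_0}=g_0$ whose Levi-Civita connection is $\nabla$, i.e. $\nabla$ is symmetric and $\nabla g=0$. -/

import Mathlib

open Set Bundle
open scoped Manifold ContDiff

noncomputable section

section Definitions

variable {E : Type*} [NormedAddCommGroup E] [NormedSpace ℝ E]
  {H : Type*} [TopologicalSpace H] {I : ModelWithCorners ℝ E H}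
  {M : Type*} [TopologicalSpace M] [ChartedSpace H M]

/-- `p` holds on every piece `[t i, t (i + 1)]` of some partition
`a = t 0 < t 1 < ⋯ < t k = b` (with `k ≥ 1`) of the interval `[a, b]`. -/
def OnPieces (p : Set ℝ → Prop) (a b : ℝ) : Prop :=
  ∃ (k : ℕ) (t : ℕ → ℝ), 0 < k ∧ t 0 = a ∧ t k = b ∧
    (∀ i < k, t i < t (i + 1)) ∧ ∀ i < k, p (Icc (t i) (t (i + 1)))

/-- The velocity `γ' t` of the curve `γ|ₛ` at the time `t`, a vector tangent to `M` at `γ t`. -/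
def velocityWithin (I : ModelWithCorners ℝ E H) (γ : ℝ → M) (s : Set ℝ) (t : ℝ) :
    TangentSpace I (γ t) :=
  mfderivWithin 𝓘(ℝ, ℝ) I γ s t (1 : ℝ)

section TangentBundle

variable [IsManifold I 1 M]

/-- Multiplication by the scalar `c` in the fibres of the tangent bundle. -/
def fiberSMul (I : ModelWithCorners ℝ E H) (M : Type*) [TopologicalSpace M] [ChartedSpace H M]
    [IsManifold I 1 M] (c : ℝ) (v : TangentBundle I M) : TangentBundle I M :=
  ⟨v.proj, c • v.2⟩

/-- A spray: a smooth vector field `S` on `TM` with `dπ (S v) = v` and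
`c • d𝔪_c (S v) = S (c • v)`, where `𝔪_c` is multiplication by `c` in the fibres. -/
structure IsSpray [IsManifold I.tangent 1 (TangentBundle I M)]
    (S : (v : TangentBundle I M) → TangentSpace I.tangent v) : Prop where
  smooth : ContMDiff I.tangent I.tangent.tangent ∞
    (fun v ↦ (⟨v, S v⟩ : TangentBundle I.tangent (TangentBundle I M)))
  proj : ∀ v : TangentBundle I M,
    mfderiv I.tangent I (TotalSpace.proj : TangentBundle I M → M) v (S v) = v.2
  homogeneous : ∀ (c : ℝ) (v : TangentBundle I M),
    c • mfderiv I.tangent I.tangent (fiberSMul I M c) v (S v) = S (fiberSMul I M c v)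

/-- `γ|ₛ` is a solution of `S`: it is differentiable and `γ' : s → TM` is an integral curve
of the vector field `S` on `TM`. -/
def IsSpraySolutionOn (S : (v : TangentBundle I M) → TangentSpace I.tangent v)
    (γ : ℝ → M) (s : Set ℝ) : Prop :=
  MDifferentiableOn 𝓘(ℝ, ℝ) I γ s ∧
    IsMIntegralCurveOn (I := I.tangent)
      (fun t ↦ (⟨γ t, velocityWithin I γ s t⟩ : TangentBundle I M)) S s

/-- `γ : [a, b] → M` is a piecewise solution of `S`. -/
def IsPiecewiseSpraySolution (S : (v : TangentBundle I M) → TangentSpace I.tangent v)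
    (γ : ℝ → M) (a b : ℝ) : Prop :=
  OnPieces (IsSpraySolutionOn S γ) a b

variable (cov : CovariantDerivative I E (TangentSpace I : M → Type _))

/-- `W` is the covariant derivative at the time `t` of the vector field `V` along the curve `γ|ₛ`.
Let `e` be the trivialization of `TM` centred at `γ t` and `(∂ᵢ)` the corresponding local frame,
so that `V = ∑ Vⁱ ∂ᵢ`. Then `W = ∑ (Vⁱ)'(t) ∂ᵢ + ∑ Vⁱ(t) ∇_{γ' t} ∂ᵢ`. The last sum is
`∇_{γ' t}` of the field `extend E (V t)`, which has the constant coordinates `Vⁱ(t)`. -/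
def HasCovDerivWithinAt (γ : ℝ → M) (V : (t : ℝ) → TangentSpace I (γ t)) (s : Set ℝ) (t : ℝ)
    (W : TangentSpace I (γ t)) : Prop :=
  let e := trivializationAt E (TangentSpace I : M → Type _) (γ t)
  MDifferentiableWithinAt 𝓘(ℝ, ℝ) I γ s t ∧
    HasDerivWithinAt (fun r ↦ (e ⟨γ r, V r⟩).2)
      (e ⟨γ t, W - cov (FiberBundle.extend E (V t)) (γ t) (velocityWithin I γ s t)⟩).2 s t

/-- `V` is a parallel vector field along the piecewise smooth curve `γ : [a, b] → M`: the interval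
splits into closed pieces on each of which the covariant derivative of `V` vanishes. -/
def IsParallelAlong (γ : ℝ → M) (V : (t : ℝ) → TangentSpace I (γ t)) (a b : ℝ) : Prop :=
  OnPieces (fun s ↦ ∀ t ∈ s, HasCovDerivWithinAt cov γ V s t 0) a b

/-- `P : T_{m₀}M → T_{γ b}M` is the parallel transport along a curve `γ : [a, b] → M` that starts
at `m₀`: every `u` is the value at `a` of a parallel field along `γ` whose value at `b` is `P u`. -/
def IsParallelTransport (γ : ℝ → M) (a b : ℝ) {m₀ : M}
    (P : TangentSpace I m₀ ≃ₗ[ℝ] TangentSpace I (γ b)) : Prop :=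
  ∀ u : TangentSpace I m₀, ∃ V : (t : ℝ) → TangentSpace I (γ t),
    IsParallelAlong cov γ V a b ∧
      (⟨γ a, V a⟩ : TangentBundle I M) = ⟨m₀, u⟩ ∧ V b = P u

/-- `∇_X ∇_Y Z - ∇_Y ∇_X Z - ∇_{[X, Y]} Z` for vector fields `X`, `Y`, `Z`. -/
def curvatureField (X Y Z : (x : M) → TangentSpace I x) (x : M) : TangentSpace I x :=
  cov (fun y ↦ cov Z y (Y y)) x (X x) - cov (fun y ↦ cov Z y (X y)) x (Y x)
    - cov Z x (VectorField.mlieBracket I X Y x)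

/-- The curvature operator `R_x(v, w) : T_xM → T_xM`: the value at `x` of
`∇_X ∇_Y Z - ∇_Y ∇_X Z - ∇_{[X, Y]} Z` for vector fields `X`, `Y`, `Z`, smooth near `x`, that
extend `v`, `w`, `z`. -/
def curvatureAt (x : M) (v w z : TangentSpace I x) : TangentSpace I x :=
  curvatureField cov (FiberBundle.extend E v) (FiberBundle.extend E w) (FiberBundle.extend E z) x

variable (I M) in
/-- A semi-Riemannian metric: a smooth field of nondegenerate symmetric bilinear forms on the
tangent spaces, of any signature. -/
structure SemiRiemannianMetric where
  /-- The bilinear form on each tangent space. -/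
  form (x : M) : TangentSpace I x →L[ℝ] TangentSpace I x →L[ℝ] ℝ
  symm (x : M) (v w : TangentSpace I x) : form x v w = form x w v
  nondegenerate (x : M) (v : TangentSpace I x) (hv : ∀ w, form x v w = 0) : v = 0
  smooth : ContMDiff I (I.prod 𝓘(ℝ, E →L[ℝ] E →L[ℝ] ℝ)) ∞
    (fun x ↦ TotalSpace.mk' (E →L[ℝ] E →L[ℝ] ℝ)
      (E := fun x : M ↦ TangentSpace I x →L[ℝ] TangentSpace I x →L[ℝ] ℝ) x (form x))

end TangentBundle

/-- `∇` is the Levi-Civita connection of `g`: it is symmetric and `∇g = 0`, that is,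
`X (g(ξ, η)) = g(∇_X ξ, η) + g(ξ, ∇_X η)` for all smooth vector fields `X`, `ξ`, `η`. -/
structure IsLeviCivita [IsManifold I 1 M] [IsManifold I 2 M] [FiniteDimensional ℝ E]
    [CompleteSpace E]
    (cov : CovariantDerivative I E (TangentSpace I : M → Type _))
    (g : SemiRiemannianMetric I M) : Prop where
  symmetric : cov.torsion = 0
  parallel : ∀ X ξ η : (x : M) → TangentSpace I x,
    ContMDiff I I.tangent ∞ (fun x ↦ (⟨x, X x⟩ : TangentBundle I M)) →
    ContMDiff I I.tangent ∞ (fun x ↦ (⟨x, ξ x⟩ : TangentBundle I M)) →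
    ContMDiff I I.tangent ∞ (fun x ↦ (⟨x, η x⟩ : TangentBundle I M)) →
    ∀ x : M, mfderiv I 𝓘(ℝ, ℝ) (fun y ↦ g.form y (ξ y) (η y)) x (X x) =
      g.form x (cov ξ x (X x)) (η x) + g.form x (ξ x) (cov η x (X x))

end Definitions

end

/-! The connection on `TM` induces one on the bundle of bilinear forms; a metric with Levi-Civita
connection `∇` is a symmetric, nondegenerate parallel section of it. The curvature of the induced
connection vanishes on a form exactly when the operators `R(v, w)` are skew for that form.
Transporting `g₀` along the piecewise solutions of the spray gives forms (`transportedForms`) on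
which, by hypothesis, this curvature vanishes. They need not come from curves adapted to any chart,
so flat sections cannot be read off directly.

The remedy is to take the closure of this set in the total space. Vanishing curvature and symmetry
are closed conditions, so they persist (`skew_of_mem_closure_transportedForms`,
`symm_of_mem_closure_transportedForms`). From every element of the closure, in every direction `u`,
issues a curve in the closure whose initial velocity is the horizontal lift of `u`: follow the spray
solution with initial velocity `u` and transport the form
(`exists_curve_mem_closure_transportedForms`). Nagumo's theorem turns this first-order information
into invariance under parallel transport over straight segments of a chart
(`IsTransport.mem_of_subtangent`).

Radial transport in a chart then stays in a set where the curvature vanishes, and a Gronwall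
estimate shows that its endpoint is a differentiable, hence parallel, local section
(`isFlatAt_of_isTransport`, `exists_flat_sections`). Parallel sections are determined by one value,
so with the leaf topology the closure becomes a covering space of `M`. As `M` is simply connected,
there is a global section through `g₀` (`IsLocalSectionFamily.exists_global_section`). It is smooth
because it solves a smooth linear equation, and nondegenerate because nondegeneracy is an open and
closed condition along a parallel form. -/

noncomputable section

set_option maxSynthPendingDepth 3
set_option linter.unusedSectionVars false

/-! ### Nagumo's theorem on flow-invariant closed sets. -/

section Invariance
open Filter Topology Metric

variable {F : Type*} [NormedAddCommGroup F] [NormedSpace ℝ F]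

/-- Local form of the invariance theorem: the trajectory of a Lipschitz vector field, tangent to a
compact set `K ∩ closedBall p R`, does not leave it as long as it stays in a small ball. -/
theorem mem_of_subtangent_of_lipschitzOnWith [ProperSpace F] {K : Set F} {X : F → F} {p : F} {R : ℝ}
    {L : NNReal} (hp : p ∈ K) (hR : 0 < R) (hK : IsClosed (K ∩ closedBall p R))
    (hX : LipschitzOnWith L X (closedBall p R))
    (hsub : ∀ x ∈ K ∩ ball p R, ∃ q : ℝ → F, q 0 = x ∧ HasDerivWithinAt q (X x) (Ici 0) 0 ∧
      ∀ᶠ h in 𝓝[>] 0, q h ∈ K)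
    {c : ℝ → F} {a b : ℝ} (hc : ∀ t ∈ Icc a b, HasDerivWithinAt c (X (c t)) (Icc a b) t)
    (hcR : ∀ t ∈ Icc a b, dist (c t) p < R / 4) (ha : c a ∈ K) :
    ∀ t ∈ Icc a b, c t ∈ K := by
  intro t₁ ht₁
  have hab : a ≤ b := ht₁.1.trans ht₁.2
  set K' := K ∩ closedBall p R with hK'
  have hK'c : IsCompact K' := (isCompact_closedBall p R).of_isClosed_subset hK inter_subset_right
  have hpK' : p ∈ K' := ⟨hp, mem_closedBall_self hR.le⟩
  have hne : K'.Nonempty := ⟨p, hpK'⟩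
  have hcont : ContinuousOn c (Icc a b) := fun t ht ↦ (hc t ht).continuousWithinAt
  -- The distance `d` from `c t` to `K'` has right lower derivative at most `L * d`: compare `c`
  -- with the curve `q` in `K` issuing from a nearest point `x`, and use `‖X (c t) - X x‖ ≤ L * d`.
  -- Gronwall with initial value `0` gives `d = 0`.
  have key : ∀ t ∈ Icc a b, infDist (c t) K' ≤ gronwallBound 0 L 0 (t - a) := by
    refine le_gronwallBound_of_liminf_deriv_right_le (f' := fun t ↦ L * infDist (c t) K')
      ((continuous_infDist_pt K').comp_continuousOn hcont) ?_ ?_ ?_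
    · intro t ht r hr
      have htI : t ∈ Icc a b := Ico_subset_Icc_self ht
      obtain ⟨x, hxK', hx⟩ := hK'c.exists_infDist_eq_dist hne (c t)
      -- Both `c t` and `p` are within `R / 4` of each other and `p ∈ K'`, so the nearest point lies
      -- within `R / 2` of `p`, in the open ball where `hsub` applies and which `q` does not leave
      -- at once.
      have hxd : dist (c t) x < R / 4 := by
        rw [← hx]
        exact (infDist_le_dist_of_mem hpK').trans_lt (hcR t htI)
      have hxp : dist x p < R := by
        have := dist_triangle_left x p (c t)
        linarith [hcR t htI]
      obtain ⟨q, hq0, hqd, hqK⟩ := hsub x ⟨hxK'.1, hxp⟩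
      have hqshift : HasDerivWithinAt (fun z ↦ q (z - t)) (X x) (Ici t) t := by
        have h1 : HasDerivWithinAt q (X x) (Ici 0) (t - t) := by simpa using hqd
        have h2 : HasDerivWithinAt (fun z : ℝ ↦ z - t) 1 (Ici t) t :=
          ((hasDerivAt_id t).sub_const t).hasDerivWithinAt
        have := HasDerivWithinAt.scomp (h := fun z : ℝ ↦ z - t) t h1 h2
          (fun z hz ↦ by simpa using! hz)
        simpa [Function.comp_def] using this
      have hct : HasDerivWithinAt c (X (c t)) (Ici t) t :=
        (hc t htI).mono_of_mem_nhdsWithin (Icc_mem_nhdsGE_of_mem ht)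
      have hρ := hct.sub hqshift
      have hnorm : ‖X (c t) - X x‖ < r := by
        refine lt_of_le_of_lt ?_ hr
        rw [← dist_eq_norm, hx]
        refine hX.dist_le_mul _ ?_ _ ?_
        · exact mem_closedBall.2 (by linarith [hcR t htI])
        · exact hxK'.2
      have hlim := hρ.Ioi_of_Ici.limsup_slope_norm_le hnorm
      have hqev : ∀ᶠ z in 𝓝[>] t, q (z - t) ∈ K' := by
        have h1 : Tendsto (fun z ↦ z - t) (𝓝[>] t) (𝓝[>] 0) := by
          refine tendsto_nhdsWithin_iff.2 ⟨?_, ?_⟩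
          · have : Tendsto (fun z ↦ z - t) (𝓝 t) (𝓝 (t - t)) :=
              (continuous_id.sub continuous_const).tendsto t
            rw [sub_self] at this
            exact this.mono_left nhdsWithin_le_nhds
          · filter_upwards [self_mem_nhdsWithin] with z hz
            simpa using hz
        have h2 : Tendsto (fun z ↦ q (z - t)) (𝓝[>] t) (𝓝 x) := by
          have := hqshift.continuousWithinAt.tendsto
          simp only [sub_self, hq0] at this
          exact this.mono_left (nhdsWithin_mono _ Ioi_subset_Ici_self)
        filter_upwards [h1.eventually hqK, h2.eventually (isOpen_ball.mem_nhds hxp)] with z h3 h4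
        exact ⟨h3, ball_subset_closedBall h4⟩
      refine (hlim.and (hqev.and self_mem_nhdsWithin)).frequently.mono ?_
      rintro z ⟨hz1, hz2, hz3⟩
      have hzt : 0 < z - t := sub_pos.2 hz3
      rw [Real.norm_eq_abs, abs_of_pos hzt] at hz1
      refine lt_of_le_of_lt ?_ hz1
      have h5 : infDist (c z) K' ≤ ‖(c - fun z ↦ q (z - t)) z‖ := by
        rw [Pi.sub_apply, ← dist_eq_norm]
        exact infDist_le_dist_of_mem hz2
      have h6 : ‖(c - fun z ↦ q (z - t)) t‖ = infDist (c t) K' := by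
        rw [Pi.sub_apply, ← dist_eq_norm, sub_self, hq0, hx]
      rw [h6]
      gcongr
    · have hca : c a ∈ K' :=
        ⟨ha, mem_closedBall.2 (by linarith [hcR a (left_mem_Icc.2 hab)])⟩
      exact (infDist_zero_of_mem hca).le
    · intro t _
      simp
  have h0 : infDist (c t₁) K' = 0 := by
    refine le_antisymm ((key t₁ ht₁).trans ?_) infDist_nonneg
    simp [gronwallBound_ε0_δ0]
  exact ((hK.mem_iff_infDist_zero hne).2 h0).1

/-- **Nagumo's invariance theorem**: a trajectory of a `C¹` vector field `X` on an open set `Ω` that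
starts in a relatively closed set `K` stays in `K`, if every vector `X x` with `x ∈ K` is the
velocity at time `0` of a curve in `K`. -/
theorem mem_of_subtangent [ProperSpace F] {K Ω : Set F} {X : F → F} (hΩ : IsOpen Ω)
    (hK : ∀ x ∈ Ω, x ∈ closure K → x ∈ K) (hX : ∀ x ∈ Ω, ContDiffAt ℝ 1 X x)
    (hsub : ∀ x ∈ K ∩ Ω, ∃ q : ℝ → F, q 0 = x ∧ HasDerivWithinAt q (X x) (Ici 0) 0 ∧
      ∀ᶠ h in 𝓝[>] 0, q h ∈ K)
    {c : ℝ → F} {a b : ℝ} (hc : ∀ t ∈ Icc a b, HasDerivWithinAt c (X (c t)) (Icc a b) t)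
    (hcΩ : ∀ t ∈ Icc a b, c t ∈ Ω) (ha : c a ∈ K) :
    ∀ t ∈ Icc a b, c t ∈ K := by
  have hcont : ContinuousOn c (Icc a b) := fun t ht ↦ (hc t ht).continuousWithinAt
  change Icc a b ⊆ {t | c t ∈ K}
  -- Continuation: the set of good times is closed since `K` is relatively closed, and it extends to
  -- the right of each of its points by the local theorem on a ball where `X` is Lipschitz.
  refine IsClosed.Icc_subset_of_forall_exists_gt ?_ ha ?_
  · refine isClosed_of_closure_subset fun t ht ↦ ?_
    have htI : t ∈ Icc a b := closure_minimal inter_subset_right isClosed_Icc ht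
    refine ⟨hK _ (hcΩ t htI) ?_, htI⟩
    have h1 : ContinuousWithinAt c ({t | c t ∈ K} ∩ Icc a b) t :=
      (hcont t htI).mono inter_subset_right
    exact closure_mono (by rintro _ ⟨z, hz, rfl⟩; exact hz.1) (h1.mem_closure_image ht)
  · rintro t ⟨htK, htI⟩ y hy
    have htI' : t ∈ Icc a b := Ico_subset_Icc_self htI
    have hΩt := hcΩ t htI'
    obtain ⟨L, s, hs, hL⟩ := (hX _ hΩt).exists_lipschitzOnWith
    obtain ⟨R, hR, hRs⟩ := nhds_basis_closedBall.mem_iff.1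
      (inter_mem hs (hΩ.mem_nhds hΩt))
    have hev : ∀ᶠ z in 𝓝[≥] t, dist (c z) (c t) < R / 4 ∧ z < y ∧ z < b := by
      have h1 : Tendsto c (𝓝[≥] t) (𝓝 (c t)) :=
        (hcont t htI').mono_left (nhdsWithin_le_of_mem (Icc_mem_nhdsGE_of_mem htI))
      have h2 : ∀ᶠ z in 𝓝[≥] t, dist (c z) (c t) < R / 4 :=
        h1.eventually (ball_mem_nhds _ (by positivity))
      have h3 : ∀ᶠ z in 𝓝[≥] t, z < y := nhdsWithin_le_nhds (Iio_mem_nhds hy)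
      have h4 : ∀ᶠ z in 𝓝[≥] t, z < b := nhdsWithin_le_nhds (Iio_mem_nhds htI.2)
      exact h2.and (h3.and h4)
    obtain ⟨d, hd, hdI⟩ := mem_nhdsGE_iff_exists_Icc_subset.1 hev
    refine ⟨d, ?_, hd, (hdI (right_mem_Icc.2 (le_of_lt hd))).2.1.le⟩
    have hsubI : Icc t d ⊆ Icc a b :=
      Icc_subset_Icc htI.1 (hdI (right_mem_Icc.2 (le_of_lt hd))).2.2.le
    refine mem_of_subtangent_of_lipschitzOnWith (K := K) (p := c t) htK hR ?_
      (hL.mono fun z hz ↦ (hRs hz).1) (fun x hx ↦ hsub x ⟨hx.1, (hRs (ball_subset_closedBall hx.2)).2⟩)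
      (fun z hz ↦ (hc z (hsubI hz)).mono hsubI) (fun z hz ↦ (hdI hz).1) htK d
      (right_mem_Icc.2 (le_of_lt hd))
    refine isClosed_of_closure_subset fun x hx ↦ ?_
    have hxR : x ∈ closedBall (c t) R := closure_minimal inter_subset_right isClosed_closedBall hx
    exact ⟨hK x (hRs hxR).2 (closure_mono inter_subset_left hx), hxR⟩

end Invariance

/-! ### Linear total differential equations `ds = A s` and transport over segments. -/

section LinearTransport
open Filter Topology Metric

variable {E : Type*} [NormedAddCommGroup E] [NormedSpace ℝ E]
  {V : Type*} [NormedAddCommGroup V] [NormedSpace ℝ V]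
  {W : Type*} [NormedAddCommGroup W] [NormedSpace ℝ W]

theorem exists_norm_bound {f : E → W} {Ω S : Set E} (hf : ContDiffOn ℝ ∞ f Ω) (hS : IsCompact S)
    (hSΩ : S ⊆ Ω) : ∃ C : ℝ, ∀ x ∈ S, ‖f x‖ ≤ C :=
  hS.exists_bound_of_continuousOn (hf.continuousOn.mono hSΩ)

theorem exists_fderiv_bound {f : E → W} {Ω S : Set E} (hΩ : IsOpen Ω) (hS : IsCompact S)
    (hSΩ : S ⊆ Ω) (hf : ContDiffOn ℝ ∞ f Ω) :
    (∀ x ∈ S, DifferentiableAt ℝ f x) ∧ ∃ C : ℝ, ∀ x ∈ S, ‖fderiv ℝ f x‖ ≤ C :=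
  ⟨fun x hx ↦ (hf.contDiffAt (hΩ.mem_nhds (hSΩ hx))).differentiableAt (by simp),
    hS.exists_bound_of_continuousOn
      ((hf.fderiv_of_isOpen (m := ∞) hΩ (by simp)).continuousOn.mono hSΩ)⟩

theorem exists_taylor_bounds {f : E → W} {Ω S : Set E} (hΩ : IsOpen Ω) (hS : IsCompact S)
    (hSc : Convex ℝ S) (hSΩ : S ⊆ Ω) (hf : ContDiffOn ℝ ∞ f Ω) :
    ∃ C : ℝ, 0 < C ∧ (∀ x ∈ S, ‖f x‖ ≤ C) ∧ (∀ x ∈ S, ∀ y ∈ S, ‖f y - f x‖ ≤ C * ‖y - x‖) ∧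
      ∀ x ∈ S, ∀ y ∈ S, ‖f y - f x - fderiv ℝ f x (y - x)‖ ≤ C * ‖y - x‖ ^ 2 := by
  have hf1 : ContDiffOn ℝ ∞ (fderiv ℝ f) Ω := hf.fderiv_of_isOpen hΩ (by simp)
  obtain ⟨C0, h0⟩ := exists_norm_bound hf hS hSΩ
  obtain ⟨hd, C1, h1⟩ := exists_fderiv_bound hΩ hS hSΩ hf
  obtain ⟨hd1, C2, h2⟩ := exists_fderiv_bound hΩ hS hSΩ hf1
  set C := max 1 (max C0 (max C1 C2)) with hC
  have hC0 : C0 ≤ C := by simp [hC]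
  have hC1 : C1 ≤ C := by simp [hC]
  have hC2 : C2 ≤ C := by simp [hC]
  have hCpos : 0 < C := lt_of_lt_of_le one_pos (le_max_left _ _)
  refine ⟨C, hCpos, fun x hx ↦ (h0 x hx).trans hC0, fun x hx y hy ↦ ?_, fun x hx y hy ↦ ?_⟩
  · exact hSc.norm_image_sub_le_of_norm_fderiv_le hd (fun z hz ↦ (h1 z hz).trans hC1) hx hy
  · have hseg : segment ℝ x y ⊆ S := hSc.segment_subset hx hy
    have := (convex_segment x y).norm_image_sub_le_of_norm_fderiv_le' (f := f)
      (φ := fderiv ℝ f x) (C := C * ‖y - x‖) (fun z hz ↦ hd z (hseg hz)) (fun z hz ↦ ?_)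
      (left_mem_segment ℝ x y) (right_mem_segment ℝ x y)
    · rwa [mul_assoc, ← sq] at this
    · refine (hSc.norm_image_sub_le_of_norm_fderiv_le hd1 (fun z hz ↦ (h2 z hz).trans hC2) hx
        (hseg hz)).trans ?_
      gcongr
      exact norm_sub_le_of_mem_segment hz

/-- `c` is parallel over the segment `t ↦ y + t • w`, `t ∈ [0, 1]`, for the equation `ds = A s`. -/
def IsTransport (A : E → E →L[ℝ] V →L[ℝ] V) (y w : E) (c : ℝ → V) : Prop :=
  ∀ t ∈ Icc (0 : ℝ) 1, HasDerivWithinAt c (A (y + t • w) w (c t)) (Icc 0 1) t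

variable {A : E → E →L[ℝ] V →L[ℝ] V} {y w : E} {c : ℝ → V}

theorem IsTransport.continuousOn (h : IsTransport A y w c) : ContinuousOn c (Icc 0 1) :=
  fun t ht ↦ (h t ht).continuousWithinAt

theorem add_smul_mem_of_convex {S : Set E} (hS : Convex ℝ S) (hy : y ∈ S) (hw : y + w ∈ S) {t : ℝ}
    (ht : t ∈ Icc (0 : ℝ) 1) : y + t • w ∈ S :=
  hS.add_smul_mem hy hw ht

/-- Since `C * ‖w‖ ≤ 1 / 2`, the right-hand side is at most `‖g‖` in norm on the ball of radius
`‖g‖` around `g`, so Picard–Lindelöf applies on the whole of `[0, 1]`, for every `g`. -/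
theorem exists_isTransport [CompleteSpace V] {S : Set E} (hS : Convex ℝ S)
    (hA : ContinuousOn A S) {C : ℝ} (hC : ∀ x ∈ S, ‖A x‖ ≤ C) (hy : y ∈ S) (hyw : y + w ∈ S)
    (hw : C * ‖w‖ ≤ 1 / 2) (g : V) :
    ∃ c : ℝ → V, c 0 = g ∧ IsTransport A y w c := by
  have hb : ∀ t ∈ Icc (0 : ℝ) 1, ‖A (y + t • w) w‖ ≤ 1 / 2 := fun t ht ↦
    (((A (y + t • w)).le_opNorm w).trans
      (by gcongr; exact hC _ (add_smul_mem_of_convex hS hy hyw ht))).trans hw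
  have hPL : IsPicardLindelof (fun t g ↦ A (y + t • w) w g) (tmin := 0) (tmax := 1)
      ⟨0, by simp⟩ g ‖g‖₊ 0 ‖g‖₊ 1 := by
    refine ⟨fun t ht ↦ ?_, fun x _ ↦ ?_, fun t ht x hx ↦ ?_, by simp⟩
    · refine ((A (y + t • w) w).lipschitz.weaken ?_).lipschitzOnWith
      rw [← NNReal.coe_le_coe]
      exact (hb t ht).trans (by norm_num)
    · have h1 : ContinuousOn (fun t : ℝ ↦ A (y + t • w)) (Icc 0 1) :=
        hA.comp (by fun_prop) (fun t ht ↦ add_smul_mem_of_convex hS hy hyw ht)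
      exact (h1.clm_apply continuousOn_const).clm_apply continuousOn_const
    · have h1 : ‖x‖ ≤ 2 * ‖g‖ := by
        have h2 : ‖x - g‖ ≤ ‖g‖ := by simpa [dist_eq_norm] using hx
        have h3 := norm_le_norm_add_norm_sub' x g
        linarith
      calc ‖A (y + t • w) w x‖ ≤ ‖A (y + t • w) w‖ * ‖x‖ := (A (y + t • w) w).le_opNorm x
        _ ≤ 1 / 2 * (2 * ‖g‖) := mul_le_mul (hb t ht) h1 (norm_nonneg _) (by norm_num)
        _ = _ := by simp
  exact hPL.exists_eq_forall_mem_Icc_hasDerivWithinAt₀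

theorem IsTransport.eqOn {C : ℝ} (hC : ∀ t ∈ Icc (0 : ℝ) 1, ‖A (y + t • w)‖ ≤ C) {c' : ℝ → V}
    (h : IsTransport A y w c) (h' : IsTransport A y w c') (h0 : c 0 = c' 0) :
    EqOn c c' (Icc 0 1) := by
  refine ODE_solution_unique_of_mem_Icc_right (v := fun t g ↦ A (y + t • w) w g)
    (s := fun _ ↦ univ) (K := (C * ‖w‖).toNNReal) (fun t ht ↦ ?_) h.continuousOn
    (fun t ht ↦ (h t (Ico_subset_Icc_self ht)).mono_of_mem_nhdsWithin (Icc_mem_nhdsGE_of_mem ht))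
    (fun _ _ ↦ trivial) h'.continuousOn
    (fun t ht ↦ (h' t (Ico_subset_Icc_self ht)).mono_of_mem_nhdsWithin (Icc_mem_nhdsGE_of_mem ht))
    (fun _ _ ↦ trivial) h0
  refine ((A (y + t • w) w).lipschitz.weaken ?_).lipschitzOnWith
  rw [← NNReal.coe_le_coe]
  refine le_trans ?_ (Real.le_coe_toNNReal _)
  refine ((A (y + t • w)).le_opNorm w).trans ?_
  gcongr
  exact hC t (Ico_subset_Icc_self ht)

theorem IsTransport.reverse (h : IsTransport A y w c) :
    IsTransport A (y + w) (-w) (fun t ↦ c (1 - t)) := by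
  intro t ht
  have ht' : 1 - t ∈ Icc (0 : ℝ) 1 := ⟨by linarith [ht.2], by linarith [ht.1]⟩
  have h1 : HasDerivWithinAt (fun s : ℝ ↦ 1 - s) (-1) (Icc 0 1) t :=
    ((hasDerivAt_id t).const_sub 1).hasDerivWithinAt
  have := HasDerivWithinAt.scomp (h := fun s : ℝ ↦ 1 - s) t (h (1 - t) ht') h1
    (fun s hs ↦ ⟨by linarith [hs.2], by linarith [hs.1]⟩)
  have e : y + w + t • -w = y + (1 - t) • w := by module
  rw [e]
  simpa [Function.comp_def] using! this

/-- `s` solves the equation `ds = A s` at the point `y`. -/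
def IsFlatAt (A : E → E →L[ℝ] V →L[ℝ] V) (s : E → V) (y : E) : Prop :=
  HasFDerivAt s ((A y).flip (s y)) y

theorem isTransport_of_isFlatAt {s : E → V} (h : ∀ t ∈ Icc (0 : ℝ) 1, IsFlatAt A s (y + t • w)) :
    IsTransport A y w (fun t ↦ s (y + t • w)) := by
  intro t ht
  have h1 : HasDerivAt (fun t : ℝ ↦ y + t • w) w t := by
    simpa using ((hasDerivAt_id t).smul_const w).const_add y
  exact (HasFDerivAt.comp_hasDerivAt (f := fun t : ℝ ↦ y + t • w) t (h t ht) h1).hasDerivWithinAt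

theorem eqOn_of_isFlatAt {S : Set E} (hS : Convex ℝ S) {C : ℝ} (hC : ∀ x ∈ S, ‖A x‖ ≤ C)
    {s s' : E → V} (h : ∀ x ∈ S, IsFlatAt A s x) (h' : ∀ x ∈ S, IsFlatAt A s' x)
    {x₁ : E} (hx₁ : x₁ ∈ S) (he : s x₁ = s' x₁) : EqOn s s' S := by
  intro x hx
  have hm : ∀ t ∈ Icc (0 : ℝ) 1, x₁ + t • (x - x₁) ∈ S := fun t ht ↦
    add_smul_mem_of_convex hS hx₁ (by simpa using hx) ht
  have := (isTransport_of_isFlatAt fun t ht ↦ h _ (hm t ht)).eqOn (fun t ht ↦ hC _ (hm t ht))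
    (isTransport_of_isFlatAt fun t ht ↦ h' _ (hm t ht)) (by simpa using he)
    (right_mem_Icc.2 zero_le_one)
  simpa using this

/-- Bootstrapping: if `s` is `C^n`, then so is its derivative `A s`, and `s` is `C^(n+1)`. -/
theorem contDiffOn_of_isFlatAt [FiniteDimensional ℝ E] {Ω : Set E} (hΩ : IsOpen Ω) (hA : ContDiffOn ℝ ∞ A Ω) {s : E → V}
    (h : ∀ x ∈ Ω, IsFlatAt A s x) : ContDiffOn ℝ ∞ s Ω := by
  rw [contDiffOn_infty]
  intro n
  induction n with
  | zero => exact contDiffOn_zero.2 fun x hx ↦ (h x hx).continuousAt.continuousWithinAt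
  | succ n ih =>
    push_cast
    rw [contDiffOn_succ_iff_fderiv_of_isOpen hΩ]
    refine ⟨fun x hx ↦ (h x hx).differentiableAt.differentiableWithinAt, by simp, ?_⟩
    have h1 : ContDiffOn ℝ n (fun x ↦ (A x).flip (s x)) Ω := by
      exact contDiffOn_clm_apply.2 fun u ↦
        ((contDiffOn_infty.1 hA n).clm_apply contDiffOn_const).clm_apply ih
    exact h1.congr fun x hx ↦ (h x hx).fderiv

/-- The curvature of the equation `ds = A s` vanishes on `g` at the point `y`. -/
def IsIntegrableAt (A : E → E →L[ℝ] V →L[ℝ] V) (y : E) (g : V) : Prop :=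
  ∀ u v : E, fderiv ℝ A y u v g + A y v (A y u g) = fderiv ℝ A y v u g + A y u (A y v g)

end LinearTransport

/-! ### Differentiability of radial transport when the curvature vanishes. -/

section RadialTransport
open Filter Topology Metric

variable {E : Type*} [NormedAddCommGroup E] [NormedSpace ℝ E]
  {V : Type*} [NormedAddCommGroup V] [NormedSpace ℝ V]
  {A : E → E →L[ℝ] V →L[ℝ] V}

/-- The algebraic estimate behind `isFlatAt_of_isTransport`: here `a`, `a'` are the values of `A` at
two points with difference `τ` and `D` is the derivative of `A` in the direction `τ`. -/
theorem norm_variation_le {a a' D : E →L[ℝ] V →L[ℝ] V} {Dw : V} {τ w u : E} {g : V} {C : ℝ}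
    (hτ : ‖τ‖ ≤ ‖u‖) (ha : ‖a‖ ≤ C) (ha' : ‖a'‖ ≤ C) (h1 : ‖a' - a‖ ≤ C * ‖u‖)
    (h2 : ‖a' - a - D‖ ≤ C * ‖u‖ ^ 2)
    (hint : Dw + a τ (a w g) = D w g + a w (a τ g)) :
    ‖a' (w + u) (g + a τ g) - (a w g + (Dw + a u g + a τ (a w g)))‖ ≤
      (C * ‖w‖ + C + C * C * ‖w‖ + C * C) * ‖g‖ * ‖u‖ ^ 2 := by
  -- The hypothesis `hint` trades `a τ (a w g)` for `a w (a τ g)`; this removes the first-order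
  -- terms, and each of the four remaining ones is of second order in `u`.
  have e : a' (w + u) (g + a τ g) - (a w g + (Dw + a u g + a τ (a w g))) =
      (a' - a - D) w g + (a' - a) u g + (a' - a) w (a τ g) + a' u (a τ g) := by
    have : Dw = D w g + a w (a τ g) - a τ (a w g) := eq_sub_of_add_eq hint
    simp only [this, map_add, add_apply, sub_apply]
    abel
  have bd : ∀ (b : E →L[ℝ] V →L[ℝ] V) (x : E) (z : V) {β ξ ζ : ℝ}, ‖b‖ ≤ β → ‖x‖ ≤ ξ → ‖z‖ ≤ ζ →
      ‖b x z‖ ≤ β * ξ * ζ := fun b x z β ξ ζ hb hx hz ↦ by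
    have hβ : 0 ≤ β := le_trans (norm_nonneg b) hb
    have hξ : 0 ≤ ξ := (norm_nonneg _).trans hx
    exact (b.le_opNorm₂ x z).trans (by gcongr)
  have hz : ‖a τ g‖ ≤ C * ‖u‖ * ‖g‖ := bd a τ g ha hτ le_rfl
  rw [e]
  refine (norm_add_le _ _).trans ((add_le_add ((norm_add_le _ _).trans
    (add_le_add ((norm_add_le _ _).trans (add_le_add (bd _ w g h2 le_rfl le_rfl)
    (bd _ u g h1 le_rfl le_rfl))) (bd _ w _ h1 le_rfl hz))) (bd _ u _ ha' le_rfl hz)).trans ?_)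
  apply le_of_eq
  ring

/-- If parallel transport is known over all segments issuing from `y₀` and the curvature vanishes
along one of them, then the endpoint depends differentiably on the segment there. -/
theorem isFlatAt_of_isTransport {Ω : Set E} {y₀ y : E} {r : ℝ} (hΩ : IsOpen Ω)
    (hA : ContDiffOn ℝ ∞ A Ω) [ProperSpace E] (hr : closedBall y₀ r ⊆ Ω) (hy : y ∈ ball y₀ r)
    {g : V} {s : E → V} {c : E → ℝ → V}
    (hc0 : ∀ z ∈ ball y₀ r, c z 0 = g) (hc1 : ∀ z ∈ ball y₀ r, c z 1 = s z)
    (hc : ∀ z ∈ ball y₀ r, IsTransport A y₀ (z - y₀) (c z))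
    (hint : ∀ t ∈ Icc (0 : ℝ) 1, IsIntegrableAt A (y₀ + t • (y - y₀)) (c y t)) :
    IsFlatAt A s y := by
  set w := y - y₀ with hw
  obtain ⟨C, hC, hb0, hb1, hb2⟩ := exists_taylor_bounds hΩ (isCompact_closedBall y₀ r)
    (convex_closedBall y₀ r) hr hA
  obtain ⟨m, hm⟩ := isCompact_Icc.exists_bound_of_continuousOn (hc y hy).continuousOn
  have hm0 : 0 ≤ m := (norm_nonneg _).trans (hm 0 (by simp))
  have hmem : ∀ z ∈ ball y₀ r, ∀ t ∈ Icc (0 : ℝ) 1, y₀ + t • (z - y₀) ∈ closedBall y₀ r :=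
    fun z hz t ht ↦ ball_subset_closedBall (add_smul_mem_of_convex (convex_ball _ _)
      (mem_ball_self (nonempty_ball.1 ⟨y, hy⟩)) (by simpa using hz) ht)
  -- `K` bounds `A` applied to the direction `w + u` for `‖u‖ ≤ 1`; `M` is the constant of
  -- `norm_variation_le` with `m` as bound for the transported values.
  set K : ℝ := C * (‖w‖ + 1) with hK
  set M : ℝ := (C * ‖w‖ + C + C * C * ‖w‖ + C * C) * m with hM
  have hKpos : 0 < K := by positivity
  have hM0 : 0 ≤ M := by positivity
  have main : ∀ u : E, y + u ∈ ball y₀ r → ‖u‖ ≤ 1 →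
      ‖s (y + u) - s y - A y u (s y)‖ ≤ gronwallBound 0 K (M * ‖u‖ ^ 2) 1 := by
    intro u hu hu1
    have hyu : y + u - y₀ = w + u := by rw [hw]; abel
    have hcu := hc _ hu
    have hcy := hc _ hy
    rw [hyu] at hcu
    set yt : ℝ → E := fun t ↦ y₀ + t • w with hyt
    have hyt' : ∀ t, y₀ + t • (w + u) = yt t + t • u := fun t ↦ by simp only [hyt]; module
    have hmem1 : ∀ t ∈ Icc (0 : ℝ) 1, yt t ∈ closedBall y₀ r := hmem y hy
    have hmem2 : ∀ t ∈ Icc (0 : ℝ) 1, yt t + t • u ∈ closedBall y₀ r := fun t ht ↦ by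
      have := hmem _ hu t ht
      rwa [hyu, hyt'] at this
    -- First-order guess for the transport over the varied segment ending at `y + u`. By vanishing
    -- curvature it solves the varied equation up to an error `M * ‖u‖ ^ 2`, so Gronwall bounds its
    -- distance to the true transport by a multiple of `‖u‖ ^ 2`; at `t = 1` this is the derivative
    -- of `s`.
    set k : ℝ → V := fun t ↦ c y t + A (yt t) (t • u) (c y t) with hk
    set Dw : ℝ → V := fun t ↦ fderiv ℝ A (yt t) w (t • u) (c y t)
    have hkd : ∀ t ∈ Icc (0 : ℝ) 1, HasDerivWithinAt k (A (yt t) w (c y t) +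
        (Dw t + A (yt t) u (c y t) + A (yt t) (t • u) (A (yt t) w (c y t)))) (Icc 0 1) t := by
      intro t ht
      have d1 : HasDerivAt yt w t := by
        simpa [hyt] using! ((hasDerivAt_id t).smul_const w).const_add y₀
      have d2 : HasDerivAt (fun t ↦ A (yt t)) (fderiv ℝ A (yt t) w) t :=
        HasFDerivAt.comp_hasDerivAt (f := yt) t ((hA.contDiffAt (hΩ.mem_nhds
          (hr (hmem1 t ht)))).differentiableAt (by simp)).hasFDerivAt d1
      have d3 : HasDerivAt (fun t : ℝ ↦ t • u) u t := by
        simpa using (hasDerivAt_id t).smul_const u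
      have d4 := ((d2.clm_apply d3).hasDerivWithinAt (s := Icc 0 1)).clm_apply (hcy t ht)
      simpa only [add_apply] using! (hcy t ht).add d4
    have hcut : ∀ t ∈ Icc (0 : ℝ) 1, HasDerivWithinAt (c (y + u))
        (A (yt t + t • u) (w + u) (c (y + u) t)) (Icc 0 1) t := fun t ht ↦ by
      simpa only [hyt'] using hcu t ht
    have hdiff := norm_le_gronwallBound_of_norm_deriv_right_le (f := c (y + u) - k) (δ := 0)
      (K := K) (ε := M * ‖u‖ ^ 2) (a := 0) (b := 1)
      (fun t ht ↦ ((hcut t ht).sub (hkd t ht)).continuousWithinAt)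
      (fun t ht ↦ ((hcut t (Ico_subset_Icc_self ht)).sub
        (hkd t (Ico_subset_Icc_self ht))).mono_of_mem_nhdsWithin (Icc_mem_nhdsGE_of_mem ht))
      (by simp [hk, hc0 _ hu, hc0 _ hy]) (fun t ht ↦ ?_) 1 (right_mem_Icc.2 zero_le_one)
    · have e1 : yt 1 = y := by simp [hyt, hw]
      have e2 : (c (y + u) - k) 1 = s (y + u) - s y - A y u (s y) := by
        simp only [hk, Pi.sub_apply, e1, one_smul, hc1 _ hu, hc1 _ hy]
        abel
      rwa [e2, sub_zero] at hdiff
    · have htI := Ico_subset_Icc_self ht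
      have hτ : ‖t • u‖ ≤ ‖u‖ := by
        rw [norm_smul, Real.norm_eq_abs, abs_of_nonneg htI.1]
        exact mul_le_of_le_one_left (norm_nonneg _) htI.2
      have hB1 := hb1 _ (hmem1 t htI) _ (hmem2 t htI)
      have hB2 := hb2 _ (hmem1 t htI) _ (hmem2 t htI)
      rw [add_sub_cancel_left] at hB1 hB2
      have hv := norm_variation_le (w := w) (g := c y t) (Dw := Dw t) hτ
        (hb0 _ (hmem1 t htI)) (hb0 _ (hmem2 t htI))
        (hB1.trans (by gcongr)) (hB2.trans (by gcongr)) (hint t htI w (t • u))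
      have e3 : A (yt t + t • u) (w + u) (c (y + u) t) - (A (yt t) w (c y t) +
          (Dw t + A (yt t) u (c y t) + A (yt t) (t • u) (A (yt t) w (c y t)))) =
          A (yt t + t • u) (w + u) ((c (y + u) - k) t) +
          (A (yt t + t • u) (w + u) (c y t + A (yt t) (t • u) (c y t)) - (A (yt t) w (c y t) +
          (Dw t + A (yt t) u (c y t) + A (yt t) (t • u) (A (yt t) w (c y t))))) := by
        simp only [hk, Pi.sub_apply, map_sub]
        abel
      rw [e3]
      refine (norm_add_le _ _).trans (add_le_add ?_ (hv.trans ?_))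
      · refine ((A (yt t + t • u)).le_opNorm₂ _ _).trans ?_
        refine mul_le_mul_of_nonneg_right (mul_le_mul (hb0 _ (hmem2 t htI))
          ((norm_add_le _ _).trans (by gcongr)) (norm_nonneg _) hC.le) (norm_nonneg _)
      · rw [hM]
        gcongr
        exact hm t htI
  set B := M / K * (Real.exp (K * 1) - 1) with hB
  have hgb : ∀ u : E, gronwallBound 0 K (M * ‖u‖ ^ 2) 1 = B * ‖u‖ ^ 2 := fun u ↦ by
    rw [gronwallBound_of_K_ne_0 hKpos.ne', hB]
    ring
  rw [IsFlatAt, hasFDerivAt_iff_isLittleO_nhds_zero]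
  have hO : (fun u ↦ s (y + u) - s y - (A y).flip (s y) u) =O[𝓝 0] fun u ↦ ‖u‖ ^ 2 := by
    refine Asymptotics.IsBigO.of_bound B ?_
    have h1 : ∀ᶠ u in 𝓝 (0 : E), y + u ∈ ball y₀ r := by
      have : Tendsto (fun u ↦ y + u) (𝓝 0) (𝓝 (y + 0)) :=
        (continuous_const.add continuous_id).tendsto 0
      rw [add_zero] at this
      exact this.eventually (isOpen_ball.mem_nhds hy)
    have h2 : ∀ᶠ u in 𝓝 (0 : E), ‖u‖ ≤ 1 := by
      filter_upwards [closedBall_mem_nhds (0 : E) one_pos] with u hu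
      simpa using hu
    filter_upwards [h1, h2] with u hu hu1
    have := main u hu hu1
    rw [hgb] at this
    simpa using this
  refine hO.trans_isLittleO ?_
  exact ((Asymptotics.isLittleO_pow_id (𝕜 := ℝ) (n := 2) (by norm_num)).comp_tendsto
    (tendsto_norm_zero (E := E))).of_norm_right

end RadialTransport

/-! ### Local flat sections with values in an invariant set. -/

section FlatSections
open Filter Topology Metric

variable {E : Type*} [NormedAddCommGroup E] [NormedSpace ℝ E] [FiniteDimensional ℝ E]
  {V : Type*} [NormedAddCommGroup V] [NormedSpace ℝ V]
  {A : E → E →L[ℝ] V →L[ℝ] V} {Ω : Set E} {y₀ : E} {r : ℝ}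

theorem eqOn_ball_of_isFlatAt (hA : ContDiffOn ℝ ∞ A Ω) (hr : closedBall y₀ r ⊆ Ω) {s s' : E → V}
    (h : ∀ x ∈ ball y₀ r, IsFlatAt A s x) (h' : ∀ x ∈ ball y₀ r, IsFlatAt A s' x)
    {x₁ : E} (hx₁ : x₁ ∈ ball y₀ r) (he : s x₁ = s' x₁) : EqOn s s' (ball y₀ r) := by
  have := FiniteDimensional.proper ℝ E
  obtain ⟨C, hC⟩ := exists_norm_bound hA (isCompact_closedBall y₀ r) hr
  exact eqOn_of_isFlatAt (convex_ball y₀ r) (fun x hx ↦ hC x (ball_subset_closedBall hx)) h h'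
    hx₁ he

/-- Around every point there are balls in which parallel transport exists over all segments. -/
theorem exists_ball_transport [CompleteSpace V] (hΩ : IsOpen Ω) (hA : ContDiffOn ℝ ∞ A Ω)
    (hy₀ : y₀ ∈ Ω) :
    ∃ r > 0, closedBall y₀ r ⊆ Ω ∧ ∀ y ∈ ball y₀ r, ∀ z ∈ ball y₀ r, ∀ g : V,
      ∃ c : ℝ → V, c 0 = g ∧ IsTransport A y (z - y) c := by
  have := FiniteDimensional.proper ℝ E
  obtain ⟨R, hR, hRΩ⟩ := nhds_basis_closedBall.mem_iff.1 (hΩ.mem_nhds hy₀)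
  obtain ⟨C, hC⟩ := exists_norm_bound hA (isCompact_closedBall y₀ R) hRΩ
  have hC0 : 0 ≤ C := le_trans (norm_nonneg (A y₀)) (hC y₀ (mem_closedBall_self hR.le))
  -- Two points of this ball are at distance at most `1 / (2 * (C + 1))`, which meets the smallness
  -- condition of `exists_isTransport`.
  refine ⟨min R (1 / (4 * (C + 1))), by positivity,
    (closedBall_subset_closedBall (min_le_left _ _)).trans hRΩ, fun y hy z hz g ↦ ?_⟩
  set r := min R (1 / (4 * (C + 1))) with hr
  have hbR : ball y₀ r ⊆ closedBall y₀ R :=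
    (ball_subset_ball (min_le_left _ _)).trans ball_subset_closedBall
  refine exists_isTransport (convex_ball y₀ r) (hA.continuousOn.mono (hbR.trans hRΩ))
    (fun x hx ↦ hC x (hbR hx)) hy (by simpa using hz) ?_ g
  have h1 : ‖z - y‖ ≤ 2 * (1 / (4 * (C + 1))) := by
    rw [← dist_eq_norm]
    have h2 := dist_triangle_right z y y₀
    have h3 : dist z y₀ < 1 / (4 * (C + 1)) := lt_of_lt_of_le hz (min_le_right _ _)
    have h4 : dist y y₀ < 1 / (4 * (C + 1)) := lt_of_lt_of_le hy (min_le_right _ _)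
    linarith
  calc C * ‖z - y‖ ≤ (C + 1) * (2 * (1 / (4 * (C + 1)))) := by gcongr; linarith
    _ = 1 / 2 := by field_simp; norm_num

/-- Let `K` be a relatively closed set of values of sections which is, to first order, invariant
under parallel transport. Then it is invariant under parallel transport over segments. -/
theorem IsTransport.mem_of_subtangent [FiniteDimensional ℝ V] (hΩ : IsOpen Ω)
    (hA : ContDiffOn ℝ ∞ A Ω) {K : Set (E × V)}
    (hK : ∀ x : E × V, x.1 ∈ Ω → x ∈ closure K → x ∈ K)
    (hsub : ∀ x ∈ K, x.1 ∈ Ω → ∀ u : E, ∃ q : ℝ → E × V, q 0 = x ∧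
      HasDerivWithinAt q (u, A x.1 u x.2) (Ici 0) 0 ∧ ∀ᶠ h in 𝓝[>] 0, q h ∈ K)
    {y w : E} {c : ℝ → V} (hc : IsTransport A y w c) (hw : ∀ t ∈ Icc (0 : ℝ) 1, y + t • w ∈ Ω)
    (h0 : (y, c 0) ∈ K) : ∀ t ∈ Icc (0 : ℝ) 1, (y + t • w, c t) ∈ K := by
  have := FiniteDimensional.proper ℝ (E × V)
  -- Adding the base point to the state makes the transport equation autonomous: its solutions are
  -- trajectories of the horizontal lift of the constant field `w`.
  refine _root_.mem_of_subtangent (X := fun x : E × V ↦ (w, A x.1 w x.2))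
    (hΩ.preimage continuous_fst) (fun x hx ↦ hK x hx) (fun x hx ↦ ?_)
    (fun x hx ↦ hsub x hx.1 hx.2 w) (fun t ht ↦ ?_) hw (by simpa using h0)
  · have h1 : ContDiffAt ℝ 1 A x.1 := (hA.contDiffAt (hΩ.mem_nhds hx)).of_le (by simp)
    have h2 : ContDiffAt ℝ 1 (fun x : E × V ↦ A x.1) x := h1.comp x contDiffAt_fst
    exact contDiffAt_const.prodMk ((h2.clm_apply contDiffAt_const).clm_apply contDiffAt_snd)
  · have h1 : HasDerivAt (fun t : ℝ ↦ y + t • w) w t := by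
      simpa using ((hasDerivAt_id t).smul_const w).const_add y
    exact h1.hasDerivWithinAt.prodMk (hc t ht)

/-- **Local sections.** Let `K` be a relatively closed set of values of sections which is, to first
order, invariant under parallel transport for the equation `ds = A s`, and whose elements are
annihilated by the curvature of this equation. Then through every element of `K` over a small ball
there is a solution with values in `K`. -/
theorem exists_flat_sections [FiniteDimensional ℝ V] (hΩ : IsOpen Ω)
    (hA : ContDiffOn ℝ ∞ A Ω) {K : Set (E × V)}
    (hK : ∀ x : E × V, x.1 ∈ Ω → x ∈ closure K → x ∈ K)
    (hsub : ∀ x ∈ K, x.1 ∈ Ω → ∀ u : E, ∃ q : ℝ → E × V, q 0 = x ∧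
      HasDerivWithinAt q (u, A x.1 u x.2) (Ici 0) 0 ∧ ∀ᶠ h in 𝓝[>] 0, q h ∈ K)
    (hint : ∀ x ∈ K, x.1 ∈ Ω → IsIntegrableAt A x.1 x.2) (hy₀ : y₀ ∈ Ω) :
    ∃ r > 0, closedBall y₀ r ⊆ Ω ∧ ∃ σ : V → E → V,
      (∀ g, (y₀, g) ∈ K → σ g y₀ = g ∧
        ∀ y ∈ ball y₀ r, (y, σ g y) ∈ K ∧ IsFlatAt A (σ g) y) ∧
      ∀ y ∈ ball y₀ r, ∀ g, (y, g) ∈ K → ∃ g₀, (y₀, g₀) ∈ K ∧ σ g₀ y = g := by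
  have := FiniteDimensional.proper ℝ E
  have := FiniteDimensional.complete ℝ V
  obtain ⟨r, hr, hrΩ, hT⟩ := exists_ball_transport hΩ hA hy₀
  have hy₀r : y₀ ∈ ball y₀ r := mem_ball_self hr
  have hbΩ : ball y₀ r ⊆ Ω := ball_subset_closedBall.trans hrΩ
  obtain ⟨C, hC⟩ := exists_norm_bound hA (isCompact_closedBall y₀ r) hrΩ
  have hline : ∀ y ∈ ball y₀ r, ∀ z ∈ ball y₀ r, ∀ t ∈ Icc (0 : ℝ) 1,
      y + t • (z - y) ∈ ball y₀ r := fun y hy z hz t ht ↦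
    add_smul_mem_of_convex (convex_ball y₀ r) hy (by simpa using hz) ht
  have hT' : ∀ g : V, ∀ z : E, ∃ c : ℝ → V, z ∈ ball y₀ r →
      c 0 = g ∧ IsTransport A y₀ (z - y₀) c := fun g z ↦ by
    by_cases hz : z ∈ ball y₀ r
    · obtain ⟨c, hc⟩ := hT y₀ hy₀r z hz g
      exact ⟨c, fun _ ↦ hc⟩
    · exact ⟨0, fun h ↦ absurd h hz⟩
  choose c hc using hT'
  have hcK : ∀ g, (y₀, g) ∈ K → ∀ y ∈ ball y₀ r, ∀ t ∈ Icc (0 : ℝ) 1,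
      (y₀ + t • (y - y₀), c g y t) ∈ K := fun g hg y hy ↦
    (hc g y hy).2.mem_of_subtangent hΩ hA hK hsub
      (fun t ht ↦ hbΩ (hline y₀ hy₀r y hy t ht)) (by rwa [(hc g y hy).1])
  -- The section through `g` is the endpoint of radial transport. Its curves stay in `K`, where the
  -- curvature vanishes, as `isFlatAt_of_isTransport` requires.
  refine ⟨r, hr, hrΩ, fun g y ↦ c g y 1, fun g hg ↦ ⟨?_, fun y hy ↦ ⟨?_, ?_⟩⟩, fun y hy g hg ↦ ?_⟩
  · have h1 : IsTransport A y₀ (y₀ - y₀) (fun _ ↦ g) := fun t _ ↦ by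
      simpa using hasDerivWithinAt_const t _ g
    exact (hc g y₀ hy₀r).2.eqOn
      (fun t ht ↦ hC _ (ball_subset_closedBall (hline y₀ hy₀r y₀ hy₀r t ht))) h1
      (hc g y₀ hy₀r).1 (right_mem_Icc.2 zero_le_one)
  · simpa using hcK g hg y hy 1 (right_mem_Icc.2 zero_le_one)
  · exact isFlatAt_of_isTransport hΩ hA hrΩ hy (fun z hz ↦ (hc g z hz).1) (fun z hz ↦ rfl)
      (fun z hz ↦ (hc g z hz).2) fun t ht ↦
        hint _ (hcK g hg y hy t ht) (hbΩ (hline y₀ hy₀r y hy t ht))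
  -- Transporting `g` back to the centre stays in `K` as well; by uniqueness, the section through
  -- the value obtained there returns to `g`.
  · obtain ⟨c', hc'0, hc'⟩ := hT y hy y₀ hy₀r g
    have h1 := hc'.mem_of_subtangent hΩ hA hK hsub
      (fun t ht ↦ hbΩ (hline y hy y₀ hy₀r t ht)) (by rwa [hc'0]) 1 (right_mem_Icc.2 zero_le_one)
    refine ⟨c' 1, by simpa using h1, ?_⟩
    have h2 := hc'.reverse
    rw [add_sub_cancel, neg_sub] at h2
    have := (hc (c' 1) y hy).2.eqOn
      (fun t ht ↦ hC _ (ball_subset_closedBall (hline y₀ hy₀r y hy t ht))) h2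
      (by simp [(hc (c' 1) y hy).1]) (right_mem_Icc.2 zero_le_one)
    simpa [hc'0] using this

end FlatSections

/-! ### The leaf topology and global sections over a simply connected space. -/

section Monodromy
open Filter Topology

variable {X : Type*} [TopologicalSpace X] {B : X → Type*}

/-- A family of local sections: for each `x₀` and each `f` in the fibre `K x₀` a section `σ x₀ f`
over the neighbourhood `U x₀` of `x₀`. Through each element of `K x` with `x ∈ U x₀` passes exactly
one of the sections `σ x₀ f`, and two sections of the family that agree at a point agree nearby. -/
structure IsLocalSectionFamily (K : ∀ x, Set (B x)) (U : X → Set X)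
    (σ : ∀ x₀, B x₀ → ∀ x, B x) : Prop where
  isOpen : ∀ x₀, IsOpen (U x₀)
  mem : ∀ x₀, x₀ ∈ U x₀
  self : ∀ x₀, ∀ f ∈ K x₀, σ x₀ f x₀ = f
  mapsTo : ∀ x₀, ∀ f ∈ K x₀, ∀ x ∈ U x₀, σ x₀ f x ∈ K x
  surj : ∀ x₀, ∀ x ∈ U x₀, ∀ g ∈ K x, ∃ f ∈ K x₀, σ x₀ f x = g
  inj : ∀ x₀, ∀ x ∈ U x₀, ∀ f ∈ K x₀, ∀ f' ∈ K x₀, σ x₀ f x = σ x₀ f' x → f = f'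
  eventually_eq : ∀ x₀, ∀ f ∈ K x₀, ∀ x₁, ∀ f' ∈ K x₁, ∀ x ∈ U x₀, x ∈ U x₁ →
    σ x₀ f x = σ x₁ f' x → ∀ᶠ y in 𝓝 x, σ x₀ f y = σ x₁ f' y

namespace IsLocalSectionFamily

variable {K : ∀ x, Set (B x)} {U : X → Set X} {σ : ∀ x₀, B x₀ → ∀ x, B x}

/-- The element of the total space given by a local section. -/
def lift (h : IsLocalSectionFamily K U σ) (x₀ : X) (p : U x₀ × K x₀) : Σ x, K x :=
  ⟨p.1, σ x₀ p.2 p.1, h.mapsTo x₀ _ p.2.2 _ p.1.2⟩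

/-- The leaf topology on the total space of a family of local sections. -/
abbrev topology (h : IsLocalSectionFamily K U σ) : TopologicalSpace (Σ x, K x) :=
  ⨆ x₀, TopologicalSpace.coinduced (h.lift x₀) (@instTopologicalSpaceProd _ _ _ ⊥)

/-- Each fibre `K x₀` carries the discrete topology, so openness can be tested on one sheet at a
time. -/
theorem isOpen_iff (h : IsLocalSectionFamily K U σ) {s : Set (Σ x, K x)} :
    IsOpen[h.topology] s ↔ ∀ x₀, ∀ f : K x₀, IsOpen {x : U x₀ | h.lift x₀ (x, f) ∈ s} := by
  rw [topology, isOpen_iSup_iff]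
  refine forall_congr' fun x₀ ↦ ?_
  let : TopologicalSpace (K x₀) := ⊥
  have : DiscreteTopology (K x₀) := ⟨rfl⟩
  rw [isOpen_coinduced]
  constructor
  · intro hs f
    exact hs.preimage (Continuous.prodMk_left f)
  · intro hs
    have : h.lift x₀ ⁻¹' s = ⋃ f : K x₀, {x : U x₀ | h.lift x₀ (x, f) ∈ s} ×ˢ {f} := by
      ext ⟨x, f⟩
      refine ⟨fun hx ↦ mem_iUnion.2 ⟨f, hx, rfl⟩, fun hx ↦ ?_⟩
      obtain ⟨f', hx, rfl⟩ := mem_iUnion.1 hx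
      exact hx
    rw [this]
    exact isOpen_iUnion fun f ↦ (hs f).prod (isOpen_discrete _)

/-- Sheets are open because two sections that agree at a point agree nearby: a sheet therefore meets
any other one in an open set of base points. -/
theorem isOpen_image (h : IsLocalSectionFamily K U σ) (x₀ : X) (f : K x₀) {N : Set (U x₀)}
    (hN : IsOpen N) : IsOpen[h.topology] ((fun x ↦ h.lift x₀ (x, f)) '' N) := by
  rw [h.isOpen_iff]
  intro x₁ f'
  rw [isOpen_iff_mem_nhds]
  rintro ⟨x, hx⟩ ⟨⟨x', hx'⟩, hxN, he⟩
  obtain rfl : x' = x := congrArg Sigma.fst he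
  have he' : σ x₀ f x' = σ x₁ f' x' := by
    have := (Sigma.mk.inj_iff.1 he).2
    exact congrArg Subtype.val (eq_of_heq this)
  have hev := h.eventually_eq x₀ f f.2 x₁ f' f'.2 x' hx' hx he'
  have hN' : (Subtype.val '' N) ∈ 𝓝 x' :=
    ((h.isOpen x₀).isOpenMap_subtype_val N hN).mem_nhds ⟨_, hxN, rfl⟩
  rw [mem_nhds_subtype_iff_nhdsWithin, mem_nhdsWithin_iff_exists_mem_nhds_inter]
  refine ⟨_, Filter.inter_mem hev hN', ?_⟩
  rintro z ⟨⟨hz1, ⟨z', hz'N, rfl⟩⟩, hz2⟩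
  refine ⟨⟨z', hz2⟩, ⟨z', hz'N, ?_⟩, rfl⟩
  exact Sigma.ext rfl (heq_of_eq (Subtype.ext hz1))

/-- `h.lift x₀` is a homeomorphism from `U x₀ × K x₀`, with discrete second factor, onto the
preimage of `U x₀`: `surj` gives the image, `inj` injectivity, and `isOpen_image` openness. -/
theorem isCoveringMap (h : IsLocalSectionFamily K U σ) :
    @IsCoveringMap _ X h.topology _ (Sigma.fst : (Σ x, K x) → X) := by
  let := h.topology
  intro x₀
  let : TopologicalSpace (K x₀) := ⊥
  have : DiscreteTopology (K x₀) := ⟨rfl⟩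
  refine IsEvenlyCovered.to_isEvenlyCovered_preimage (I := K x₀) ?_
  have hex : ∀ t : (Sigma.fst : (Σ x, K x) → X) ⁻¹' U x₀, ∃ f : K x₀,
      h.lift x₀ (⟨t.1.1, t.2⟩, f) = t := by
    rintro ⟨⟨x, g, hg⟩, hx⟩
    obtain ⟨f, hf, he⟩ := h.surj x₀ x hx g hg
    exact ⟨⟨f, hf⟩, Sigma.ext rfl (heq_of_eq (Subtype.ext he))⟩
  choose φ hφ using hex
  have hinj : Function.Injective (h.lift x₀) := by
    rintro ⟨⟨x, hx⟩, f⟩ ⟨⟨x', hx'⟩, f'⟩ he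
    obtain rfl : x = x' := congrArg Sigma.fst he
    have := congrArg Subtype.val (eq_of_heq (Sigma.mk.inj_iff.1 he).2)
    have := h.inj x₀ x hx f f.2 f' f'.2 this
    simp [Subtype.ext this]
  have hcont : Continuous (h.lift x₀) := continuous_iff_coinduced_le.2 (le_iSup
    (fun x₀ ↦ TopologicalSpace.coinduced (h.lift x₀) (@instTopologicalSpaceProd _ _ _ ⊥)) x₀)
  have hopen : IsOpenMap (h.lift x₀) := by
    intro s hs
    have : h.lift x₀ '' s = ⋃ f : K x₀, (fun x ↦ h.lift x₀ (x, f)) '' {x | (x, f) ∈ s} := by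
      ext t
      simp only [mem_image, Prod.exists, mem_iUnion, mem_ofPred_eq]
      exact exists_comm
    rw [this]
    exact isOpen_iUnion fun f ↦ h.isOpen_image x₀ f (hs.preimage (Continuous.prodMk_left f))
  have hrange : range (h.lift x₀) = Sigma.fst ⁻¹' U x₀ := by
    ext t
    exact ⟨by rintro ⟨p, rfl⟩; exact p.1.2, fun ht ↦ ⟨_, hφ ⟨t, ht⟩⟩⟩
  have hU : IsOpen ((Sigma.fst : (Σ x, K x) → X) ⁻¹' U x₀) := hrange ▸ hopen.isOpen_range
  let e : (U x₀ × K x₀) ≃ₜ range (h.lift x₀) :=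
    (Topology.IsOpenEmbedding.of_continuous_injective_isOpenMap hcont hinj hopen).toHomeomorph
  refine ⟨inferInstance, U x₀, h.mem x₀, h.isOpen x₀, hU,
    (Homeomorph.setCongr hrange.symm).trans e.symm, fun t ↦ ?_⟩
  obtain ⟨p, hp⟩ := e.surjective (Homeomorph.setCongr hrange.symm t)
  rw [Homeomorph.trans_apply, ← hp, Homeomorph.symm_apply_apply]
  exact congrArg (fun z ↦ z.1.1) hp

/-- **Monodromy**: over a simply connected space a family of local sections has a global one through
every element of the total space. -/
theorem exists_global_section [SimplyConnectedSpace X] [LocallyPathConnectedSpace X]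
    (h : IsLocalSectionFamily K U σ) (x₀ : X) {g : B x₀} (hg : g ∈ K x₀) :
    ∃ s : ∀ x, B x, s x₀ = g ∧ ∀ x, s x ∈ K x ∧ ∀ᶠ y in 𝓝 x, s y = σ x (s x) y := by
  let := h.topology
  -- A section of the covering is a lift of the identity map of `X`.
  obtain ⟨F, ⟨hF0, hF⟩, -⟩ := h.isCoveringMap.existsUnique_continuousMap_lifts
    (ContinuousMap.id X) x₀ ⟨x₀, g, hg⟩ rfl
  have hF' : ∀ x, (F x).1 = x := fun x ↦ congrFun hF x
  have hs : ∀ x, ∃ f : K x, F x = ⟨x, f⟩ := fun x ↦ by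
    rcases hy : F x with ⟨y, f⟩
    obtain rfl : y = x := by rw [← hF' x, hy]
    exact ⟨f, rfl⟩
  choose s hs using hs
  have hss : ∀ x, σ x (s x) x = s x := fun x ↦ h.self x (s x) (s x).2
  refine ⟨fun x ↦ s x, ?_, fun x ↦ ⟨(s x).2, ?_⟩⟩
  · have := (hs x₀).symm.trans hF0
    exact congrArg Subtype.val (eq_of_heq (Sigma.mk.inj_iff.1 this).2)
  -- The sheet of `σ x (s x)` is an open neighbourhood of `F x`, so by continuity the lift runs in
  -- this sheet near `x`.
  · have hop := h.isOpen_image x (s x) isOpen_univ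
    have hmem : F x ∈ (fun y ↦ h.lift x (y, s x)) '' univ :=
      ⟨⟨x, h.mem x⟩, trivial, by rw [hs]; exact Sigma.ext rfl (heq_of_eq (Subtype.ext (hss x)))⟩
    filter_upwards [F.continuous.continuousAt (hop.mem_nhds hmem)] with y hy
    obtain ⟨⟨y', hy'⟩, -, he⟩ := hy
    rw [hs] at he
    obtain rfl : y' = y := congrArg Sigma.fst he
    exact (congrArg Subtype.val (eq_of_heq (Sigma.mk.inj_iff.1 he).2)).symm

end IsLocalSectionFamily

end Monodromy

/-! ### Parallel bilinear forms in coordinates. -/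

section Forms
open Filter Topology Metric

variable {E : Type*} [NormedAddCommGroup E] [NormedSpace ℝ E]

/-- The derivative of the action of `GL(E)` on bilinear forms: `g ↦ g(B·, ·) + g(·, B·)`. -/
def formAction (E : Type*) [NormedAddCommGroup E] [NormedSpace ℝ E] :
    (E →L[ℝ] E) →L[ℝ] (E →L[ℝ] E →L[ℝ] ℝ) →L[ℝ] (E →L[ℝ] E →L[ℝ] ℝ) :=
  (ContinuousLinearMap.compL ℝ E E (E →L[ℝ] ℝ)).flip +
    (ContinuousLinearMap.compL ℝ E (E →L[ℝ] ℝ) (E →L[ℝ] ℝ)).comp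
      (ContinuousLinearMap.compL ℝ E E ℝ).flip

theorem formAction_apply (B : E →L[ℝ] E) (g : E →L[ℝ] E →L[ℝ] ℝ) (ξ η : E) :
    formAction E B g ξ η = g (B ξ) η + g ξ (B η) := rfl

/-- The equation of parallel bilinear forms of a connection with Christoffel symbol `Γ`. -/
def formConnection (Γ : E → E →L[ℝ] E →L[ℝ] E) (y : E) :
    E →L[ℝ] (E →L[ℝ] E →L[ℝ] ℝ) →L[ℝ] (E →L[ℝ] E →L[ℝ] ℝ) :=
  (formAction E).comp (Γ y)

theorem formConnection_apply (Γ : E → E →L[ℝ] E →L[ℝ] E) (y u : E) (g : E →L[ℝ] E →L[ℝ] ℝ)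
    (ξ η : E) : formConnection Γ y u g ξ η = g (Γ y u ξ) η + g ξ (Γ y u η) := rfl

/-- The curvature of a connection with Christoffel symbol `Γ`. -/
def christoffelCurvature (Γ : E → E →L[ℝ] E →L[ℝ] E) (y u v ξ : E) : E :=
  fderiv ℝ Γ y u v ξ - fderiv ℝ Γ y v u ξ + (Γ y u (Γ y v ξ) - Γ y v (Γ y u ξ))

theorem contDiffOn_formConnection {Γ : E → E →L[ℝ] E →L[ℝ] E} {Ω : Set E}
    (hΓ : ContDiffOn ℝ ∞ Γ Ω) : ContDiffOn ℝ ∞ (formConnection Γ) Ω :=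
  contDiffOn_const.clm_comp hΓ

theorem fderiv_const_comp {F G : Type*} [NormedAddCommGroup F] [NormedSpace ℝ F]
    [NormedAddCommGroup G] [NormedSpace ℝ G] (L : F →L[ℝ] G) {Γ : E → E →L[ℝ] F} {y : E}
    (hΓ : DifferentiableAt ℝ Γ y) (u v : E) :
    fderiv ℝ (fun y ↦ L.comp (Γ y)) y u v = L (fderiv ℝ Γ y u v) := by
  have h := (hasFDerivAt_const L y).clm_comp hΓ.hasFDerivAt
  rw [h.fderiv]
  simp

theorem fderiv_formConnection {Γ : E → E →L[ℝ] E →L[ℝ] E} {y : E} (hΓ : DifferentiableAt ℝ Γ y)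
    (u v : E) : fderiv ℝ (formConnection Γ) y u v = formAction E (fderiv ℝ Γ y u v) :=
  fderiv_const_comp (formAction E) hΓ u v

/-- In the commutator of the two form operators the mixed terms `g (Γ u ξ) (Γ v η)` cancel, so the
induced curvature acts on `g` through the curvature of `Γ` in each slot. -/
theorem isIntegrableAt_formConnection {Γ : E → E →L[ℝ] E →L[ℝ] E} {y : E}
    (hΓ : DifferentiableAt ℝ Γ y) {g : E →L[ℝ] E →L[ℝ] ℝ}
    (hg : ∀ u v ξ η, g (christoffelCurvature Γ y u v ξ) η +
      g ξ (christoffelCurvature Γ y u v η) = 0) :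
    IsIntegrableAt (formConnection Γ) y g := by
  intro u v
  ext ξ η
  have := hg u v ξ η
  simp only [christoffelCurvature, map_add, map_sub, add_apply, sub_apply] at this
  rw [fderiv_formConnection hΓ, fderiv_formConnection hΓ]
  simp only [add_apply, formAction_apply, formConnection_apply]
  linarith

/-- Nondegeneracy is preserved along parallel bilinear forms. -/
theorem exists_ball_nondegenerate_of_isFlatAt [FiniteDimensional ℝ E]
    {Γ : E → E →L[ℝ] E →L[ℝ] E} {Ω : Set E}
    (hΩ : IsOpen Ω) (hΓ : ContDiffOn ℝ ∞ Γ Ω) {y₀ : E} (hy₀ : y₀ ∈ Ω) :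
    ∃ r > 0, ball y₀ r ⊆ Ω ∧ ∀ s : E → E →L[ℝ] E →L[ℝ] ℝ,
      (∀ x ∈ ball y₀ r, IsFlatAt (formConnection Γ) s x) →
      ∀ y ∈ ball y₀ r, ∀ z ∈ ball y₀ r, (∀ ξ, s y ξ = 0 → ξ = 0) → ∀ ξ, s z ξ = 0 → ξ = 0 := by
  have := FiniteDimensional.proper ℝ E
  have := FiniteDimensional.complete ℝ E
  have hΓ' : ContDiffOn ℝ ∞ (fun x ↦ -Γ x) Ω := hΓ.neg
  obtain ⟨r, hr, hrΩ, hT⟩ := exists_ball_transport hΩ hΓ' hy₀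
  obtain ⟨C, hC⟩ := exists_norm_bound hΓ (isCompact_closedBall y₀ r) hrΩ
  refine ⟨r, hr, ball_subset_closedBall.trans hrΩ, fun s hs y hy z hz hnd ξ hξ ↦ ?_⟩
  -- A kernel vector `ξ` at `z` is transported as a vector to `y`. It remains in the kernel of `s`,
  -- so it vanishes at `y`; reversing the transport gives `ξ = 0`.
  obtain ⟨c, hc0, hc⟩ := hT z hz y hy ξ
  set w := y - z with hw
  have hline : ∀ t ∈ Icc (0 : ℝ) 1, z + t • w ∈ ball y₀ r := fun t ht ↦
    add_smul_mem_of_convex (convex_ball y₀ r) hz (by simpa [hw] using hy) ht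
  have hbd : ∀ t ∈ Icc (0 : ℝ) 1, ‖Γ (z + t • w)‖ ≤ C := fun t ht ↦
    hC _ (ball_subset_closedBall (hline t ht))
  have hst := isTransport_of_isFlatAt fun t ht ↦ hs _ (hline t ht)
  -- The term of `ds` with `Γ` acting on `c` cancels against the derivative of `c`. What remains is
  -- linear in `s (c)`, which therefore stays `0`.
  have hd : ∀ t ∈ Icc (0 : ℝ) 1, HasDerivWithinAt (fun t ↦ s (z + t • w) (c t))
      ((s (z + t • w) (c t)).comp (Γ (z + t • w) w)) (Icc 0 1) t := fun t ht ↦ by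
    convert! (hst t ht).clm_apply (hc t ht) using 1
    ext η
    simp [formConnection_apply]
  have hzero := eq_zero_of_abs_deriv_le_mul_abs_self_of_eq_zero_right
    (f := fun t ↦ s (z + t • w) (c t)) (K := C * ‖w‖)
    (fun t ht ↦ (hd t ht).continuousWithinAt)
    (fun t ht ↦ (hd t (Ico_subset_Icc_self ht)).mono_of_mem_nhdsWithin (Icc_mem_nhdsGE_of_mem ht))
    (by simpa [hc0] using hξ) (fun t ht ↦ ?_) 1 (right_mem_Icc.2 zero_le_one)
  · have hc1 : c 1 = 0 := hnd _ (by simpa [hw] using hzero)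
    have h0 : IsTransport (fun x ↦ -Γ x) (z + w) (-w) (fun _ ↦ (0 : E)) := fun t _ ↦ by
      simpa using hasDerivWithinAt_const t _ (0 : E)
    have := hc.reverse.eqOn (C := C) (fun t ht ↦ ?_) h0 (by simpa using hc1)
      (right_mem_Icc.2 zero_le_one)
    · simpa [hc0] using this
    · have ht' : 1 - t ∈ Icc (0 : ℝ) 1 := ⟨by linarith [ht.2], by linarith [ht.1]⟩
      have e : z + w + t • -w = z + (1 - t) • w := by module
      rw [e, norm_neg]
      exact hbd _ ht'
  · have htI := Ico_subset_Icc_self ht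
    calc ‖(s (z + t • w) (c t)).comp (Γ (z + t • w) w)‖
        ≤ ‖s (z + t • w) (c t)‖ * ‖Γ (z + t • w) w‖ := ContinuousLinearMap.opNorm_comp_le _ _
      _ ≤ ‖s (z + t • w) (c t)‖ * (C * ‖w‖) := by
          gcongr
          exact ((Γ (z + t • w)).le_opNorm w).trans (by gcongr; exact hbd t htI)
      _ = _ := by ring

end Forms

/-! ### Functions and vector fields in a chart. -/

section ChartCoordinates

variable {E : Type*} [NormedAddCommGroup E] [NormedSpace ℝ E]
  {H : Type*} [TopologicalSpace H] {I : ModelWithCorners ℝ E H}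
  {M : Type*} [TopologicalSpace M] [ChartedSpace H M]
  {F : Type*} [NormedAddCommGroup F] [NormedSpace ℝ F]

theorem contMDiffAt_iff_contDiffAt_comp_extChartAt_symm [I.Boundaryless] {n : ℕ∞ω}
    [IsManifold I n M] {f : M → F} {x₀ x : M} (hx : x ∈ (chartAt H x₀).source) :
    ContMDiffAt I 𝓘(ℝ, F) n f x ↔
      ContDiffAt ℝ n (f ∘ (extChartAt I x₀).symm) (extChartAt I x₀ x) := by
  have hx' : x ∈ (extChartAt I x₀).source := by rwa [extChartAt_source]
  have hy := (extChartAt I x₀).map_source hx'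
  rw [← contMDiffAt_iff_contDiffAt]
  constructor
  · intro h
    have h2 := (contMDiffOn_extChartAt_symm (n := n) (I := I) x₀).contMDiffAt
      (((isOpen_extChartAt_target (I := I) x₀)).mem_nhds hy)
    refine ContMDiffAt.comp _ ?_ h2
    rwa [(extChartAt I x₀).left_inv hx']
  · intro h
    have h2 := contMDiffAt_extChartAt' (n := n) (I := I) hx
    refine (ContMDiffAt.comp x h h2).congr_of_eventuallyEq ?_
    filter_upwards [(isOpen_extChartAt_source (I := I) x₀).mem_nhds hx'] with z hz
    exact congrArg f ((extChartAt I x₀).left_inv hz).symm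

theorem mdifferentiableAt_iff_differentiableAt_comp_extChartAt_symm [I.Boundaryless]
    [IsManifold I 1 M] {f : M → F} {x₀ x : M} (hx : x ∈ (chartAt H x₀).source) :
    MDifferentiableAt I 𝓘(ℝ, F) f x ↔
      DifferentiableAt ℝ (f ∘ (extChartAt I x₀).symm) (extChartAt I x₀ x) := by
  have hx' : x ∈ (extChartAt I x₀).source := by rwa [extChartAt_source]
  have hy := (extChartAt I x₀).map_source hx'
  rw [← mdifferentiableAt_iff_differentiableAt]
  constructor
  · intro h
    have h2 := ((contMDiffOn_extChartAt_symm (n := 1) (I := I) x₀).contMDiffAt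
      (((isOpen_extChartAt_target (I := I) x₀)).mem_nhds hy)).mdifferentiableAt one_ne_zero
    refine MDifferentiableAt.comp _ ?_ h2
    rwa [(extChartAt I x₀).left_inv hx']
  · intro h
    have h2 := mdifferentiableAt_extChartAt (I := I) hx
    refine (MDifferentiableAt.comp x h h2).congr_of_eventuallyEq ?_
    filter_upwards [(isOpen_extChartAt_source (I := I) x₀).mem_nhds hx'] with z hz
    exact congrArg f ((extChartAt I x₀).left_inv hz).symm

variable [IsManifold I 1 M]

variable (I) in
/-- The coordinates of a tangent vector at `x` in the chart centred at `x₀`. -/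
def tangentCoord (x₀ x : M) : TangentSpace I x →L[ℝ] E :=
  (trivializationAt E (TangentSpace I : M → Type _) x₀).continuousLinearMapAt ℝ x

variable (I) in
/-- The tangent vector at `x` with given coordinates in the chart centred at `x₀`. -/
def tangentCoordSymm (x₀ x : M) : E →L[ℝ] TangentSpace I x :=
  (trivializationAt E (TangentSpace I : M → Type _) x₀).symmL ℝ x

variable {x₀ x : M}

theorem tangentCoord_eq (hx : x ∈ (chartAt H x₀).source) (v : TangentSpace I x) :
    tangentCoord I x₀ x v = (trivializationAt E (TangentSpace I : M → Type _) x₀ ⟨x, v⟩).2 := by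
  rw [tangentCoord, Trivialization.continuousLinearMapAt_apply,
    Trivialization.coe_linearMapAt_of_mem]
  exact hx

@[simp]
theorem tangentCoord_symm (hx : x ∈ (chartAt H x₀).source) (c : E) :
    tangentCoord I x₀ x (tangentCoordSymm I x₀ x c) = c :=
  (trivializationAt E (TangentSpace I : M → Type _) x₀).continuousLinearMapAt_symmL hx c

@[simp]
theorem tangentCoordSymm_coord (hx : x ∈ (chartAt H x₀).source) (v : TangentSpace I x) :
    tangentCoordSymm I x₀ x (tangentCoord I x₀ x v) = v :=
  (trivializationAt E (TangentSpace I : M → Type _) x₀).symmL_continuousLinearMapAt hx v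

variable (I) in
/-- The coordinate representation of a vector field in the chart centred at `x₀`. -/
def coordRep (x₀ : M) (Z : (x : M) → TangentSpace I x) (y : E) : E :=
  tangentCoord I x₀ ((extChartAt I x₀).symm y) (Z ((extChartAt I x₀).symm y))

theorem coordRep_extChartAt (hx : x ∈ (chartAt H x₀).source) (Z : (x : M) → TangentSpace I x) :
    coordRep I x₀ Z (extChartAt I x₀ x) = tangentCoord I x₀ x (Z x) := by
  rw [coordRep, (extChartAt I x₀).left_inv (by rwa [extChartAt_source])]

variable [I.Boundaryless]

theorem eventually_coordRep_eq (hx : x ∈ (chartAt H x₀).source)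
    (Z : (x : M) → TangentSpace I x) :
    (fun x ↦ (trivializationAt E (TangentSpace I : M → Type _) x₀ ⟨x, Z x⟩).2) ∘
      (extChartAt I x₀).symm =ᶠ[nhds (extChartAt I x₀ x)] coordRep I x₀ Z := by
  have hy := (extChartAt I x₀).map_source (x := x) (by rwa [extChartAt_source])
  filter_upwards [(isOpen_extChartAt_target (I := I) x₀).mem_nhds hy] with y hy
  rw [coordRep, tangentCoord_eq, Function.comp]
  simpa using (extChartAt I x₀).map_target hy

theorem contMDiffAt_section_iff_coordRep [IsManifold I ∞ M] (hx : x ∈ (chartAt H x₀).source)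
    {Z : (x : M) → TangentSpace I x} :
    ContMDiffAt I I.tangent ∞ (fun x ↦ (⟨x, Z x⟩ : TangentBundle I M)) x ↔
      ContDiffAt ℝ ∞ (coordRep I x₀ Z) (extChartAt I x₀ x) := by
  have h := eventually_coordRep_eq hx Z
  rw [show ContDiffAt ℝ ∞ (coordRep I x₀ Z) (extChartAt I x₀ x) ↔ _ from
    ⟨fun h' ↦ h'.congr_of_eventuallyEq h, fun h' ↦ h'.congr_of_eventuallyEq h.symm⟩,
    ← contMDiffAt_iff_contDiffAt_comp_extChartAt_symm hx]
  exact Trivialization.contMDiffAt_section_iff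
    (trivializationAt E (TangentSpace I : M → Type _) x₀) hx

theorem mdifferentiableAt_section_iff_coordRep [IsManifold I 2 M]
    (hx : x ∈ (chartAt H x₀).source)
    {Z : (x : M) → TangentSpace I x} :
    MDifferentiableAt I I.tangent (fun x ↦ (⟨x, Z x⟩ : TangentBundle I M)) x ↔
      DifferentiableAt ℝ (coordRep I x₀ Z) (extChartAt I x₀ x) := by
  have : ContMDiffVectorBundle 1 E (TangentSpace I : M → Type _) I := by
    have : IsManifold I (1 + 1) M := by simpa [one_add_one_eq_two]
    infer_instance
  rw [← (eventually_coordRep_eq hx Z).differentiableAt_iff,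
    ← mdifferentiableAt_iff_differentiableAt_comp_extChartAt_symm hx]
  exact Trivialization.mdifferentiableAt_section_iff I
    (trivializationAt E (TangentSpace I : M → Type _) x₀) Z hx

theorem mfderiv_eq_fderiv_comp_extChartAt_symm {f : M → F}
    (hx : x ∈ (chartAt H x₀).source) (hf : MDifferentiableAt I 𝓘(ℝ, F) f x)
    (v : TangentSpace I x) :
    mfderiv I 𝓘(ℝ, F) f x v =
      fderiv ℝ (f ∘ (extChartAt I x₀).symm) (extChartAt I x₀ x) (tangentCoord I x₀ x v) := by
  have hx' : x ∈ (extChartAt I x₀).source := by rwa [extChartAt_source]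
  have hd := (mdifferentiableAt_iff_differentiableAt_comp_extChartAt_symm hx).1 hf
  have h2 := mdifferentiableAt_extChartAt (I := I) hx
  rw [tangentCoord, TangentBundle.continuousLinearMapAt_trivializationAt hx,
    ← mfderiv_eq_fderiv]
  have h3 := mfderiv_comp x hd.mdifferentiableAt h2
  have h4 : mfderiv I 𝓘(ℝ, F) f x =
    mfderiv I 𝓘(ℝ, F) ((f ∘ (extChartAt I x₀).symm) ∘ (extChartAt I x₀)) x := by
    refine Filter.EventuallyEq.mfderiv_eq ?_
    filter_upwards [(isOpen_extChartAt_source (I := I) x₀).mem_nhds hx'] with z hz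
    exact congrArg f ((extChartAt I x₀).left_inv hz).symm
  rw [h4, h3]
  rfl

end ChartCoordinates

/-! ### Christoffel symbols and their smoothness. -/

section Christoffel

variable {E : Type*} [NormedAddCommGroup E] [NormedSpace ℝ E] [FiniteDimensional ℝ E]
  {H : Type*} [TopologicalSpace H] {I : ModelWithCorners ℝ E H} [I.Boundaryless]
  {M : Type*} [TopologicalSpace M] [ChartedSpace H M] [IsManifold I ∞ M] [IsManifold I 1 M]
  [IsManifold I 2 M]
  (cov : CovariantDerivative I E (TangentSpace I : M → Type _)) {x₀ x : M}

/-- The Christoffel symbols of `cov` in the chart centred at `x₀`. -/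
def christoffel (x₀ : M) (y : E) : E →L[ℝ] E →L[ℝ] E :=
  (∑ i, ((Module.finBasis ℝ E).coord i).toContinuousLinearMap.smulRight
    (tangentCoord I x₀ ((extChartAt I x₀).symm y) ∘L
      cov (fun x ↦ tangentCoordSymm I x₀ x (Module.finBasis ℝ E i)) ((extChartAt I x₀).symm y) ∘L
      tangentCoordSymm I x₀ ((extChartAt I x₀).symm y))).flip

theorem coordRep_tangentCoordSymm_eventuallyEq (hx : x ∈ (chartAt H x₀).source) (c : E) :
    coordRep I x₀ (fun x ↦ tangentCoordSymm I x₀ x c) =ᶠ[nhds (extChartAt I x₀ x)] fun _ ↦ c := by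
  have hy := (extChartAt I x₀).map_source (x := x) (by rwa [extChartAt_source])
  filter_upwards [(isOpen_extChartAt_target (I := I) x₀).mem_nhds hy] with y hy
  rw [coordRep, tangentCoord_symm (by simpa using (extChartAt I x₀).map_target hy)]

theorem contMDiffAt_tangentCoordSymm (hx : x ∈ (chartAt H x₀).source) (c : E) :
    ContMDiffAt I I.tangent ∞
      (fun x ↦ (⟨x, tangentCoordSymm I x₀ x c⟩ : TangentBundle I M)) x :=
  (contMDiffAt_section_iff_coordRep hx).2
    (contDiffAt_const.congr_of_eventuallyEq (coordRep_tangentCoordSymm_eventuallyEq hx c))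

variable {cov} in
-- `∇` and the coordinate derivative obey the same Leibniz rule, so the derivatives of `f` cancel in
-- their difference, which thus depends only on the value `Z x`.
theorem tensorialAt_tangentCoord_cov_sub (hx : x ∈ (chartAt H x₀).source) (v : TangentSpace I x) :
    TensorialAt I E (fun Z : (x : M) → TangentSpace I x ↦ tangentCoord I x₀ x (cov Z x v) -
      fderiv ℝ (coordRep I x₀ Z) (extChartAt I x₀ x) (tangentCoord I x₀ x v)) x where
  smul {f Z} hf hZ := by
    have h1 : coordRep I x₀ (f • Z) =
        fun y ↦ (f ∘ (extChartAt I x₀).symm) y • coordRep I x₀ Z y :=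
      funext fun y ↦ ContinuousLinearMap.map_smul _ _ _
    have hf' := (mdifferentiableAt_iff_differentiableAt_comp_extChartAt_symm hx).1 hf
    have hZ' := (mdifferentiableAt_section_iff_coordRep hx).1 hZ
    rw [h1, fderiv_fun_smul hf' hZ', cov.isCovariantDerivativeOnUniv.leibniz hZ hf,
      coordRep_extChartAt hx]
    have h2 : d% f x v = fderiv ℝ (f ∘ (extChartAt I x₀).symm) (extChartAt I x₀ x)
        (tangentCoord I x₀ x v) := mfderiv_eq_fderiv_comp_extChartAt_symm hx hf v
    have h3 : (f ∘ (extChartAt I x₀).symm) (extChartAt I x₀ x) = f x :=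
      congrArg f ((extChartAt I x₀).left_inv (by rwa [extChartAt_source]))
    have h4 : tangentCoord I x₀ x ((f x • cov Z x + (d% f x).smulRight (Z x)) v) =
        f x • tangentCoord I x₀ x (cov Z x v) + d% f x v • tangentCoord I x₀ x (Z x) :=
      (map_add _ (f x • cov Z x v) (d% f x v • Z x)).trans
        (congrArg₂ _ (map_smul _ _ _) (map_smul _ _ _))
    rw [h4, h2, h3]
    simp only [add_apply, smul_apply, ContinuousLinearMap.smulRight_apply, smul_sub]
    abel
  add {Z Z'} hZ hZ' := by
    have h1 : coordRep I x₀ (Z + Z') = fun y ↦ coordRep I x₀ Z y + coordRep I x₀ Z' y :=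
      funext fun y ↦ ContinuousLinearMap.map_add _ _ _
    rw [h1, fderiv_fun_add ((mdifferentiableAt_section_iff_coordRep hx).1 hZ)
      ((mdifferentiableAt_section_iff_coordRep hx).1 hZ'),
      cov.isCovariantDerivativeOnUniv.add hZ hZ', add_apply, add_apply, map_add]
    abel

theorem christoffel_extChartAt (hx : x ∈ (chartAt H x₀).source) (u c : E) :
    christoffel cov x₀ (extChartAt I x₀ x) u c = ∑ i, (Module.finBasis ℝ E).coord i c •
      tangentCoord I x₀ x (cov (fun x ↦ tangentCoordSymm I x₀ x (Module.finBasis ℝ E i)) x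
        (tangentCoordSymm I x₀ x u)) := by
  rw [christoffel, (extChartAt I x₀).left_inv (by rwa [extChartAt_source])]
  simp

theorem tangentCoord_cov {Z : (x : M) → TangentSpace I x} (hx : x ∈ (chartAt H x₀).source)
    (hZ : MDifferentiableAt I I.tangent (fun x ↦ (⟨x, Z x⟩ : TangentBundle I M)) x)
    (v : TangentSpace I x) :
    tangentCoord I x₀ x (cov Z x v) =
      fderiv ℝ (coordRep I x₀ Z) (extChartAt I x₀ x) (tangentCoord I x₀ x v) +
        christoffel cov x₀ (extChartAt I x₀ x) (tangentCoord I x₀ x v)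
          (tangentCoord I x₀ x (Z x)) := by
  have hb := fun c : E ↦ (contMDiffAt_tangentCoordSymm (I := I) hx c).mdifferentiableAt
    (by simp)
  have ht := tensorialAt_tangentCoord_cov_sub (cov := cov) hx v
  set b := Module.finBasis ℝ E
  set c := tangentCoord I x₀ x (Z x) with hc
  have : ContMDiffVectorBundle 1 E (TangentSpace I : M → Type _) I := by
    have : IsManifold I (1 + 1) M := by simpa [one_add_one_eq_two]
    infer_instance
  have hs (i) : MDifferentiableAt I I.tangent (fun y ↦ (⟨y, b.coord i c •
      tangentCoordSymm I x₀ y (b i)⟩ : TangentBundle I M)) x := by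
    have := hb (b.coord i c • b i)
    simpa using this
  -- By tensoriality `Z` may be replaced by the field with constant coordinates and the same value
  -- at `x`; its coordinate derivative vanishes, leaving the Christoffel term.
  have h1 := ht.pointwise (σ' := fun y ↦ ∑ i, b.coord i c • tangentCoordSymm I x₀ y (b i)) hZ
    (MDifferentiableAt.sum_section fun i _ ↦ hs i) (by
      rw [← tangentCoordSymm_coord hx (Z x), ← hc]
      conv_lhs => rw [← b.sum_repr c, map_sum]
      simp only [map_smul]
      rfl)
  have h2 := ht.sum (s := Finset.univ) (σ := fun i y ↦ b.coord i c • tangentCoordSymm I x₀ y (b i))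
    (fun i _ ↦ hs i)
  have h3 (i) := ht.smul (f := fun _ ↦ b.coord i c) (σ := fun y ↦ tangentCoordSymm I x₀ y (b i))
    mdifferentiableAt_const (hb (b i))
  rw [← sub_eq_iff_eq_add', christoffel_extChartAt cov hx, tangentCoordSymm_coord hx]
  refine h1.trans (h2.trans (Finset.sum_congr rfl fun i _ ↦ (h3 i).trans ?_))
  rw [(coordRep_tangentCoordSymm_eventuallyEq (I := I) hx (b i)).fderiv_eq]
  simp [b]

theorem contDiffOn_christoffel [T2Space M] (hcov : cov.ContMDiffCovariantDerivative ∞) (x₀ : M) :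
    ContDiffOn ℝ ∞ (christoffel cov x₀) (extChartAt I x₀).target := by
  intro y hy
  set x := (extChartAt I x₀).symm y with hxy
  have hx : x ∈ (extChartAt I x₀).source := (extChartAt I x₀).map_target hy
  have hx' : x ∈ (chartAt H x₀).source := by rwa [extChartAt_source] at hx
  have hyx : y = extChartAt I x₀ x := ((extChartAt I x₀).right_inv hy).symm
  have : LocallyCompactSpace M := Manifold.locallyCompact_of_finiteDimensional I
  have key (c : E) : ContMDiffAt I (I.prod 𝓘(ℝ, E →L[ℝ] E)) ∞ (fun z ↦
      (⟨z, cov (fun x ↦ tangentCoordSymm I x₀ x c) z⟩ : TotalSpace (E →L[ℝ] E)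
        fun z : M ↦ TangentSpace I z →L[ℝ] TangentSpace I z)) x := by
    -- Smoothness of `cov` speaks of global fields, while the coordinate fields are smooth only on
    -- the chart domain: they are cut off by a bump function, which does not affect `cov` near `x`.
    obtain ⟨f, hf⟩ : ∃ f : SmoothBumpFunction I x, tsupport f ⊆ (extChartAt I x₀).source :=
      ((SmoothBumpFunction.nhds_basis_tsupport (I := I) x).mem_iff.1
        ((isOpen_extChartAt_source (I := I) x₀).mem_nhds hx)).imp fun _ h ↦ h.2
    have hs : ContMDiff I I.tangent ∞
        (fun z ↦ (⟨z, (⇑f • fun x ↦ tangentCoordSymm I x₀ x c) z⟩ : TangentBundle I M)) :=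
      (f.contMDiff.contMDiffOn).smul_section_of_tsupport (isOpen_extChartAt_source (I := I) x₀) hf
        fun z hz ↦ (contMDiffAt_tangentCoordSymm (by rwa [extChartAt_source] at hz)
          c).contMDiffWithinAt
    have h := (hcov.contMDiff.contMDiff (σ := ⇑f • fun x ↦ tangentCoordSymm I x₀ x c)
      hs.contMDiffOn).contMDiffAt Filter.univ_mem (x := x)
    refine h.congr_of_eventuallyEq ?_
    filter_upwards [f.eventuallyEq_one.eventuallyEq_nhds,
      (isOpen_extChartAt_source (I := I) x₀).mem_nhds hx] with z hz hzs
    refine congrArg (TotalSpace.mk z) ?_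
    refine cov.isCovariantDerivativeOnUniv.congr_of_eventuallyEq ?_ (hs.mdifferentiableAt (by simp))
      Filter.univ_mem ?_
    · exact (contMDiffAt_tangentCoordSymm (by rwa [extChartAt_source] at hzs)
          c).mdifferentiableAt (by simp)
    · filter_upwards [hz] with w hw
      simp [hw]
  have key2 (c : E) : ContDiffAt ℝ ∞ (fun y ↦ tangentCoord I x₀ ((extChartAt I x₀).symm y) ∘L
      cov (fun x ↦ tangentCoordSymm I x₀ x c) ((extChartAt I x₀).symm y) ∘L
      tangentCoordSymm I x₀ ((extChartAt I x₀).symm y)) y := by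
    have h := (Trivialization.contMDiffAt_section_iff (trivializationAt (E →L[ℝ] E)
      (fun z : M ↦ TangentSpace I z →L[ℝ] TangentSpace I z) x₀) ⟨hx', hx'⟩).1 (key c)
    rw [contMDiffAt_iff_contDiffAt_comp_extChartAt_symm hx', ← hyx] at h
    exact h
  refine ContDiffAt.contDiffWithinAt ?_
  refine ((ContinuousLinearMap.flipₗᵢ ℝ E E E).contDiff.contDiffAt).comp y ?_
  refine ContDiffAt.sum fun i _ ↦ ?_
  exact ((ContinuousLinearMap.smulRightL ℝ E (E →L[ℝ] E)
    ((Module.finBasis ℝ E).coord i).toContinuousLinearMap).contDiff.contDiffAt).comp y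
      (key2 (Module.finBasis ℝ E i))
end Christoffel

/-! ### The curvature tensor in coordinates. -/

section Curvature

variable {E : Type*} [NormedAddCommGroup E] [NormedSpace ℝ E] [FiniteDimensional ℝ E]
  [CompleteSpace E]
  {H : Type*} [TopologicalSpace H] {I : ModelWithCorners ℝ E H} [I.Boundaryless]
  {M : Type*} [TopologicalSpace M] [ChartedSpace H M] [IsManifold I ∞ M] [IsManifold I 1 M]
  [IsManifold I 2 M]
  {cov : CovariantDerivative I E (TangentSpace I : M → Type _)} {x₀ x : M}

theorem inverse_mfderiv_extChartAt (hx : x ∈ (chartAt H x₀).source) :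
    (mfderiv I 𝓘(ℝ, E) (extChartAt I x₀) x).inverse = tangentCoordSymm I x₀ x := by
  rw [← TangentBundle.continuousLinearMapAt_trivializationAt hx]
  have h : (trivializationAt E (TangentSpace I : M → Type _) x₀).continuousLinearMapAt ℝ x =
      ((trivializationAt E (TangentSpace I : M → Type _) x₀).continuousLinearEquivAt ℝ x hx :
        TangentSpace I x →L[ℝ] E) :=
    ContinuousLinearMap.ext fun v ↦ tangentCoord_eq hx v
  rw [h]
  exact (ContinuousLinearMap.inverse_equiv _).trans (ContinuousLinearMap.ext fun c : E ↦
    ((trivializationAt E (TangentSpace I : M → Type _) x₀).continuousLinearEquivAt ℝ x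
      hx).symm_apply_eq.2 ((tangentCoord_symm (E := E) (I := I) hx c).symm.trans (tangentCoord_eq hx _)))

/-- Coordinate fields are pullbacks of constant fields by the chart, and pullback commutes with the
bracket. -/
theorem mlieBracket_tangentCoordSymm (hx : x ∈ (chartAt H x₀).source) (c d : E) :
    VectorField.mlieBracket I (fun x ↦ tangentCoordSymm I x₀ x c)
      (fun x ↦ tangentCoordSymm I x₀ x d) x = 0 := by
  let cst (c : E) : (y : E) → TangentSpace 𝓘(ℝ, E) y := fun _ ↦ c
  have key (c : E) : (fun x ↦ tangentCoordSymm I x₀ x c) =ᶠ[nhds x]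
      VectorField.mpullback I 𝓘(ℝ, E) (extChartAt I x₀) (cst c) := by
    filter_upwards [(chartAt H x₀).open_source.mem_nhds hx] with y hy
    exact congrArg (fun L : E →L[ℝ] TangentSpace I y ↦ L c) (inverse_mfderiv_extChartAt hy).symm
  have hcst (c : E) : MDifferentiableAt 𝓘(ℝ, E) 𝓘(ℝ, E).tangent
      (fun y ↦ (⟨y, cst c y⟩ : TangentBundle 𝓘(ℝ, E) E)) (extChartAt I x₀ x) :=
    (contMDiffAt_vectorSpace_iff_contDiffAt (n := 1).2 contDiffAt_const).mdifferentiableAt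
      one_ne_zero
  have h0 : VectorField.mlieBracket 𝓘(ℝ, E) (cst c) (cst d) (extChartAt I x₀ x) = 0 := by
    rw [← VectorField.mlieBracketWithin_univ, VectorField.mlieBracketWithin_eq_lieBracketWithin]
    simp [VectorField.lieBracketWithin, cst]
    rfl
  have : IsManifold I (minSmoothness ℝ 2) M := by
    rw [minSmoothness_of_isRCLikeNormedField]; infer_instance
  rw [(key c).mlieBracket_vectorField_eq (key d),
    ← VectorField.mpullback_mlieBracket (n := 2) (hcst c) (hcst d) (contMDiffAt_extChartAt' hx)
      (by simp), VectorField.mpullback_apply, h0, map_zero]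

theorem christoffel_symm (hsymm : cov.torsion = 0) (hx : x ∈ (chartAt H x₀).source) (u c : E) :
    christoffel cov x₀ (extChartAt I x₀ x) u c = christoffel cov x₀ (extChartAt I x₀ x) c u := by
  have hb := fun c : E ↦ (contMDiffAt_tangentCoordSymm (I := I) hx c).mdifferentiableAt
    (by simp)
  have h := (cov.torsion_eq_zero_iff.1 hsymm) (hb u) (hb c)
  rw [mlieBracket_tangentCoordSymm hx, sub_eq_zero] at h
  have h1 := tangentCoord_cov cov hx (hb u) (tangentCoordSymm I x₀ x c)
  have h2 := tangentCoord_cov cov hx (hb c) (tangentCoordSymm I x₀ x u)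
  rw [(coordRep_tangentCoordSymm_eventuallyEq hx _).fderiv_eq] at h1 h2
  simp only [tangentCoord_symm hx, fderiv_fun_const, Pi.zero_apply, zero_apply, zero_add] at h1 h2
  rw [← h1, ← h2, h]

theorem coordRep_cov_eventuallyEq {Y Z : (x : M) → TangentSpace I x}
    (hx : x ∈ (chartAt H x₀).source)
    (hZ : ContMDiffAt I I.tangent ∞ (fun x ↦ (⟨x, Z x⟩ : TangentBundle I M)) x) :
    coordRep I x₀ (fun y ↦ cov Z y (Y y)) =ᶠ[nhds (extChartAt I x₀ x)] fun y ↦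
      fderiv ℝ (coordRep I x₀ Z) y (coordRep I x₀ Y y) +
        christoffel cov x₀ y (coordRep I x₀ Y y) (coordRep I x₀ Z y) := by
  have hy := (extChartAt I x₀).map_source (x := x) (by rwa [extChartAt_source])
  have hZ1 := ((contMDiffAt_section_iff_coordRep hx).1 hZ).of_le (m := 1) (by simp)
  filter_upwards [(isOpen_extChartAt_target (I := I) x₀).mem_nhds hy, hZ1.eventually (by simp)]
    with y hy hZy
  have hyx := (extChartAt I x₀).right_inv hy
  have hx' : (extChartAt I x₀).symm y ∈ (chartAt H x₀).source := by
    simpa using (extChartAt I x₀).map_target hy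
  have h := tangentCoord_cov cov hx' ((mdifferentiableAt_section_iff_coordRep hx').2
    (by rw [hyx]; exact hZy.differentiableAt (by simp))) (Y ((extChartAt I x₀).symm y))
  rwa [hyx] at h

/-- Second derivatives of `Z` cancel by symmetry. Zero torsion replaces `[X, Y]` by `∇_X Y - ∇_Y X`,
which cancels the terms with derivatives of `X` and `Y`. -/
theorem tangentCoord_curvatureField [T2Space M] (hcov : cov.ContMDiffCovariantDerivative ∞)
    (hsymm : cov.torsion = 0)
    {X Y Z : (x : M) → TangentSpace I x} (hx : x ∈ (chartAt H x₀).source)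
    (hX : ContMDiffAt I I.tangent ∞ (fun x ↦ (⟨x, X x⟩ : TangentBundle I M)) x)
    (hY : ContMDiffAt I I.tangent ∞ (fun x ↦ (⟨x, Y x⟩ : TangentBundle I M)) x)
    (hZ : ContMDiffAt I I.tangent ∞ (fun x ↦ (⟨x, Z x⟩ : TangentBundle I M)) x) :
    tangentCoord I x₀ x (curvatureField cov X Y Z x) =
      christoffelCurvature (christoffel cov x₀) (extChartAt I x₀ x) (tangentCoord I x₀ x (X x))
        (tangentCoord I x₀ x (Y x)) (tangentCoord I x₀ x (Z x)) := by
  have hy := (extChartAt I x₀).map_source (x := x) (by rwa [extChartAt_source])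
  have hΓ : DifferentiableAt ℝ (christoffel cov x₀) (extChartAt I x₀ x) :=
    ((contDiffOn_christoffel cov hcov x₀).contDiffAt
      ((isOpen_extChartAt_target (I := I) x₀).mem_nhds hy)).differentiableAt (by simp)
  have hX' := ((contMDiffAt_section_iff_coordRep hx).1 hX)
  have hY' := ((contMDiffAt_section_iff_coordRep hx).1 hY)
  have hZ' := ((contMDiffAt_section_iff_coordRep hx).1 hZ)
  have hdX := hX'.differentiableAt (by simp)
  have hdY := hY'.differentiableAt (by simp)
  have hdZ := hZ'.differentiableAt (by simp)
  have hddZ : DifferentiableAt ℝ (fderiv ℝ (coordRep I x₀ Z)) (extChartAt I x₀ x) :=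
    (hZ'.fderiv_right (m := 1)
      (WithTop.coe_le_coe.2 (le_top : (1 + 1 : ℕ∞) ≤ ⊤))).differentiableAt (by simp)
  have key {Y : (x : M) → TangentSpace I x}
      (hd : DifferentiableAt ℝ (coordRep I x₀ Y) (extChartAt I x₀ x)) (X : TangentSpace I x) :
      tangentCoord I x₀ x (cov (fun y ↦ cov Z y (Y y)) x X) =
        fderiv ℝ (fderiv ℝ (coordRep I x₀ Z)) (extChartAt I x₀ x) (tangentCoord I x₀ x X)
          (tangentCoord I x₀ x (Y x)) +
        fderiv ℝ (coordRep I x₀ Z) (extChartAt I x₀ x)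
          (fderiv ℝ (coordRep I x₀ Y) (extChartAt I x₀ x) (tangentCoord I x₀ x X)) +
        fderiv ℝ (christoffel cov x₀) (extChartAt I x₀ x) (tangentCoord I x₀ x X)
          (tangentCoord I x₀ x (Y x)) (tangentCoord I x₀ x (Z x)) +
        christoffel cov x₀ (extChartAt I x₀ x)
          (fderiv ℝ (coordRep I x₀ Y) (extChartAt I x₀ x) (tangentCoord I x₀ x X))
          (tangentCoord I x₀ x (Z x)) +
        christoffel cov x₀ (extChartAt I x₀ x) (tangentCoord I x₀ x (Y x))
          (fderiv ℝ (coordRep I x₀ Z) (extChartAt I x₀ x) (tangentCoord I x₀ x X)) +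
        christoffel cov x₀ (extChartAt I x₀ x) (tangentCoord I x₀ x X)
          (fderiv ℝ (coordRep I x₀ Z) (extChartAt I x₀ x) (tangentCoord I x₀ x (Y x)) +
          christoffel cov x₀ (extChartAt I x₀ x) (tangentCoord I x₀ x (Y x))
            (tangentCoord I x₀ x (Z x))) := by
    have hW := coordRep_cov_eventuallyEq (cov := cov) (Y := Y) hx hZ
    have hder := (hddZ.hasFDerivAt.clm_apply hd.hasFDerivAt).add
      ((hΓ.hasFDerivAt.clm_apply hd.hasFDerivAt).clm_apply hdZ.hasFDerivAt)
    have hder' := hder.congr_of_eventuallyEq hW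
    rw [tangentCoord_cov cov hx ((mdifferentiableAt_section_iff_coordRep hx).2
      hder'.differentiableAt), hder'.fderiv]
    have hWx : tangentCoord I x₀ x (cov Z x (Y x)) = _ :=
      tangentCoord_cov cov hx (hZ.mdifferentiableAt (by simp)) (Y x)
    rw [hWx]
    simp only [coordRep_extChartAt hx, add_apply, ContinuousLinearMap.comp_apply,
      ContinuousLinearMap.flip_apply, map_add]
    abel
  have hbr := (cov.torsion_eq_zero_iff.1 hsymm) (hX.mdifferentiableAt (by simp))
    (hY.mdifferentiableAt (by simp))
  have hsec : IsSymmSndFDerivAt ℝ (coordRep I x₀ Z) (extChartAt I x₀ x) :=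
    hZ'.isSymmSndFDerivAt (by
      rw [minSmoothness_of_isRCLikeNormedField]
      exact WithTop.coe_le_coe.2 (le_top : (2 : ℕ∞) ≤ ⊤))
  rw [curvatureField, map_sub, map_sub, key hdY, key hdX,
    tangentCoord_cov cov hx (hZ.mdifferentiableAt (by simp)), ← hbr, map_sub,
    tangentCoord_cov cov hx (hY.mdifferentiableAt (by simp)),
    tangentCoord_cov cov hx (hX.mdifferentiableAt (by simp)),
    christoffel_symm hsymm hx (tangentCoord I x₀ x (X x)) (tangentCoord I x₀ x (Y x)),
    hsec.eq (tangentCoord I x₀ x (X x)) (tangentCoord I x₀ x (Y x))]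
  simp only [christoffelCurvature, map_add, map_sub, add_apply, sub_apply]
  abel

theorem tangentCoord_curvatureAt [T2Space M] (hcov : cov.ContMDiffCovariantDerivative ∞)
    (hsymm : cov.torsion = 0) (hx : x ∈ (chartAt H x₀).source) (u v w : TangentSpace I x) :
    tangentCoord I x₀ x (curvatureAt cov x u v w) =
      christoffelCurvature (christoffel cov x₀) (extChartAt I x₀ x) (tangentCoord I x₀ x u)
        (tangentCoord I x₀ x v) (tangentCoord I x₀ x w) := by
  have hs (u : TangentSpace I x) := FiberBundle.contMDiffAt_extend I E (k := ∞) u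
  have := tangentCoord_curvatureField hcov hsymm hx (hs u) (hs v) (hs w)
  simp only [FiberBundle.extend_apply_self] at this
  exact this

end Curvature

/-! ### The spray flow together with parallel transport, as one differential equation. -/

section Flow

/-- The existence time `ε` is common to all initial points near `z₀`; this uniformity is what allows
a limit of transported forms to be transported in turn. -/
theorem exists_local_flow {Z : Type*} [NormedAddCommGroup Z] [NormedSpace ℝ Z] [CompleteSpace Z]
    {f : Z → Z} {z₀ : Z} {U : Set Z} (hf : ContDiffAt ℝ 1 f z₀) (hU : U ∈ nhds z₀) :
    ∃ ε > 0, ∃ α : Z → ℝ → Z, (∀ᶠ z in nhds z₀, α z 0 = z ∧ ∀ t ∈ Icc (0 : ℝ) ε,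
      α z t ∈ U ∧ HasDerivWithinAt (α z) (f (α z t)) (Icc 0 ε) t) ∧
      ∀ t ∈ Icc (0 : ℝ) ε, ContinuousAt (α · t) z₀ := by
  obtain ⟨ε, hε, a, r, L, K, hr, hpl⟩ := IsPicardLindelof.of_contDiffAt_one hf
  obtain ⟨α, hα, hc⟩ := (hpl 0).exists_forall_mem_closedBall_eq_hasDerivWithinAt_continuousOn
  have hr' : Metric.closedBall z₀ r ∈ nhds z₀ := Metric.closedBall_mem_nhds _ (by exact_mod_cast hr)
  have hc' {t : ℝ} (ht : t ∈ Ioo (0 - ε) (0 + ε)) : ContinuousAt α (z₀, t) :=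
    hc.continuousAt (prod_mem_nhds hr' (Icc_mem_nhds ht.1 ht.2))
  have h0 : α (z₀, 0) = z₀ := (hα z₀ (mem_of_mem_nhds hr')).1
  have hev : ∀ᶠ p in nhds z₀ ×ˢ nhds (0 : ℝ), α p ∈ U := by
    rw [← nhds_prod_eq]
    exact (hc' ⟨by linarith, by linarith⟩).eventually_mem (by rwa [h0])
  obtain ⟨p, hp, q, hq, hpq⟩ := Filter.eventually_prod_iff.1 hev
  obtain ⟨δ, hδ, hδq⟩ := Metric.eventually_nhds_iff.1 hq
  have hmin : 0 < min ε δ := lt_min hε hδ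
  refine ⟨min ε δ / 2, by positivity, fun z t ↦ α (z, t), ?_, fun t ht ↦ ?_⟩
  · filter_upwards [hp, hr'] with z hz hzr
    refine ⟨(hα z hzr).1, fun t ht ↦ ⟨hpq hz (hδq ?_), ((hα z hzr).2 t ?_).mono ?_⟩⟩
    · rw [Real.dist_eq, sub_zero, abs_of_nonneg ht.1]
      linarith [ht.2, min_le_right ε δ]
    · exact ⟨by linarith [ht.1], by linarith [ht.2, min_le_left ε δ]⟩
    · exact Icc_subset_Icc (by linarith) (by linarith [min_le_left ε δ])
  · have : ContinuousAt (fun z : Z ↦ (z, t)) z₀ := by fun_prop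
    exact ContinuousAt.comp (f := fun z : Z ↦ (z, t))
      (hc' ⟨by linarith [ht.1], by linarith [ht.2, min_le_left ε δ]⟩) this

variable {E : Type*} [NormedAddCommGroup E] [NormedSpace ℝ E] [FiniteDimensional ℝ E]

/-- In coordinates: a solution `(y, v)` of the second order system `G`, with parallel transport `T`
along `y` and its inverse `Q`. -/
structure IsTransportFlowOn (Ω : Set E) (G : E × E → E × E) (Γ : E → E →L[ℝ] E →L[ℝ] E)
    (y v : ℝ → E) (T Q : ℝ → E →L[ℝ] E) (ε : ℝ) : Prop where
  T_zero : T 0 = .id ℝ E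
  Q_zero : Q 0 = .id ℝ E
  mem : ∀ t ∈ Icc 0 ε, y t ∈ Ω
  hasDerivWithinAt : ∀ t ∈ Icc 0 ε,
    HasDerivWithinAt (fun t ↦ (y t, v t)) (G (y t, v t)) (Icc 0 ε) t
  hasDerivWithinAt_fst : ∀ t ∈ Icc 0 ε, HasDerivWithinAt y (v t) (Icc 0 ε) t
  hasDerivWithinAt_T : ∀ t ∈ Icc 0 ε, HasDerivWithinAt T (-(Γ (y t) (v t) ∘L T t)) (Icc 0 ε) t
  hasDerivWithinAt_Q : ∀ t ∈ Icc 0 ε, HasDerivWithinAt Q (Q t ∘L Γ (y t) (v t)) (Icc 0 ε) t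

namespace IsTransportFlowOn

variable {Ω : Set E} {G : E × E → E × E} {Γ : E → E →L[ℝ] E →L[ℝ] E}
    {y v : ℝ → E} {T Q : ℝ → E →L[ℝ] E} {ε : ℝ}

theorem mono (h : IsTransportFlowOn Ω G Γ y v T Q ε) {δ : ℝ} (hδ : δ ≤ ε) :
    IsTransportFlowOn Ω G Γ y v T Q δ := by
  have hs : Icc 0 δ ⊆ Icc 0 ε := Icc_subset_Icc_right hδ
  exact ⟨h.T_zero, h.Q_zero, fun t ht ↦ h.mem t (hs ht),
    fun t ht ↦ (h.hasDerivWithinAt t (hs ht)).mono hs,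
    fun t ht ↦ (h.hasDerivWithinAt_fst t (hs ht)).mono hs,
    fun t ht ↦ (h.hasDerivWithinAt_T t (hs ht)).mono hs,
    fun t ht ↦ (h.hasDerivWithinAt_Q t (hs ht)).mono hs⟩

/-- The two equations are adjoint to each other, so the derivative of `Q ∘ T` is `QΓT - QΓT = 0`. -/
theorem Q_comp_T (h : IsTransportFlowOn Ω G Γ y v T Q ε) {t : ℝ} (ht : t ∈ Icc 0 ε) :
    Q t ∘L T t = .id ℝ E := by
  have hd (t) (ht : t ∈ Icc 0 ε) : HasDerivWithinAt (fun t ↦ Q t ∘L T t) 0 (Icc 0 ε) t := by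
    have := (h.hasDerivWithinAt_Q t ht).clm_comp (h.hasDerivWithinAt_T t ht)
    convert this using 1
    ext x; simp
  have := constant_of_has_deriv_right_zero (fun t ht ↦ (hd t ht).continuousWithinAt)
    (fun t ht ↦ ((hd t (Ico_subset_Icc_self ht)).mono
      (Icc_subset_Icc_left ht.1)).mono_of_mem_nhdsWithin (Icc_mem_nhdsGE ht.2)) t ht
  rw [this, h.T_zero, h.Q_zero]
  rfl

theorem T_comp_Q (h : IsTransportFlowOn Ω G Γ y v T Q ε) {t : ℝ} (ht : t ∈ Icc 0 ε) :
    T t ∘L Q t = .id ℝ E := by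
  have := congrArg ContinuousLinearMap.toLinearMap (h.Q_comp_T ht)
  exact ContinuousLinearMap.coe_injective ((LinearMap.comp_eq_id_comm ℝ E).1 this)

/-- The transport of a bilinear form. -/
theorem hasDerivWithinAt_form (h : IsTransportFlowOn Ω G Γ y v T Q ε) (hε : 0 < ε)
    (g : E →L[ℝ] E →L[ℝ] ℝ) :
    HasDerivWithinAt (fun t ↦ g.bilinearComp (Q t) (Q t)) (formConnection Γ (y 0) (v 0) g)
      (Ici 0) 0 := by
  have h0 : (0 : ℝ) ∈ Icc 0 ε := ⟨le_rfl, hε.le⟩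
  have hQ := (h.hasDerivWithinAt_Q 0 h0).mono_of_mem_nhdsWithin (Icc_mem_nhdsGE hε)
  -- `Q` is inserted in one slot, the arguments are flipped, `Q` is inserted in the other slot, and
  -- the arguments are flipped back.
  have h1 := (hasDerivWithinAt_const 0 (Ici 0) g).clm_comp hQ
  have h2 := ((ContinuousLinearMap.flipₗᵢ ℝ E E ℝ).toContinuousLinearEquiv.toContinuousLinearMap
    |>.hasFDerivAt.comp_hasDerivWithinAt 0 h1).clm_comp hQ
  have h3 := (ContinuousLinearMap.flipₗᵢ ℝ E E ℝ).toContinuousLinearEquiv.toContinuousLinearMap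
    |>.hasFDerivAt.comp_hasDerivWithinAt 0 h2
  refine h3.congr_deriv ?_
  ext ξ η
  simp [formConnection_apply, h.Q_zero]

end IsTransportFlowOn

theorem exists_transportFlow {Ω : Set E} (hΩ : IsOpen Ω) {G : E × E → E × E}
    {Γ : E → E →L[ℝ] E →L[ℝ] E} (hG : ContDiffOn ℝ ∞ G (Ω ×ˢ univ))
    (hG1 : ∀ y ∈ Ω, ∀ v, (G (y, v)).1 = v) (hΓ : ContDiffOn ℝ ∞ Γ Ω) {y₀ : E} (hy₀ : y₀ ∈ Ω)
    (u : E) :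
    ∃ ε > 0, ∃ (y v : E → ℝ → E) (T Q : E → ℝ → E →L[ℝ] E),
      (∀ᶠ x in nhds y₀, y x 0 = x ∧ v x 0 = u ∧
        IsTransportFlowOn Ω G Γ (y x) (v x) (T x) (Q x) ε) ∧
      ∀ t ∈ Icc 0 ε, ContinuousAt (y · t) y₀ ∧ ContinuousAt (Q · t) y₀ := by
  have hcE : CompleteSpace E := FiniteDimensional.complete ℝ E
  -- The state consists of position, velocity, transport and inverse transport, so existence and
  -- continuous dependence follow from a single local flow.
  let f : (E × E) × (E →L[ℝ] E) × (E →L[ℝ] E) → (E × E) × (E →L[ℝ] E) × (E →L[ℝ] E) := fun z ↦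
    (G z.1, -(Γ z.1.1 z.1.2 ∘L z.2.1), z.2.2 ∘L Γ z.1.1 z.1.2)
  let ι : E → (E × E) × (E →L[ℝ] E) × (E →L[ℝ] E) := fun x ↦ ((x, u), .id ℝ E, .id ℝ E)
  have hΩn : Ω ∈ nhds y₀ := hΩ.mem_nhds hy₀
  have hf : ContDiffAt ℝ 1 f (ι y₀) := by
    have h1 : ContDiffAt ℝ 1 (fun z : (E × E) × (E →L[ℝ] E) × (E →L[ℝ] E) ↦ Γ z.1.1 z.1.2)
        (ι y₀) := by
      refine ContDiffAt.clm_apply ?_ (by fun_prop)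
      exact ContDiffAt.comp (ι y₀) (((hΓ.contDiffAt hΩn).of_le (by simp)))
        (contDiffAt_fst.fst)
    have h2 : ContDiffAt ℝ 1 (fun z : (E × E) × (E →L[ℝ] E) × (E →L[ℝ] E) ↦ G z.1) (ι y₀) :=
      ContDiffAt.comp (ι y₀) (((hG.contDiffAt (prod_mem_nhds hΩn Filter.univ_mem)).of_le
        (by simp))) contDiffAt_fst
    refine h2.prodMk (ContDiffAt.prodMk (ContDiffAt.neg ?_) ?_)
    · exact h1.clm_comp contDiffAt_snd.fst
    · exact contDiffAt_snd.snd.clm_comp h1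
  have hι : Continuous ι := by fun_prop
  have hU : {z : (E × E) × (E →L[ℝ] E) × (E →L[ℝ] E) | z.1.1 ∈ Ω} ∈ nhds (ι y₀) :=
    (hΩ.preimage (by fun_prop : Continuous
      fun z : (E × E) × (E →L[ℝ] E) × (E →L[ℝ] E) ↦ z.1.1)).mem_nhds hy₀
  obtain ⟨ε, hε, α, hα, hαc⟩ := exists_local_flow hf hU
  refine ⟨ε, hε, fun x t ↦ (α (ι x) t).1.1, fun x t ↦ (α (ι x) t).1.2, fun x t ↦ (α (ι x) t).2.1,
    fun x t ↦ (α (ι x) t).2.2, ?_, fun t ht ↦ ?_⟩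
  · filter_upwards [hι.continuousAt.eventually hα] with x hx
    have hd1 (t) (ht : t ∈ Icc 0 ε) : HasDerivWithinAt (fun t ↦ (α (ι x) t).1)
      (G (α (ι x) t).1) (Icc 0 ε) t := ((hx.2 t ht).2).fst
    refine ⟨by simp [hx.1, ι], by simp [hx.1, ι], by simp [hx.1, ι], by simp [hx.1, ι],
      fun t ht ↦ (hx.2 t ht).1, hd1, fun t ht ↦ ?_, fun t ht ↦ ((hx.2 t ht).2).snd.fst,
      fun t ht ↦ ((hx.2 t ht).2).snd.snd⟩
    have h1 : HasDerivWithinAt (fun t ↦ (α (ι x) t).1.1) (G (α (ι x) t).1).1 (Icc 0 ε) t :=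
      (hd1 t ht).fst
    have h2 : (G (α (ι x) t).1).1 = (α (ι x) t).1.2 := hG1 _ (hx.2 t ht).1 _
    rwa [h2] at h1
  · have := ContinuousAt.comp (f := ι) (x := y₀) (hαc t ht) hι.continuousAt
    exact ⟨this.fst.fst, this.snd.snd⟩

end Flow

/-! ### Curves and spray solutions in a chart. -/

section Curves

variable {E : Type*} [NormedAddCommGroup E] [NormedSpace ℝ E]
  {H : Type*} [TopologicalSpace H] {I : ModelWithCorners ℝ E H}
  {M : Type*} [TopologicalSpace M] [ChartedSpace H M]

/-- The vectors `V (c t)` and `V (c' t)` have types depending on different base points; they are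
compared in the model space `E`. -/
theorem HasMFDerivWithinAt.smulRight_congr {V : (x : M) → TangentSpace I x} {c c' : ℝ → M}
    {s : Set ℝ} {t : ℝ}
    (h : HasMFDerivWithinAt 𝓘(ℝ, ℝ) I c s t ((1 : ℝ →L[ℝ] ℝ).smulRight (V (c t))))
    (hc : EqOn c' c s) (ht : t ∈ s) :
    HasMFDerivWithinAt 𝓘(ℝ, ℝ) I c' s t ((1 : ℝ →L[ℝ] ℝ).smulRight (V (c' t))) := by
  have h' := h.congr_of_eventuallyEq (Filter.eventuallyEq_of_mem self_mem_nhdsWithin hc) (hc ht)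
  have hV : (V (c' t) : E) = V (c t) := congrArg (fun x ↦ (V x : E)) (hc ht)
  have key : ∀ w : E, w = V (c t) → HasMFDerivWithinAt 𝓘(ℝ, ℝ) I c' s t
      ((1 : ℝ →L[ℝ] ℝ).smulRight w : ℝ →L[ℝ] E) := by
    rintro _ rfl
    exact h'
  exact key _ hV

theorem velocityWithin_congr {c c' : ℝ → M} {s : Set ℝ} (hc : EqOn c' c s) {t : ℝ} (ht : t ∈ s) :
    (velocityWithin I c' s t : E) = velocityWithin I c s t := by
  have : mfderivWithin 𝓘(ℝ, ℝ) I c' s t = mfderivWithin 𝓘(ℝ, ℝ) I c s t :=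
    Filter.EventuallyEq.mfderivWithin_eq (Filter.eventuallyEq_of_mem self_mem_nhdsWithin hc) (hc ht)
  exact congrArg (fun L : ℝ →L[ℝ] E ↦ L 1) this

variable [IsManifold I 1 M] {x₀ x : M}

theorem IsSpraySolutionOn.congr {S : (v : TangentBundle I M) → TangentSpace I.tangent v}
    {c c' : ℝ → M} {s : Set ℝ} (h : IsSpraySolutionOn S c s) (hc : EqOn c' c s) :
    IsSpraySolutionOn S c' s := by
  refine ⟨h.1.congr hc, fun t ht ↦ (h.2 t ht).smulRight_congr (fun r hr ↦ ?_) ht⟩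
  have h1 := velocityWithin_congr (I := I) hc hr
  have h2 := hc hr
  change (⟨c' r, velocityWithin I c' s r⟩ : TangentBundle I M) = ⟨c r, velocityWithin I c s r⟩
  generalize velocityWithin I c' s r = v at *
  generalize velocityWithin I c s r = w at *
  revert v w
  rw [h2]
  rintro v w rfl
  rfl

theorem HasCovDerivWithinAt.congr {cov : CovariantDerivative I E (TangentSpace I : M → Type _)}
    {c c' : ℝ → M} {V V' : ℝ → E} {s : Set ℝ} (hc : EqOn c' c s) (hV : EqOn V' V s)
    {t : ℝ} (ht : t ∈ s) (h : HasCovDerivWithinAt cov c V s t (0 : E)) :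
    HasCovDerivWithinAt cov c' V' s t (0 : E) := by
  obtain ⟨h1, h2⟩ := h
  refine ⟨h1.congr hc (hc ht), ?_⟩
  have hvel := velocityWithin_congr (I := I) hc ht
  have key (x x' : M) (hx : x' = x) (V V' : E) (hV : V' = V) (w w' : E) (hw : w' = w) :
      (trivializationAt E (TangentSpace I : M → Type _) x' ⟨x', (0 : TangentSpace I x') -
        cov (FiberBundle.extend E (x := x') (V' : TangentSpace I x')) x' w'⟩).2 =
      (trivializationAt E (TangentSpace I : M → Type _) x ⟨x, (0 : TangentSpace I x) -
        cov (FiberBundle.extend E (x := x) (V : TangentSpace I x)) x w⟩).2 := by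
    subst hx hV hw; rfl
  have := h2.congr (f₁ := fun r ↦ (trivializationAt E (TangentSpace I : M → Type _) (c' t)
    ⟨c' r, V' r⟩).2) (fun r hr ↦ by rw [hc hr, hc ht, hV hr]) (by rw [hc ht, hV ht])
  exact this.congr_deriv (key _ _ (hc ht) _ _ (hV ht) _ _ hvel).symm

variable [I.Boundaryless]

theorem hasMFDerivAt_extChartAt_symm {y : E} (hy : y ∈ (extChartAt I x₀).target) :
    HasMFDerivAt 𝓘(ℝ, E) I (extChartAt I x₀).symm y
      (tangentCoordSymm I x₀ ((extChartAt I x₀).symm y)) := by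
  have h := ((contMDiffOn_extChartAt_symm (n := 1) (I := I) x₀).contMDiffAt
    ((isOpen_extChartAt_target (I := I) x₀).mem_nhds hy)).mdifferentiableAt one_ne_zero
  have hx : (extChartAt I x₀).symm y ∈ (chartAt H x₀).source := by
    simpa using (extChartAt I x₀).map_target hy
  have h1 := TangentBundle.symmL_trivializationAt (I := I) hx
  rw [(extChartAt I x₀).right_inv hy, I.range_eq_univ, mfderivWithin_univ] at h1
  have h2 := h.hasMFDerivAt
  rw [← h1] at h2
  exact h2

theorem HasDerivWithinAt.hasMFDerivWithinAt_extChartAt_symm {z : ℝ → E} {z' : E} {s : Set ℝ}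
    {t : ℝ} (h : HasDerivWithinAt z z' s t) (ht : z t ∈ (extChartAt I x₀).target) :
    HasMFDerivWithinAt 𝓘(ℝ, ℝ) I (fun r ↦ (extChartAt I x₀).symm (z r)) s t
      ((1 : ℝ →L[ℝ] ℝ).smulRight
        (tangentCoordSymm I x₀ ((extChartAt I x₀).symm (z t)) z')) := by
  have h1 := HasMFDerivAt.comp_hasMFDerivWithinAt t (hasMFDerivAt_extChartAt_symm ht)
    h.hasFDerivWithinAt.hasMFDerivWithinAt
  refine h1.congr_mfderiv ?_
  refine ContinuousLinearMap.ext_ring ?_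
  exact (congrArg (tangentCoordSymm I x₀ _) (one_smul ℝ z')).trans (one_smul ℝ _).symm

theorem HasDerivWithinAt.velocityWithin_extChartAt_symm {z : ℝ → E} {z' : E} {s : Set ℝ}
    {t : ℝ} (h : HasDerivWithinAt z z' s t) (ht : z t ∈ (extChartAt I x₀).target)
    (hs : UniqueDiffWithinAt ℝ s t) :
    velocityWithin I (fun r ↦ (extChartAt I x₀).symm (z r)) s t =
      tangentCoordSymm I x₀ ((extChartAt I x₀).symm (z t)) z' := by
  rw [velocityWithin, (h.hasMFDerivWithinAt_extChartAt_symm ht).mfderivWithin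
    hs.uniqueMDiffWithinAt]
  exact (one_smul ℝ _)

theorem mem_chartAt_tangent_source_iff {p : TangentBundle I M} :
    p ∈ (chartAt (ModelProd H E) (⟨x₀, 0⟩ : TangentBundle I M)).source ↔
      p.proj ∈ (chartAt H x₀).source :=
  TangentBundle.mem_chart_source_iff _ _

theorem extChartAt_tangent_target :
    (extChartAt I.tangent (⟨x₀, 0⟩ : TangentBundle I M)).target =
      (extChartAt I x₀).target ×ˢ univ := by
  rw [FiberBundle.extChartAt_target]
  congr 1
  refine inter_eq_left.2 fun y hy ↦ ?_
  simpa using (extChartAt I x₀).map_target hy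

theorem extChartAt_tangent_apply {p : TangentBundle I M} (hp : p.proj ∈ (chartAt H x₀).source) :
    extChartAt I.tangent (⟨x₀, 0⟩ : TangentBundle I M) p =
      (extChartAt I x₀ p.proj, tangentCoord I x₀ p.proj p.2) := by
  rw [FiberBundle.extChartAt, tangentCoord_eq hp]
  simp

theorem extChartAt_tangent_symm_apply {z : E × E} (hz : z.1 ∈ (extChartAt I x₀).target) :
    (extChartAt I.tangent (⟨x₀, 0⟩ : TangentBundle I M)).symm z =
      ⟨(extChartAt I x₀).symm z.1, tangentCoordSymm I x₀ ((extChartAt I x₀).symm z.1) z.2⟩ := by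
  have hx : (extChartAt I x₀).symm z.1 ∈ (chartAt H x₀).source := by
    simpa using (extChartAt I x₀).map_target hz
  set p : TangentBundle I M :=
    ⟨(extChartAt I x₀).symm z.1, tangentCoordSymm I x₀ ((extChartAt I x₀).symm z.1) z.2⟩ with hp
  have h := extChartAt_tangent_apply (p := p) hx
  rw [tangentCoord_symm hx, (extChartAt I x₀).right_inv hz] at h
  rw [show z = _ from h.symm, PartialEquiv.left_inv]
  rw [extChartAt_source]
  exact mem_chartAt_tangent_source_iff.2 hx

variable [IsManifold I ∞ M] {S : (v : TangentBundle I M) → TangentSpace I.tangent v}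

section
variable [IsManifold I.tangent 1 (TangentBundle I M)]

variable (I) in
/-- The coordinate representation of a vector field on the tangent bundle. -/
def sprayRep (x₀ : M) (S : (v : TangentBundle I M) → TangentSpace I.tangent v) : E × E → E × E :=
  coordRep I.tangent (⟨x₀, 0⟩ : TangentBundle I M) S

theorem IsSpray.contDiffOn_sprayRep (hS : IsSpray S) :
    ContDiffOn ℝ ∞ (sprayRep I x₀ S) ((extChartAt I x₀).target ×ˢ univ) := by
  rw [← extChartAt_tangent_target]
  intro z hz
  have h1 := (extChartAt I.tangent (⟨x₀, 0⟩ : TangentBundle I M)).map_target hz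
  rw [extChartAt_source] at h1
  have := (contMDiffAt_section_iff_coordRep h1).1 (hS.smooth _)
  rw [(extChartAt I.tangent (⟨x₀, 0⟩ : TangentBundle I M)).right_inv hz] at this
  exact this.contDiffWithinAt

/-- In the charts the projection `π` is the first projection, so `dπ (S v) = v` says that the
coordinate system is of second order. -/
theorem IsSpray.sprayRep_fst (hS : IsSpray S) {y : E} (hy : y ∈ (extChartAt I x₀).target) (v : E) :
    (sprayRep I x₀ S (y, v)).1 = v := by
  set p₀ : TangentBundle I M := ⟨x₀, 0⟩ with hp₀
  have hz : (y, v) ∈ (extChartAt I.tangent p₀).target := by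
    rw [extChartAt_tangent_target]; exact ⟨hy, mem_univ _⟩
  set p := (extChartAt I.tangent p₀).symm (y, v) with hp
  have hps : p ∈ (extChartAt I.tangent p₀).source := (extChartAt I.tangent p₀).map_target hz
  have hps' : p ∈ (chartAt (ModelProd H E) p₀).source := by rwa [extChartAt_source] at hps
  have hπ : MDifferentiableAt I.tangent I (TotalSpace.proj : TangentBundle I M → M) p :=
    (contMDiff_proj (n := 1) (TangentSpace I)).mdifferentiable one_ne_zero p
  have h1 := HasMFDerivAt.comp (y, v) hπ.hasMFDerivAt (hasMFDerivAt_extChartAt_symm hz)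
  have h2 := HasMFDerivAt.comp (y, v) (hasMFDerivAt_extChartAt_symm hy)
    (hasFDerivAt_fst (p := (y, v)) (𝕜 := ℝ)).hasMFDerivAt
  have h3 : (TotalSpace.proj : TangentBundle I M → M) ∘ (extChartAt I.tangent p₀).symm
      =ᶠ[nhds (y, v)] (extChartAt I x₀).symm ∘ Prod.fst := by
    filter_upwards [(isOpen_extChartAt_target (I := I.tangent) p₀).mem_nhds hz] with z hz
    rw [extChartAt_tangent_target] at hz
    exact congrArg TotalSpace.proj (extChartAt_tangent_symm_apply hz.1)
  have h4 := hasMFDerivAt_unique (h2.congr_of_eventuallyEq h3) h1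
  have h5 : tangentCoordSymm I x₀ ((extChartAt I x₀).symm y) (sprayRep I x₀ S (y, v)).1 =
      mfderiv I.tangent I (TotalSpace.proj : TangentBundle I M → M) p
        (tangentCoordSymm I.tangent p₀ p (tangentCoord I.tangent p₀ p (S p))) :=
    congrArg (fun L : E × E →L[ℝ] E ↦ L (sprayRep I x₀ S (y, v))) h4
  rw [tangentCoordSymm_coord hps', hS.proj] at h5
  have h6 : (p.2 : E) = tangentCoordSymm I x₀ ((extChartAt I x₀).symm y) v :=
    congrArg (fun q : TangentBundle I M ↦ (q.2 : E))
      (extChartAt_tangent_symm_apply (z := (y, v)) hy)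
  have hx : (extChartAt I x₀).symm y ∈ (chartAt H x₀).source := by
    simpa using (extChartAt I x₀).map_target hy
  have h7 := congrArg (tangentCoord I x₀ ((extChartAt I x₀).symm y)) (h5.trans h6)
  rwa [tangentCoord_symm hx, tangentCoord_symm hx] at h7

theorem isSpraySolutionOn_of_hasDerivWithinAt (hS : IsSpray S) {y v : ℝ → E} {s : Set ℝ}
    (hs : UniqueDiffOn ℝ s)
    (hy : ∀ t ∈ s, y t ∈ (extChartAt I x₀).target)
    (hyv : ∀ t ∈ s, HasDerivWithinAt (fun t ↦ (y t, v t)) (sprayRep I x₀ S (y t, v t)) s t) :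
    IsSpraySolutionOn S (fun t ↦ (extChartAt I x₀).symm (y t)) s := by
  have hd (t) (ht : t ∈ s) : HasDerivWithinAt y (v t) s t := by
    have h1 : HasDerivWithinAt y (sprayRep I x₀ S (y t, v t)).1 s t := (hyv t ht).fst
    rwa [hS.sprayRep_fst (hy t ht)] at h1
  refine ⟨fun t ht ↦ ((hd t ht).hasMFDerivWithinAt_extChartAt_symm
    (hy t ht)).mdifferentiableWithinAt, ?_⟩
  intro t ht
  have hz (t) (ht : t ∈ s) : (y t, v t) ∈
      (extChartAt I.tangent (⟨x₀, 0⟩ : TangentBundle I M)).target := by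
    rw [extChartAt_tangent_target]; exact ⟨hy t ht, mem_univ _⟩
  refine HasMFDerivWithinAt.smulRight_congr (c := fun t ↦
    (extChartAt I.tangent (⟨x₀, 0⟩ : TangentBundle I M)).symm (y t, v t)) ?_ ?_ ht
  · have h1 := (hyv t ht).hasMFDerivWithinAt_extChartAt_symm (hz t ht)
    have h2 := (extChartAt I.tangent (⟨x₀, 0⟩ : TangentBundle I M)).map_target (hz t ht)
    rw [extChartAt_source] at h2
    rwa [sprayRep, coordRep, tangentCoordSymm_coord h2] at h1
  · intro r hr
    change (⟨_, velocityWithin I (fun t ↦ (extChartAt I x₀).symm (y t)) s r⟩ :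
      TangentBundle I M) = (extChartAt I.tangent (⟨x₀, 0⟩ : TangentBundle I M)).symm (y r, v r)
    rw [extChartAt_tangent_symm_apply (z := (y r, v r)) (hy r hr),
      (hd r hr).velocityWithin_extChartAt_symm (hy r hr) (hs r hr)]

end
end Curves

/-! ### Parallel fields along curves in a fixed chart. -/

section CovariantDerivative

variable {E : Type*} [NormedAddCommGroup E] [NormedSpace ℝ E] [FiniteDimensional ℝ E]
  {H : Type*} [TopologicalSpace H] {I : ModelWithCorners ℝ E H} [I.Boundaryless]
  {M : Type*} [TopologicalSpace M] [ChartedSpace H M] [IsManifold I ∞ M] [IsManifold I 1 M]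
  [IsManifold I 2 M]
  {cov : CovariantDerivative I E (TangentSpace I : M → Type _)} {x₀ : M}

theorem coordChangeL_tangent {x₁ x : M} (hx : x ∈ (chartAt H x₀).source)
    (hx₁ : x ∈ (chartAt H x₁).source) (c : E) :
    (trivializationAt E (TangentSpace I : M → Type _) x₀).coordChangeL ℝ
      (trivializationAt E (TangentSpace I : M → Type _) x₁) x c =
      tangentCoord I x₁ x (tangentCoordSymm I x₀ x c) := by
  rw [Trivialization.coordChangeL_apply _ _ ⟨hx, hx₁⟩, tangentCoord_eq hx₁, tangentCoordSymm,
    Trivialization.symmL_apply _ hx]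

theorem tangentCoord_extend {x₁ x : M} (hx : x ∈ (chartAt H x₁).source) (v : TangentSpace I x₁) :
    tangentCoord I x₁ x (FiberBundle.extend E v x) = tangentCoord I x₁ x₁ v := by
  rw [tangentCoord_eq hx, tangentCoord_eq (mem_chart_source H x₁), FiberBundle.extend,
    Trivialization.apply_mk_symm _ hx]

/-- The covariant derivative is defined in the trivialization centred at `γ t`, whereas `w` uses the
one centred at `x₀`. Subtracting the extension `Z` of the value at `t`, constant in the former,
makes the difference vanish at `t`, so the derivative of the coordinate change drops out. -/
theorem hasCovDerivWithinAt_zero_of_hasDerivWithinAt {y w : ℝ → E} {y' : E} {s : Set ℝ} {t : ℝ}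
    (hs : UniqueDiffWithinAt ℝ s t) (ht : y t ∈ (extChartAt I x₀).target)
    (hy : HasDerivWithinAt y y' s t)
    (hw : HasDerivWithinAt w (-(christoffel cov x₀ (y t) y' (w t))) s t) :
    HasCovDerivWithinAt cov (fun r ↦ (extChartAt I x₀).symm (y r))
      (fun r ↦ tangentCoordSymm I x₀ ((extChartAt I x₀).symm (y r)) (w r)) s t 0 := by
  set γ : ℝ → M := fun r ↦ (extChartAt I x₀).symm (y r) with hγ
  have hx : γ t ∈ (chartAt H x₀).source := by
    simpa [hγ] using (extChartAt I x₀).map_target ht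
  have hγd : MDifferentiableWithinAt 𝓘(ℝ, ℝ) I γ s t :=
    (hy.hasMFDerivWithinAt_extChartAt_symm ht).mdifferentiableWithinAt
  refine ⟨hγd, ?_⟩
  set e := trivializationAt E (TangentSpace I : M → Type _) x₀
  set e' := trivializationAt E (TangentSpace I : M → Type _) (γ t) with he'
  have : ContMDiffVectorBundle 1 E (TangentSpace I : M → Type _) I := by
    have : IsManifold I (1 + 1) M := by simpa [one_add_one_eq_two]
    infer_instance
  have hx' : γ t ∈ e'.baseSet := FiberBundle.mem_baseSet_trivializationAt' (γ t)
  set Z := FiberBundle.extend E (tangentCoordSymm I x₀ (γ t) (w t)) with hZ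
  have hZt : Z (γ t) = tangentCoordSymm I x₀ (γ t) (w t) :=
    FiberBundle.extend_apply_self E _
  have hZd : MDifferentiableAt I I.tangent (fun x ↦ (⟨x, Z x⟩ : TangentBundle I M)) (γ t) :=
    FiberBundle.mdifferentiableAt_extend I E _
  have hyt : extChartAt I x₀ (γ t) = y t := (extChartAt I x₀).right_inv ht
  have hZc := (mdifferentiableAt_section_iff_coordRep hx).1 hZd
  rw [hyt] at hZc
  have hk : HasDerivWithinAt (fun r ↦ w r - coordRep I x₀ Z (y r))
      (-(christoffel cov x₀ (y t) y' (w t)) - fderiv ℝ (coordRep I x₀ Z) (y t) y') s t :=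
    hw.sub (hZc.hasFDerivAt.comp_hasDerivWithinAt t hy)
  have hkt : w t - coordRep I x₀ Z (y t) = 0 := by
    rw [← hyt, coordRep_extChartAt hx, hZt, tangentCoord_symm hx, sub_self]
  have hA : MDifferentiableWithinAt 𝓘(ℝ, ℝ) 𝓘(ℝ, E →L[ℝ] E)
      (fun r ↦ (e.coordChangeL ℝ e' (γ r) : E →L[ℝ] E)) s t :=
    MDifferentiableAt.comp_mdifferentiableWithinAt t
      (mdifferentiableAt_coordChangeL (IB := I) (𝕜 := ℝ) hx hx') hγd
  have hAd := (mdifferentiableWithinAt_iff_differentiableWithinAt.1 hA).hasDerivWithinAt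
  have hder := ((hAd.clm_apply hk).add_const (e' ⟨γ t, tangentCoordSymm I x₀ (γ t) (w t)⟩).2)
  rw [hkt, map_zero, zero_add] at hder
  have hγc : ContinuousWithinAt γ s t := hγd.continuousWithinAt
  have hev : ∀ᶠ r in nhdsWithin t s, (e' ⟨γ r, tangentCoordSymm I x₀ (γ r) (w r)⟩).2 =
      (e.coordChangeL ℝ e' (γ r) : E →L[ℝ] E) (w r - coordRep I x₀ Z (y r)) +
        (e' ⟨γ t, tangentCoordSymm I x₀ (γ t) (w t)⟩).2 := by
    filter_upwards [hγc (e.open_baseSet.mem_nhds hx), hγc (e'.open_baseSet.mem_nhds hx')]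
      with r hr hr'
    have h1 := coordChangeL_tangent (I := I) hr hr' (w r - coordRep I x₀ Z (y r))
    have h2 : coordRep I x₀ Z (y r) = tangentCoord I x₀ (γ r) (Z (γ r)) := rfl
    have h3 : tangentCoordSymm I x₀ (γ r) (w r - coordRep I x₀ Z (y r)) =
        tangentCoordSymm I x₀ (γ r) (w r) - Z (γ r) := by
      rw [h2, map_sub, tangentCoordSymm_coord hr]
    have h4 : tangentCoord I (γ t) (γ r) (tangentCoordSymm I x₀ (γ r) (w r) - Z (γ r)) =
        tangentCoord I (γ t) (γ r) (tangentCoordSymm I x₀ (γ r) (w r)) -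
          tangentCoord I (γ t) (γ r) (Z (γ r)) := map_sub _ _ _
    rw [h3, h4, hZ, tangentCoord_extend hr', tangentCoord_eq hr',
      tangentCoord_eq (mem_chart_source H (γ t))] at h1
    exact (sub_eq_iff_eq_add.1 h1.symm)
  have hval : (e.coordChangeL ℝ e' (γ t) : E →L[ℝ] E)
      (-(christoffel cov x₀ (y t) y' (w t)) - fderiv ℝ (coordRep I x₀ Z) (y t) y') =
      (e' ⟨γ t, 0 - cov Z (γ t) (velocityWithin I γ s t)⟩).2 := by
    rw [hy.velocityWithin_extChartAt_symm ht hs]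
    have h1 := tangentCoord_cov cov hx hZd (tangentCoordSymm I x₀ (γ t) y')
    rw [tangentCoord_symm hx, hyt, hZt, tangentCoord_symm hx] at h1
    have h2 : -(christoffel cov x₀ (y t) y' (w t)) - fderiv ℝ (coordRep I x₀ Z) (y t) y' =
      tangentCoord I x₀ (γ t) (0 - cov Z (γ t) (tangentCoordSymm I x₀ (γ t) y')) := by
      rw [map_sub, h1, map_zero]; abel
    rw [h2]
    have h3 := coordChangeL_tangent (I := I) hx hx' (tangentCoord I x₀ (γ t)
      (0 - cov Z (γ t) (tangentCoordSymm I x₀ (γ t) y')))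
    rw [tangentCoordSymm_coord hx, tangentCoord_eq hx'] at h3
    exact h3
  exact (hder.congr_of_eventuallyEq hev (by simp [hkt])).congr_deriv hval

end CovariantDerivative

/-! ### Partitions: restriction and concatenation. -/

section Pieces

variable {p q : Set ℝ → Prop} {a b c : ℝ}

theorem OnPieces.mono (h : OnPieces p a b) (hpq : ∀ s ⊆ Iic b, p s → q s) : OnPieces q a b := by
  obtain ⟨k, t, hk, h0, hkb, ht, hp⟩ := h
  refine ⟨k, t, hk, h0, hkb, ht, fun i hi ↦ hpq _ ?_ (hp i hi)⟩
  have hm : MonotoneOn t (Iic k) := monotoneOn_of_le_succ ordConnected_Iic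
    fun i _ _ hi ↦ (ht i (Order.succ_le_iff.1 hi)).le
  exact fun r hr ↦ hr.2.trans ((hm (mem_Iic.2 hi) (mem_Iic.2 le_rfl) hi).trans_eq hkb)

/-- The alternative `a = b` stands for the trivial curve, which has no partition because at least
one piece is required. -/
theorem OnPieces.append (h : a = b ∨ OnPieces p a b) (hbc : b < c) (hp : p (Icc b c)) :
    OnPieces p a c := by
  rcases h with rfl | ⟨k, t, hk, h0, hkb, ht, hpt⟩
  · refine ⟨1, fun i ↦ if i = 0 then a else c, one_pos, by simp, by simp, ?_, ?_⟩
    all_goals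
      intro i hi
      obtain rfl : i = 0 := by omega
      simpa
  · have h1 (i : ℕ) (hi : i < k) : (fun i ↦ if i ≤ k then t i else c) (i + 1) = t (i + 1) :=
      if_pos (by omega)
    refine ⟨k + 1, fun i ↦ if i ≤ k then t i else c, by omega, by simpa, by simp, ?_, ?_⟩
    · intro i hi
      rcases (Nat.lt_succ_iff.1 hi).lt_or_eq with hi' | rfl
      · simpa [hi'.le, Nat.succ_le_iff.2 hi'] using ht i hi'
      · simpa [hkb] using hbc
    · intro i hi
      rcases (Nat.lt_succ_iff.1 hi).lt_or_eq with hi' | rfl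
      · simpa [hi'.le, Nat.succ_le_iff.2 hi'] using hpt i hi'
      · simpa [hkb] using hp

end Pieces

/-! ### Coordinates on the bundle of bilinear forms. -/

section FormBundle

variable {E : Type*} [NormedAddCommGroup E] [NormedSpace ℝ E]
  {H : Type*} [TopologicalSpace H] {I : ModelWithCorners ℝ E H}
  {M : Type*} [TopologicalSpace M] [ChartedSpace H M] [IsManifold I 1 M] {x₀ x : M}

variable (I M) in
/-- The bundle of bilinear forms on the tangent spaces. -/
abbrev FormBundle : Type _ :=
  TotalSpace (E →L[ℝ] E →L[ℝ] ℝ) fun x : M ↦ TangentSpace I x →L[ℝ] TangentSpace I x →L[ℝ] ℝ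

variable (I) in
/-- The coordinates of a bilinear form on `T_xM` in the chart centred at `x₀`. -/
def formCoord (x₀ x : M) (g : TangentSpace I x →L[ℝ] TangentSpace I x →L[ℝ] ℝ) :
    E →L[ℝ] E →L[ℝ] ℝ :=
  ContinuousLinearMap.precomp ℝ (tangentCoordSymm I x₀ x) ∘L g ∘L tangentCoordSymm I x₀ x

variable (I) in
/-- The bilinear form on `T_xM` with given coordinates in the chart centred at `x₀`. -/
def formCoordSymm (x₀ x : M) (g : E →L[ℝ] E →L[ℝ] ℝ) :
    TangentSpace I x →L[ℝ] TangentSpace I x →L[ℝ] ℝ :=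
  ContinuousLinearMap.precomp ℝ (tangentCoord I x₀ x) ∘L g ∘L tangentCoord I x₀ x

theorem formCoord_apply (g : TangentSpace I x →L[ℝ] TangentSpace I x →L[ℝ] ℝ) (ξ η : E) :
    formCoord I x₀ x g ξ η = g (tangentCoordSymm I x₀ x ξ) (tangentCoordSymm I x₀ x η) :=
  rfl

theorem formCoord_formCoordSymm (hx : x ∈ (chartAt H x₀).source) (g : E →L[ℝ] E →L[ℝ] ℝ) :
    formCoord I x₀ x (formCoordSymm I x₀ x g) = g := by
  ext ξ η
  simp [formCoord, formCoordSymm, hx]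

theorem formCoordSymm_formCoord (hx : x ∈ (chartAt H x₀).source)
    (g : TangentSpace I x →L[ℝ] TangentSpace I x →L[ℝ] ℝ) :
    formCoordSymm I x₀ x (formCoord I x₀ x g) = g := by
  ext ξ η
  simp [formCoord, formCoordSymm, hx]

theorem trivializationAt_form_apply (hx : x ∈ (chartAt H x₀).source)
    (g : TangentSpace I x →L[ℝ] TangentSpace I x →L[ℝ] ℝ) :
    trivializationAt (E →L[ℝ] E →L[ℝ] ℝ)
      (fun x : M ↦ TangentSpace I x →L[ℝ] TangentSpace I x →L[ℝ] ℝ) x₀ ⟨x, g⟩ =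
      (x, formCoord I x₀ x g) := by
  rw [hom_trivializationAt_apply]
  refine Prod.ext rfl ?_
  ext ξ η
  refine (inCoordinates_apply_eq₂ hx hx (mem_univ _)).trans ?_
  rw [formCoord_apply, tangentCoordSymm, Trivialization.symmL_apply _ hx,
    Trivialization.symmL_apply _ hx]
  simp

theorem trivializationAt_form_symm_apply (hx : x ∈ (chartAt H x₀).source)
    (g : E →L[ℝ] E →L[ℝ] ℝ) :
    (trivializationAt (E →L[ℝ] E →L[ℝ] ℝ)
      (fun x : M ↦ TangentSpace I x →L[ℝ] TangentSpace I x →L[ℝ] ℝ)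
      x₀).toOpenPartialHomeomorph.symm (x, g) = ⟨x, formCoordSymm I x₀ x g⟩ := by
  have h := trivializationAt_form_apply hx (formCoordSymm I x₀ x g)
  rw [formCoord_formCoordSymm hx] at h
  rw [← h]
  exact (trivializationAt (E →L[ℝ] E →L[ℝ] ℝ)
      (fun x : M ↦ TangentSpace I x →L[ℝ] TangentSpace I x →L[ℝ] ℝ)
      x₀).toOpenPartialHomeomorph.left_inv (Trivialization.mem_source _ |>.2 ⟨hx, hx, mem_univ _⟩)

end FormBundle

/-! ### Prolonging a transport of `g₀` by one more spray solution. -/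

section TransportedForms

variable {E : Type*} [NormedAddCommGroup E] [NormedSpace ℝ E] [FiniteDimensional ℝ E]
  {H : Type*} [TopologicalSpace H] {I : ModelWithCorners ℝ E H}
  {M : Type*} [TopologicalSpace M] [ChartedSpace H M] [IsManifold I ∞ M] [IsManifold I 1 M]
  [IsManifold I 2 M] [IsManifold I.tangent 1 (TangentBundle I M)]
  (cov : CovariantDerivative I E (TangentSpace I : M → Type _))
  (S : (v : TangentBundle I M) → TangentSpace I.tangent v)
  (m₀ : M) (g₀ : TangentSpace I m₀ →L[ℝ] TangentSpace I m₀ →L[ℝ] ℝ)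

/-- The bilinear forms obtained from `g₀` by parallel transport along piecewise solutions
of `S` that start at `m₀`. -/
def transportedForms : Set (FormBundle I M) :=
  {p | ∃ (a b : ℝ) (γ : ℝ → M) (P : TangentSpace I m₀ ≃ₗ[ℝ] TangentSpace I (γ b)),
    γ a = m₀ ∧ IsPiecewiseSpraySolution S γ a b ∧ IsParallelTransport cov γ a b P ∧
    ∃ g : TangentSpace I (γ b) →L[ℝ] TangentSpace I (γ b) →L[ℝ] ℝ,
      p = ⟨γ b, g⟩ ∧ ∀ ξ η, g (P ξ) (P η) = g₀ ξ η}

variable {cov S m₀ g₀} [I.Boundaryless] {x₀ : M}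

theorem mem_transportedForms_of_transportFlow (hS : IsSpray S) {a b : ℝ} {γ : ℝ → M}
    (hγ : γ a = m₀) (P : TangentSpace I m₀ ≃ₗ[ℝ] TangentSpace I (γ b))
    (hsol : a = b ∨ IsPiecewiseSpraySolution S γ a b)
    (hP : ∀ u : TangentSpace I m₀, ∃ V : (t : ℝ) → TangentSpace I (γ t),
      (a = b ∨ IsParallelAlong cov γ V a b) ∧
        (⟨γ a, V a⟩ : TangentBundle I M) = ⟨m₀, u⟩ ∧ V b = P u)
    (g : TangentSpace I (γ b) →L[ℝ] TangentSpace I (γ b) →L[ℝ] ℝ)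
    (hg : ∀ ξ η, g (P ξ) (P η) = g₀ ξ η) (hb : γ b ∈ (chartAt H x₀).source)
    {y v : ℝ → E} {T Q : ℝ → E →L[ℝ] E} {h : ℝ}
    (hf : IsTransportFlowOn (extChartAt I x₀).target (sprayRep I x₀ S) (christoffel cov x₀)
      y v T Q h) (hy : y 0 = extChartAt I x₀ (γ b)) (hh : 0 < h) (hab : a ≤ b) :
    (⟨(extChartAt I x₀).symm (y h), formCoordSymm I x₀ ((extChartAt I x₀).symm (y h))
      ((formCoord I x₀ (γ b) g).bilinearComp (Q h) (Q h))⟩ : FormBundle I M) ∈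
        transportedForms cov S m₀ g₀ := by
  set x' := (extChartAt I x₀).symm (y h) with hx'
  have hhI : h ∈ Icc 0 h := ⟨hh.le, le_rfl⟩
  have hx's : x' ∈ (chartAt H x₀).source := by
    simpa [hx'] using (extChartAt I x₀).map_target (hf.mem h hhI)
  have hTQ (c : E) : T h (Q h c) = c := DFunLike.congr_fun (hf.T_comp_Q hhI) c
  have hQT (c : E) : Q h (T h c) = c := DFunLike.congr_fun (hf.Q_comp_T hhI) c
  let γ₁ : ℝ → M := fun t ↦ (extChartAt I x₀).symm (y (t - b))
  -- The given curve is followed by the spray solution, shifted to start at time `b`; the transports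
  -- compose, and the form is pulled back by the inverse `Q h`.
  let γ' : ℝ → M := fun t ↦ if t ≤ b then γ t else γ₁ t
  have hγ'1 : EqOn γ' γ (Iic b) := fun t ht ↦ if_pos ht
  have hγ'2 : EqOn γ' γ₁ (Icc b (b + h)) := by
    intro t ht
    rcases ht.1.eq_or_lt with rfl | hlt
    · simp only [γ', γ₁, le_refl, if_true, sub_self, hy]
      exact ((extChartAt I x₀).left_inv (by rwa [extChartAt_source])).symm
    · exact if_neg hlt.not_ge
  have hγ'c : γ' (b + h) = x' := (hγ'2 ⟨by linarith, le_rfl⟩).trans (by simp [γ₁, hx'])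
  have hsh : MapsTo (fun t : ℝ ↦ t - b) (Icc b (b + h)) (Icc 0 h) :=
    fun t ht ↦ ⟨by linarith [ht.1], by linarith [ht.2]⟩
  have hud : UniqueDiffOn ℝ (Icc b (b + h)) := uniqueDiffOn_Icc (by linarith)
  have hshift {F : Type _} [NormedAddCommGroup F] [NormedSpace ℝ F] {f : ℝ → F} {f' : F} {t : ℝ}
      (ht : t ∈ Icc b (b + h)) (hf : HasDerivWithinAt f f' (Icc 0 h) (t - b)) :
      HasDerivWithinAt (fun t ↦ f (t - b)) f' (Icc b (b + h)) t := by
    have := hf.scomp t ((hasDerivWithinAt_id t _).sub_const b) hsh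
    rwa [one_smul] at this
  let P₁ : E ≃ₗ[ℝ] E := LinearEquiv.ofLinearMap
    ((tangentCoordSymm I x₀ x' ∘L T h ∘L tangentCoord I x₀ (γ b) : E →L[ℝ] E) : E →ₗ[ℝ] E)
    ((tangentCoordSymm I x₀ (γ b) ∘L Q h ∘L tangentCoord I x₀ x' : E →L[ℝ] E) : E →ₗ[ℝ] E)
    (LinearMap.ext fun c ↦ by
      change tangentCoordSymm I x₀ x' (T h (tangentCoord I x₀ (γ b) (tangentCoordSymm I x₀ (γ b)
        (Q h (tangentCoord I x₀ x' c))))) = c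
      rw [tangentCoord_symm hb, hTQ]
      exact tangentCoordSymm_coord hx's c)
    (LinearMap.ext fun c ↦ by
      change tangentCoordSymm I x₀ (γ b) (Q h (tangentCoord I x₀ x' (tangentCoordSymm I x₀ x'
        (T h (tangentCoord I x₀ (γ b) c))))) = c
      rw [tangentCoord_symm hx's, hQT]
      exact tangentCoordSymm_coord hb c)
  have hsol' : IsPiecewiseSpraySolution S γ' a (b + h) := by
    refine OnPieces.append (b := b) (hsol.imp_right fun hs ↦ hs.mono fun s hs h ↦
      h.congr (hγ'1.mono hs)) (by linarith) ?_
    refine IsSpraySolutionOn.congr (c := γ₁) ?_ hγ'2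
    exact isSpraySolutionOn_of_hasDerivWithinAt (v := fun t ↦ v (t - b)) hS hud
      (fun t ht ↦ hf.mem _ (hsh ht)) (fun t ht ↦ hshift ht (hf.hasDerivWithinAt _ (hsh ht)))
  refine ⟨a, b + h, γ', P.trans P₁, (hγ'1 hab).trans hγ, hsol', ?_, ?_⟩
  · intro u
    obtain ⟨V, hV, hVa, hVb⟩ := hP u
    let w : ℝ → E := fun t ↦ T (t - b) (tangentCoord I x₀ (γ b) (P u))
    let V₁ : ℝ → E := fun t ↦ tangentCoordSymm I x₀ (γ₁ t) (w t)
    let V' : ℝ → E := fun t ↦ if t ≤ b then V t else V₁ t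
    have hV'1 : EqOn V' V (Iic b) := fun t ht ↦ if_pos ht
    have hV'2 : EqOn V' V₁ (Icc b (b + h)) := by
      intro t ht
      rcases ht.1.eq_or_lt with rfl | hlt
      · have key (x : M) (hx : x = γ b) (c : E) :
            (tangentCoordSymm I x₀ x (tangentCoord I x₀ (γ b) c) : E) = c := by
          subst hx
          exact tangentCoordSymm_coord hb c
        simp only [V', V₁, w, le_refl, sub_self, hf.T_zero]
        exact hVb.trans (key _ ((hγ'2 ⟨le_rfl, by linarith⟩).symm.trans (hγ'1 self_mem_Iic)) _).symm
      · exact if_neg hlt.not_ge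
    refine ⟨V', ?_, ?_, ?_⟩
    · refine OnPieces.append (b := b) (hV.imp_right fun hs ↦ hs.mono fun s hs h t ht ↦
        (h t ht).congr (hγ'1.mono hs) (hV'1.mono hs) ht) (by linarith) ?_
      intro t ht
      refine HasCovDerivWithinAt.congr (c := γ₁) (V := V₁) hγ'2 hV'2 ht ?_
      refine hasCovDerivWithinAt_zero_of_hasDerivWithinAt (hud t ht) (hf.mem _ (hsh ht))
        (hshift ht (hf.hasDerivWithinAt_fst _ (hsh ht))) ?_
      have := (hshift ht (hf.hasDerivWithinAt_T _ (hsh ht))).clm_apply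
        (hasDerivWithinAt_const t _ (tangentCoord I x₀ (γ b) (P u)))
      refine this.congr_deriv ?_
      simp [w]
    · have key (x : M) (hx : x = γ a) (c : E) (hc : c = V a) :
          (⟨x, c⟩ : TangentBundle I M) = ⟨γ a, V a⟩ := by
        subst hx hc; rfl
      exact (key _ (hγ'1 hab) _ (hV'1 hab)).trans hVa
    · refine (hV'2 ⟨by linarith, le_rfl⟩).trans ?_
      have key (r : ℝ) (hr : r = h) (c : E) : (tangentCoordSymm I x₀
          ((extChartAt I x₀).symm (y r)) (T r (tangentCoord I x₀ (γ b) c)) : E) = P₁ c := by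
        subst hr; rfl
      exact key _ (add_sub_cancel_left b h) _
  -- The endpoint of `γ'` is only provably equal to `x'`, so the claim is proved for a variable
  -- point.
  · have key (x : M) (hx : x = x') : ∃ g' : TangentSpace I x →L[ℝ] TangentSpace I x →L[ℝ] ℝ,
        (⟨x', formCoordSymm I x₀ x' ((formCoord I x₀ (γ b) g).bilinearComp (Q h) (Q h))⟩ :
          FormBundle I M) = ⟨x, g'⟩ ∧ ∀ ξ η : TangentSpace I m₀,
        g' (P₁ (P ξ) : E) (P₁ (P η) : E) = g₀ ξ η := by
      rw [hx]
      refine ⟨_, rfl, fun ξ η ↦ ?_⟩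
      have hP₁ (c : TangentSpace I (γ b)) : tangentCoordSymm I x₀ (γ b)
          (Q h (tangentCoord I x₀ x' (P₁ c))) = c := by
        change tangentCoordSymm I x₀ (γ b) (Q h (tangentCoord I x₀ x' (tangentCoordSymm I x₀ x'
          (T h (tangentCoord I x₀ (γ b) c))))) = _
        rw [tangentCoord_symm hx's, hQT]
        exact tangentCoordSymm_coord hb c
      change g (tangentCoordSymm I x₀ (γ b) (Q h (tangentCoord I x₀ x' (P₁ (P ξ)))))
        (tangentCoordSymm I x₀ (γ b) (Q h (tangentCoord I x₀ x' (P₁ (P η))))) = _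
      rw [hP₁, hP₁, hg]
    exact key _ hγ'c

end TransportedForms

/-! ### Charts of the form bundle and their continuity. -/

section FormCoordinates

variable {E : Type*} [NormedAddCommGroup E] [NormedSpace ℝ E]
  {H : Type*} [TopologicalSpace H] {I : ModelWithCorners ℝ E H}
  {M : Type*} [TopologicalSpace M] [ChartedSpace H M] [IsManifold I 1 M] {x₀ : M}

variable (I) in
/-- The chart of the bundle of bilinear forms centred at `x₀`. -/
def formChart (x₀ : M) (p : FormBundle I M) : E × (E →L[ℝ] E →L[ℝ] ℝ) :=
  (extChartAt I x₀ p.proj, formCoord I x₀ p.proj p.2)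

variable (I) in
/-- The inverse of the chart of the bundle of bilinear forms centred at `x₀`. -/
def formChartSymm (x₀ : M) (z : E × (E →L[ℝ] E →L[ℝ] ℝ)) : FormBundle I M :=
  ⟨(extChartAt I x₀).symm z.1, formCoordSymm I x₀ ((extChartAt I x₀).symm z.1) z.2⟩

theorem extChartAt_symm_mem_source {y : E} (hy : y ∈ (extChartAt I x₀).target) :
    (extChartAt I x₀).symm y ∈ (chartAt H x₀).source := by
  simpa using (extChartAt I x₀).map_target hy

theorem formChart_formChartSymm {z : E × (E →L[ℝ] E →L[ℝ] ℝ)}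
    (hz : z.1 ∈ (extChartAt I x₀).target) : formChart I x₀ (formChartSymm I x₀ z) = z :=
  Prod.ext ((extChartAt I x₀).right_inv hz)
    (formCoord_formCoordSymm (extChartAt_symm_mem_source hz) _)

theorem formChartSymm_formChart {p : FormBundle I M} (hp : p.proj ∈ (chartAt H x₀).source) :
    formChartSymm I x₀ (formChart I x₀ p) = p := by
  obtain ⟨x, g⟩ := p
  have key (x' : M) (hx : x' = x) :
      (⟨x', formCoordSymm I x₀ x' (formCoord I x₀ x g)⟩ : FormBundle I M) = ⟨x, g⟩ := by
    subst hx
    rw [formCoordSymm_formCoord hp]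
  exact key _ ((extChartAt I x₀).left_inv (by rwa [extChartAt_source]))

theorem continuousAt_formChart {p : FormBundle I M} (hp : p.proj ∈ (chartAt H x₀).source) :
    ContinuousAt (formChart I x₀) p := by
  let e := trivializationAt (E →L[ℝ] E →L[ℝ] ℝ)
    (fun x : M ↦ TangentSpace I x →L[ℝ] TangentSpace I x →L[ℝ] ℝ) x₀
  have he : ContinuousAt e p :=
    e.continuousOn.continuousAt
      (e.open_source.mem_nhds (Trivialization.mem_source _ |>.2 ⟨hp, hp, mem_univ _⟩))
  have hc : ContinuousAt TotalSpace.proj p := (FiberBundle.continuous_proj _ _).continuousAt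
  refine ContinuousAt.prodMk ?_ ?_
  · exact ContinuousAt.comp (continuousAt_extChartAt' (by rwa [extChartAt_source])) hc
  · refine (continuousAt_snd.comp he).congr ?_
    filter_upwards [hc.preimage_mem_nhds ((chartAt H x₀).open_source.mem_nhds hp)] with q hq
    exact congrArg Prod.snd (trivializationAt_form_apply hq q.2)

theorem continuousAt_formChartSymm [I.Boundaryless] {z : E × (E →L[ℝ] E →L[ℝ] ℝ)}
    (hz : z.1 ∈ (extChartAt I x₀).target) : ContinuousAt (formChartSymm I x₀) z := by
  let e := trivializationAt (E →L[ℝ] E →L[ℝ] ℝ)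
    (fun x : M ↦ TangentSpace I x →L[ℝ] TangentSpace I x →L[ℝ] ℝ) x₀
  have hzs := extChartAt_symm_mem_source hz
  have he : ContinuousAt e.toOpenPartialHomeomorph.symm ((extChartAt I x₀).symm z.1, z.2) :=
    e.toOpenPartialHomeomorph.symm.continuousAt
      (Trivialization.mem_target _ |>.2 ⟨hzs, hzs, mem_univ _⟩)
  have hc : ContinuousAt (fun z : E × (E →L[ℝ] E →L[ℝ] ℝ) ↦ ((extChartAt I x₀).symm z.1, z.2)) z :=
    ((continuousAt_extChartAt_symm'' hz).comp continuousAt_fst).prodMk continuousAt_snd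
  refine (ContinuousAt.comp (f := fun z : E × (E →L[ℝ] E →L[ℝ] ℝ) ↦
    ((extChartAt I x₀).symm z.1, z.2)) he hc).congr ?_
  filter_upwards [continuousAt_fst.preimage_mem_nhds
    ((isOpen_extChartAt_target x₀).mem_nhds hz)] with q hq
  exact trivializationAt_form_symm_apply (extChartAt_symm_mem_source hq) q.2

end FormCoordinates

/-! ### The closure of the transported forms is invariant to first order. -/

section Subtangency

variable {E : Type*} [NormedAddCommGroup E] [NormedSpace ℝ E] [FiniteDimensional ℝ E]
  {H : Type*} [TopologicalSpace H] {I : ModelWithCorners ℝ E H} [I.Boundaryless]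
  {M : Type*} [TopologicalSpace M] [ChartedSpace H M] [IsManifold I ∞ M] [IsManifold I 1 M]
  [IsManifold I 2 M] [IsManifold I.tangent 1 (TangentBundle I M)]
  {cov : CovariantDerivative I E (TangentSpace I : M → Type _)}
  {S : (v : TangentBundle I M) → TangentSpace I.tangent v}
  {m₀ : M} {g₀ : TangentSpace I m₀ →L[ℝ] TangentSpace I m₀ →L[ℝ] ℝ} {x₀ : M}
  {y v : ℝ → E} {T Q : ℝ → E →L[ℝ] E} {h : ℝ}

theorem OnPieces.le {p : Set ℝ → Prop} {a b : ℝ} (h : OnPieces p a b) : a ≤ b := by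
  obtain ⟨k, t, hk, h0, hkb, ht, -⟩ := h
  have hm : MonotoneOn t (Iic k) := monotoneOn_of_le_succ ordConnected_Iic
    fun i _ _ hi ↦ (ht i (Order.succ_le_iff.1 hi)).le
  simpa [h0, hkb] using hm (mem_Iic.2 (Nat.zero_le k)) (mem_Iic.2 le_rfl) (Nat.zero_le k)

theorem formChartSymm_mem_transportedForms_base (hS : IsSpray S)
    (hm₀ : m₀ ∈ (chartAt H x₀).source)
    (hf : IsTransportFlowOn (extChartAt I x₀).target (sprayRep I x₀ S) (christoffel cov x₀)
      y v T Q h) (hy : y 0 = extChartAt I x₀ m₀) (hh : 0 < h) :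
    formChartSymm I x₀ (y h, (formCoord I x₀ m₀ g₀).bilinearComp (Q h) (Q h)) ∈
      transportedForms cov S m₀ g₀ :=
  mem_transportedForms_of_transportFlow (a := 0) (b := 0) (γ := fun _ ↦ m₀) hS rfl
    (LinearEquiv.refl ℝ _) (Or.inl rfl) (fun u ↦ ⟨fun _ ↦ u, Or.inl rfl, rfl, rfl⟩) g₀
    (fun _ _ ↦ rfl) hm₀ hf hy hh le_rfl

theorem formChartSymm_mem_transportedForms (hS : IsSpray S) {p : FormBundle I M}
    (hp : p ∈ transportedForms cov S m₀ g₀) (hpx : p.proj ∈ (chartAt H x₀).source)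
    (hf : IsTransportFlowOn (extChartAt I x₀).target (sprayRep I x₀ S) (christoffel cov x₀)
      y v T Q h) (hy : y 0 = extChartAt I x₀ p.proj) (hh : 0 < h) :
    formChartSymm I x₀ (y h, (formCoord I x₀ p.proj p.2).bilinearComp (Q h) (Q h)) ∈
      transportedForms cov S m₀ g₀ := by
  obtain ⟨a, b, γ, P, hγ, hsol, hP, g, rfl, hg⟩ := hp
  exact mem_transportedForms_of_transportFlow hS hγ P (Or.inr hsol)
    (fun u ↦ (hP u).imp fun V hV ↦ ⟨Or.inr hV.1, hV.2⟩) g hg hpx hf hy hh hsol.le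

/-- The initial velocity is the horizontal lift of `v 0`, as Nagumo's theorem needs. -/
theorem IsTransportFlowOn.hasDerivWithinAt_prod {Ω : Set E} {G : E × E → E × E}
    {Γ : E → E →L[ℝ] E →L[ℝ] E} (hf : IsTransportFlowOn Ω G Γ y v T Q h) (hh : 0 < h)
    (g : E →L[ℝ] E →L[ℝ] ℝ) :
    HasDerivWithinAt (fun t ↦ (y t, g.bilinearComp (Q t) (Q t)))
      (v 0, formConnection Γ (y 0) (v 0) g) (Ici 0) 0 :=
  ((hf.hasDerivWithinAt_fst 0 ⟨le_rfl, hh.le⟩).mono_of_mem_nhdsWithin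
    (Icc_mem_nhdsGE hh)).prodMk (hf.hasDerivWithinAt_form hh g)

theorem IsTransportFlowOn.bilinearComp_zero {Ω : Set E} {G : E × E → E × E}
    {Γ : E → E →L[ℝ] E →L[ℝ] E} (hf : IsTransportFlowOn Ω G Γ y v T Q h)
    (g : E →L[ℝ] E →L[ℝ] ℝ) : g.bilinearComp (Q 0) (Q 0) = g := by
  rw [hf.Q_zero]; rfl

/-- The trivial curve is not a piecewise solution, but `g₀` is the limit of its transports along a
solution over `[0, t]` as `t` tends to `0`. -/
theorem mem_closure_transportedForms_base [T2Space M]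
    (hcov : CovariantDerivative.ContMDiffCovariantDerivative cov ∞) (hS : IsSpray S) :
    (⟨m₀, g₀⟩ : FormBundle I M) ∈ closure (transportedForms cov S m₀ g₀) := by
  have hm := mem_chart_source H m₀
  have hy₀ := mem_extChartAt_target (I := I) m₀
  obtain ⟨ε, hε, y, v, T, Q, hf, -⟩ := exists_transportFlow
    (isOpen_extChartAt_target (I := I) m₀) hS.contDiffOn_sprayRep
    (fun y hy v ↦ hS.sprayRep_fst hy v) (contDiffOn_christoffel cov hcov m₀) hy₀ 0
  obtain ⟨hy, hv, hf⟩ := hf.self_of_nhds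
  set z := formChart I m₀ ⟨m₀, g₀⟩ with hz
  have hq := (hf.hasDerivWithinAt_prod hε z.2).continuousWithinAt.mono Ioi_subset_Ici_self
  have hq0 : (y z.1 0, z.2.bilinearComp (Q z.1 0) (Q z.1 0)) = z :=
    Prod.ext hy (hf.bilinearComp_zero _)
  have ht := (ContinuousAt.tendsto (continuousAt_formChartSymm (I := I) (z := z) hy₀)).comp
    (hq0 ▸ hq.tendsto)
  rw [formChartSymm_formChart hm] at ht
  rw [mem_closure_iff_frequently]
  refine ht.frequently (Filter.Eventually.frequently ?_)
  filter_upwards [Ioc_mem_nhdsGT hε] with t ht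
  exact formChartSymm_mem_transportedForms_base hS hm (hf.mono ht.2) hy ht.1

theorem exists_curve_mem_closure_transportedForms [T2Space M]
    (hcov : CovariantDerivative.ContMDiffCovariantDerivative cov ∞) (hS : IsSpray S)
    {z : E × (E →L[ℝ] E →L[ℝ] ℝ)} (hz : z.1 ∈ (extChartAt I x₀).target)
    (hzK : formChartSymm I x₀ z ∈ closure (transportedForms cov S m₀ g₀)) (u : E) :
    ∃ q : ℝ → E × (E →L[ℝ] E →L[ℝ] ℝ), q 0 = z ∧
      HasDerivWithinAt q (u, formConnection (christoffel cov x₀) z.1 u z.2) (Ici 0) 0 ∧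
      ∀ᶠ h in nhdsWithin 0 (Ioi 0), (q h).1 ∈ (extChartAt I x₀).target ∧
        formChartSymm I x₀ (q h) ∈ closure (transportedForms cov S m₀ g₀) := by
  obtain ⟨ε, hε, y, v, T, Q, hf, hc⟩ := exists_transportFlow
    (isOpen_extChartAt_target (I := I) x₀) hS.contDiffOn_sprayRep
    (fun y hy v ↦ hS.sprayRep_fst hy v) (contDiffOn_christoffel cov hcov x₀) hz u
  obtain ⟨hy, hv, hf₀⟩ := hf.self_of_nhds
  refine ⟨fun t ↦ (y z.1 t, z.2.bilinearComp (Q z.1 t) (Q z.1 t)),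
    Prod.ext hy (hf₀.bilinearComp_zero _), ?_, ?_⟩
  · have := hf₀.hasDerivWithinAt_prod hε z.2
    rwa [hy, hv] at this
  filter_upwards [Ioc_mem_nhdsGT hε] with t ht
  have htI : t ∈ Icc 0 ε := ⟨ht.1.le, ht.2⟩
  refine ⟨hf₀.mem t htI, ?_⟩
  set p := formChartSymm I x₀ z with hp
  have hps : p.proj ∈ (chartAt H x₀).source := extChartAt_symm_mem_source hz
  have hpz : formChart I x₀ p = z := formChart_formChartSymm hz
  have hF : ContinuousAt (fun w : E × (E →L[ℝ] E →L[ℝ] ℝ) ↦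
      (y w.1 t, w.2.bilinearComp (Q w.1 t) (Q w.1 t))) z := by
    have h1 : ContinuousAt (fun w : E × (E →L[ℝ] E →L[ℝ] ℝ) ↦ y w.1 t) z :=
      ContinuousAt.comp (g := (y · t)) (hc t htI).1 continuousAt_fst
    have h2 : ContinuousAt (fun w : E × (E →L[ℝ] E →L[ℝ] ℝ) ↦ Q w.1 t) z :=
      ContinuousAt.comp (g := (Q · t)) (hc t htI).2 continuousAt_fst
    refine h1.prodMk ?_
    have h3 := ((ContinuousLinearMap.flipₗᵢ ℝ E E ℝ).continuous.continuousAt.comp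
      (continuousAt_snd.clm_comp h2)).clm_comp h2
    exact (ContinuousLinearMap.flipₗᵢ ℝ E E ℝ).continuous.continuousAt.comp h3
  -- Following the flow for the fixed time `t`, with initial velocity of fixed coordinates `u`, is
  -- continuous at `p` and sends nearby transported forms to transported forms; hence it sends `p`
  -- into the closure.
  have hG : ContinuousAt (fun p' ↦ formChartSymm I x₀ (y (formChart I x₀ p').1 t,
      (formChart I x₀ p').2.bilinearComp (Q (formChart I x₀ p').1 t)
        (Q (formChart I x₀ p').1 t))) p := by
    have h1 : ContinuousAt (fun p' ↦ (y (formChart I x₀ p').1 t,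
      (formChart I x₀ p').2.bilinearComp (Q (formChart I x₀ p').1 t)
        (Q (formChart I x₀ p').1 t))) p :=
      ContinuousAt.comp_of_eq hF (continuousAt_formChart hps) hpz
    refine ContinuousAt.comp_of_eq (continuousAt_formChartSymm (I := I)
      (z := (y z.1 t, z.2.bilinearComp (Q z.1 t) (Q z.1 t))) (hf₀.mem t htI)) h1 ?_
    simp only [hpz]
  have hG' := hG.tendsto
  simp only [hpz] at hG'
  rw [mem_closure_iff_frequently] at hzK ⊢
  refine hG'.frequently (hzK.mp ?_)
  have hcf : Filter.Tendsto (fun p' ↦ (formChart I x₀ p').1) (nhds p) (nhds z.1) := by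
    have := (continuousAt_fst.comp (continuousAt_formChart hps)).tendsto
    rwa [Function.comp_apply, hpz] at this
  have hev : ∀ᶠ p' in nhds p, y (formChart I x₀ p').1 0 = (formChart I x₀ p').1 ∧
      v (formChart I x₀ p').1 0 = u ∧ IsTransportFlowOn (extChartAt I x₀).target
        (sprayRep I x₀ S) (christoffel cov x₀) (y (formChart I x₀ p').1) (v (formChart I x₀ p').1)
        (T (formChart I x₀ p').1) (Q (formChart I x₀ p').1) ε :=
    hcf.eventually hf
  have hsrc : ∀ᶠ p' : FormBundle I M in nhds p, p'.proj ∈ (chartAt H x₀).source :=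
    (FiberBundle.continuous_proj _ _).continuousAt.eventually
      ((chartAt H x₀).open_source.mem_nhds hps)
  filter_upwards [hev, hsrc] with p' hp' hps' hmem
  exact formChartSymm_mem_transportedForms hS hmem hps' (hp'.2.2.mono ht.2) hp'.1 ht.1

end Subtangency

theorem hasFDerivAt_of_apply {E F G : Type*} [NormedAddCommGroup E] [NormedSpace ℝ E]
    [FiniteDimensional ℝ E] [NormedAddCommGroup F] [NormedSpace ℝ F] [NormedAddCommGroup G]
    [NormedSpace ℝ G] {f : F → E →L[ℝ] G} {f' : F →L[ℝ] E →L[ℝ] G} {x : F}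
    (h : ∀ c, HasFDerivAt (fun y ↦ f y c) (f'.flip c) x) : HasFDerivAt f f' x := by
  let b := Module.finBasis ℝ E
  let L (i) : G →L[ℝ] E →L[ℝ] G :=
    ContinuousLinearMap.smulRightL ℝ E G (b.coord i).toContinuousLinearMap
  have hL (A : E →L[ℝ] G) : ∑ i, L i (A (b i)) = A := by
    ext c
    conv_rhs => rw [← b.sum_repr c, map_sum]
    simp [L]
  have h1 : HasFDerivAt (fun y ↦ ∑ i, L i (f y (b i))) (∑ i, L i ∘L f'.flip (b i)) x :=
    HasFDerivAt.fun_sum fun i _ ↦ (L i).hasFDerivAt.comp x (h (b i))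
  simp only [hL] at h1
  convert h1
  ext u c
  rw [← hL (f' u)]
  simp

/-! ### Parallel forms on `M` versus solutions of the coordinate equation. -/

section ParallelForm

variable {E : Type*} [NormedAddCommGroup E] [NormedSpace ℝ E] [FiniteDimensional ℝ E]
  {H : Type*} [TopologicalSpace H] {I : ModelWithCorners ℝ E H} [I.Boundaryless]
  {M : Type*} [TopologicalSpace M] [ChartedSpace H M] [IsManifold I ∞ M] [IsManifold I 1 M]
  [IsManifold I 2 M]
  (cov : CovariantDerivative I E (TangentSpace I : M → Type _))
  {x₀ x : M}

/-- The field `s` of bilinear forms is differentiable with `∇s = 0` at `x`. -/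
def IsParallelFormAt (s : ∀ x : M, TangentSpace I x →L[ℝ] TangentSpace I x →L[ℝ] ℝ) (x : M) :
    Prop :=
  ∀ ξ η : (x : M) → TangentSpace I x,
    MDifferentiableAt I I.tangent (fun x ↦ (⟨x, ξ x⟩ : TangentBundle I M)) x →
    MDifferentiableAt I I.tangent (fun x ↦ (⟨x, η x⟩ : TangentBundle I M)) x →
    MDifferentiableAt I 𝓘(ℝ, ℝ) (fun y ↦ s y (ξ y) (η y)) x ∧
      ∀ v : TangentSpace I x, mfderiv I 𝓘(ℝ, ℝ) (fun y ↦ s y (ξ y) (η y)) x v =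
        s x (cov ξ x v) (η x) + s x (ξ x) (cov η x v)

variable (I) in
/-- The coordinate representation of a field of bilinear forms in the chart centred at `x₀`. -/
def formRep (x₀ : M) (s : ∀ x : M, TangentSpace I x →L[ℝ] TangentSpace I x →L[ℝ] ℝ) (y : E) :
    E →L[ℝ] E →L[ℝ] ℝ :=
  formCoord I x₀ ((extChartAt I x₀).symm y) (s ((extChartAt I x₀).symm y))

theorem formRep_extChartAt (hx : x ∈ (chartAt H x₀).source)
    (s : ∀ x : M, TangentSpace I x →L[ℝ] TangentSpace I x →L[ℝ] ℝ) :
    formRep I x₀ s (extChartAt I x₀ x) = formCoord I x₀ x (s x) := by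
  rw [formRep, (extChartAt I x₀).left_inv (by rwa [extChartAt_source])]

variable {cov} {s : ∀ x : M, TangentSpace I x →L[ℝ] TangentSpace I x →L[ℝ] ℝ}

/-- It suffices to evaluate on pairs of coordinate fields, whose covariant derivatives are the
Christoffel symbols. -/
theorem IsParallelFormAt.isFlatAt (hx : x ∈ (chartAt H x₀).source)
    (h : IsParallelFormAt cov s x) :
    IsFlatAt (formConnection (christoffel cov x₀)) (formRep I x₀ s) (extChartAt I x₀ x) := by
  refine hasFDerivAt_of_apply fun c ↦ hasFDerivAt_of_apply fun d ↦ ?_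
  have hm (c : E) : MDifferentiableAt I I.tangent
      (fun x ↦ (⟨x, tangentCoordSymm I x₀ x c⟩ : TangentBundle I M)) x :=
    (contMDiffAt_tangentCoordSymm hx c).mdifferentiableAt (by simp)
  have hcov (c : E) (v : TangentSpace I x) :
      cov (fun x ↦ tangentCoordSymm I x₀ x c) x v = tangentCoordSymm I x₀ x
        (christoffel cov x₀ (extChartAt I x₀ x) (tangentCoord I x₀ x v) c) := by
    rw [← tangentCoordSymm_coord hx (cov _ x v), tangentCoord_cov cov hx (hm c) v,
      (coordRep_tangentCoordSymm_eventuallyEq hx c).fderiv_eq, tangentCoord_symm hx]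
    simp
  obtain ⟨h1, h2⟩ := h _ _ (hm c) (hm d)
  have h3 := ((mdifferentiableAt_iff_differentiableAt_comp_extChartAt_symm hx).1 h1).hasFDerivAt
  refine h3.congr_fderiv ?_
  ext w
  have h4 := h2 (tangentCoordSymm I x₀ x w)
  rw [mfderiv_eq_fderiv_comp_extChartAt_symm hx h1, hcov, hcov, tangentCoord_symm hx] at h4
  refine h4.trans ?_
  change _ = formRep I x₀ s (extChartAt I x₀ x) _ _ + formRep I x₀ s (extChartAt I x₀ x) _ _
  rw [formRep_extChartAt hx]
  rfl

theorem isParallelFormAt_of_isFlatAt (hx : x ∈ (chartAt H x₀).source)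
    (h : IsFlatAt (formConnection (christoffel cov x₀)) (formRep I x₀ s) (extChartAt I x₀ x)) :
    IsParallelFormAt cov s x := by
  intro ξ η hξ hη
  have hy := (extChartAt I x₀).map_source (x := x) (by rwa [extChartAt_source])
  have hξ' := ((mdifferentiableAt_section_iff_coordRep hx).1 hξ).hasFDerivAt
  have hη' := ((mdifferentiableAt_section_iff_coordRep hx).1 hη).hasFDerivAt
  have h1 := (HasFDerivAt.clm_apply h hξ').clm_apply hη'
  have he : (fun y ↦ s y (ξ y) (η y)) ∘ (extChartAt I x₀).symm =ᶠ[nhds (extChartAt I x₀ x)]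
      fun y ↦ formRep I x₀ s y (coordRep I x₀ ξ y) (coordRep I x₀ η y) := by
    filter_upwards [(isOpen_extChartAt_target (I := I) x₀).mem_nhds hy] with y hy
    have hys := extChartAt_symm_mem_source hy
    rw [formRep, formCoord_apply, coordRep, coordRep, tangentCoordSymm_coord hys,
      tangentCoordSymm_coord hys]
    rfl
  have h2 := h1.congr_of_eventuallyEq he
  have hm := (mdifferentiableAt_iff_differentiableAt_comp_extChartAt_symm hx).2 h2.differentiableAt
  refine ⟨hm, fun v ↦ ?_⟩
  have hs (w : E) (z : TangentSpace I x) : formCoord I x₀ x (s x) w (tangentCoord I x₀ x z) =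
      s x (tangentCoordSymm I x₀ x w) z := by
    rw [formCoord_apply, tangentCoordSymm_coord hx]
  have hs' (w : E) (z : TangentSpace I x) : formCoord I x₀ x (s x) (tangentCoord I x₀ x z) w =
      s x z (tangentCoordSymm I x₀ x w) := by
    rw [formCoord_apply, tangentCoordSymm_coord hx]
  rw [mfderiv_eq_fderiv_comp_extChartAt_symm hx hm, h2.fderiv,
    ← tangentCoordSymm_coord hx (cov ξ x v), ← tangentCoordSymm_coord hx (cov η x v), ← hs, ← hs',
    tangentCoord_cov cov hx hξ, tangentCoord_cov cov hx hη]
  simp only [coordRep_extChartAt hx, formRep_extChartAt hx, add_apply,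
    ContinuousLinearMap.comp_apply, ContinuousLinearMap.flip_apply, map_add, formConnection_apply]
  ring_nf
  rfl

end ParallelForm

/-! ### Closed conditions inherited from the transported forms. -/

section Closure

variable {E : Type*} [NormedAddCommGroup E] [NormedSpace ℝ E] [FiniteDimensional ℝ E]
  {H : Type*} [TopologicalSpace H] {I : ModelWithCorners ℝ E H} [I.Boundaryless]
  {M : Type*} [TopologicalSpace M] [ChartedSpace H M] [IsManifold I ∞ M] [IsManifold I 1 M]
  [IsManifold I 2 M] [IsManifold I.tangent 1 (TangentBundle I M)]
  {cov : CovariantDerivative I E (TangentSpace I : M → Type _)}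
  {S : (v : TangentBundle I M) → TangentSpace I.tangent v}
  {m₀ : M} {g₀ : TangentSpace I m₀ →L[ℝ] TangentSpace I m₀ →L[ℝ] ℝ} {x₀ : M}

theorem eq_zero_of_mem_closure_transportedForms
    {f : E × (E →L[ℝ] E →L[ℝ] ℝ) → ℝ} {z : E × (E →L[ℝ] E →L[ℝ] ℝ)}
    (hz : z.1 ∈ (extChartAt I x₀).target)
    (hzK : formChartSymm I x₀ z ∈ closure (transportedForms cov S m₀ g₀))
    (hf : ContinuousAt f z)
    (h : ∀ p ∈ transportedForms cov S m₀ g₀, p.proj ∈ (chartAt H x₀).source →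
      f (formChart I x₀ p) = 0) : f z = 0 := by
  set p := formChartSymm I x₀ z with hp
  have hps : p.proj ∈ (chartAt H x₀).source := extChartAt_symm_mem_source hz
  have hpz : formChart I x₀ p = z := formChart_formChartSymm hz
  have ht : Filter.Tendsto (fun p' ↦ f (formChart I x₀ p')) (nhds p) (nhds (f z)) := by
    have := (continuousAt_formChart hps).tendsto
    rw [hpz] at this
    exact hf.tendsto.comp this
  have hsrc : ∀ᶠ p' : FormBundle I M in nhds p, p'.proj ∈ (chartAt H x₀).source :=
    (FiberBundle.continuous_proj _ _).continuousAt.eventually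
      ((chartAt H x₀).open_source.mem_nhds hps)
  rw [mem_closure_iff_frequently] at hzK
  exact (isClosed_singleton (x := (0 : ℝ))).mem_of_frequently_of_tendsto
    ((hzK.and_eventually hsrc).mono fun p' hp' ↦ h p' hp'.1 hp'.2) ht

theorem symm_of_mem_closure_transportedForms (hg₀ : ∀ ξ η, g₀ ξ η = g₀ η ξ)
    {z : E × (E →L[ℝ] E →L[ℝ] ℝ)} (hz : z.1 ∈ (extChartAt I x₀).target)
    (hzK : formChartSymm I x₀ z ∈ closure (transportedForms cov S m₀ g₀)) (ξ η : E) :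
    z.2 ξ η = z.2 η ξ := by
  refine sub_eq_zero.1 (eq_zero_of_mem_closure_transportedForms
    (f := fun z ↦ z.2 ξ η - z.2 η ξ) hz hzK (by fun_prop) ?_)
  rintro p ⟨a, b, γ, P, -, -, -, g, rfl, hg⟩ -
  have key (ξ η : TangentSpace I (γ b)) : g ξ η = g η ξ := by
    rw [← P.apply_symm_apply ξ, ← P.apply_symm_apply η, hg, hg, hg₀]
  exact sub_eq_zero.2 (key _ _)

theorem skew_of_mem_closure_transportedForms [T2Space M]
    (hcov : CovariantDerivative.ContMDiffCovariantDerivative cov ∞) (hsymm : cov.torsion = 0)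
    (hR : ∀ (a b : ℝ) (γ : ℝ → M), γ a = m₀ → IsPiecewiseSpraySolution S γ a b →
      ∀ P : TangentSpace I m₀ ≃ₗ[ℝ] TangentSpace I (γ b),
        IsParallelTransport cov γ a b P →
        ∀ (v w : TangentSpace I (γ b)) (ξ η : TangentSpace I m₀),
          g₀ (P.symm (curvatureAt cov (γ b) v w (P ξ))) η =
            - g₀ ξ (P.symm (curvatureAt cov (γ b) v w (P η))))
    {z : E × (E →L[ℝ] E →L[ℝ] ℝ)} (hz : z.1 ∈ (extChartAt I x₀).target)
    (hzK : formChartSymm I x₀ z ∈ closure (transportedForms cov S m₀ g₀)) (u v ξ η : E) :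
    z.2 (christoffelCurvature (christoffel cov x₀) z.1 u v ξ) η +
      z.2 ξ (christoffelCurvature (christoffel cov x₀) z.1 u v η) = 0 := by
  have hΓ := (contDiffOn_christoffel cov hcov x₀).contDiffAt
    ((isOpen_extChartAt_target (I := I) x₀).mem_nhds hz)
  have h0 : ContinuousAt (christoffel cov x₀) z.1 := hΓ.continuousAt
  have h1 : ContinuousAt (fderiv ℝ (christoffel cov x₀)) z.1 :=
    (hΓ.fderiv_right (m := 0) (by simp)).continuousAt
  have hc (ξ : E) : ContinuousAt (fun z : E × (E →L[ℝ] E →L[ℝ] ℝ) ↦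
      christoffelCurvature (christoffel cov x₀) z.1 u v ξ) z := by
    refine ContinuousAt.comp (g := fun y ↦ christoffelCurvature (christoffel cov x₀) y u v ξ)
      ?_ continuousAt_fst
    unfold christoffelCurvature
    fun_prop
  refine eq_zero_of_mem_closure_transportedForms
    (f := fun z ↦ z.2 (christoffelCurvature (christoffel cov x₀) z.1 u v ξ) η +
      z.2 ξ (christoffelCurvature (christoffel cov x₀) z.1 u v η)) hz hzK
    (((continuousAt_snd.clm_apply (hc ξ)).clm_apply continuousAt_const).add
      ((continuousAt_snd.clm_apply continuousAt_const).clm_apply (hc η))) ?_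
  rintro p ⟨a, b, γ, P, hγ, hsol, hP, g, rfl, hg⟩ hb
  have hcurv (ξ : E) : tangentCoordSymm I x₀ (γ b) (christoffelCurvature (christoffel cov x₀)
      (extChartAt I x₀ (γ b)) u v ξ) = curvatureAt cov (γ b) (tangentCoordSymm I x₀ (γ b) u)
        (tangentCoordSymm I x₀ (γ b) v) (tangentCoordSymm I x₀ (γ b) ξ) := by
    rw [← tangentCoordSymm_coord hb (curvatureAt cov (γ b) _ _ _),
      tangentCoord_curvatureAt hcov hsymm hb]
    simp only [tangentCoord_symm hb]
  -- Since `P` carries `g₀` to `g`, the hypothesis on the conjugated curvature at `m₀` becomes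
  -- skewness of the curvature for `g` at the endpoint.
  have key (v w ξ η : TangentSpace I (γ b)) :
      g (curvatureAt cov (γ b) v w ξ) η + g ξ (curvatureAt cov (γ b) v w η) = 0 := by
    have h := hR a b γ hγ hsol P hP v w (P.symm ξ) (P.symm η)
    rw [← hg, ← hg] at h
    simp only [LinearEquiv.apply_symm_apply] at h
    linarith
  change formCoord I x₀ (γ b) g (christoffelCurvature (christoffel cov x₀)
      (extChartAt I x₀ (γ b)) u v ξ) η + formCoord I x₀ (γ b) g ξ
        (christoffelCurvature (christoffel cov x₀) (extChartAt I x₀ (γ b)) u v η) = 0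
  rw [formCoord_apply, formCoord_apply, hcurv, hcurv, key]

end Closure

/-! ### Uniqueness, smoothness and nondegeneracy of parallel forms. -/

section ParallelForms

variable {E : Type*} [NormedAddCommGroup E] [NormedSpace ℝ E] [FiniteDimensional ℝ E]
  {H : Type*} [TopologicalSpace H] {I : ModelWithCorners ℝ E H} [I.Boundaryless]
  {M : Type*} [TopologicalSpace M] [ChartedSpace H M] [IsManifold I ∞ M] [IsManifold I 1 M]
  [IsManifold I 2 M]
  {cov : CovariantDerivative I E (TangentSpace I : M → Type _)}
  {x₀ x : M} {r : ℝ}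

variable (I) in
/-- A ball in the chart centred at `x₀`. -/
def chartBall (x₀ : M) (r : ℝ) : Set M :=
  (extChartAt I x₀).source ∩ extChartAt I x₀ ⁻¹' Metric.ball (extChartAt I x₀ x₀) r

theorem isOpen_chartBall : IsOpen (chartBall I x₀ r) :=
  (continuousOn_extChartAt x₀).isOpen_inter_preimage (isOpen_extChartAt_source x₀)
    Metric.isOpen_ball

theorem self_mem_chartBall (hr : 0 < r) : x₀ ∈ chartBall I x₀ r :=
  ⟨mem_extChartAt_source x₀, Metric.mem_ball_self hr⟩

theorem mem_source_of_mem_chartBall (hx : x ∈ chartBall I x₀ r) : x ∈ (chartAt H x₀).source := by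
  simpa using hx.1

theorem extChartAt_symm_mem_chartBall {y : E} (hy : y ∈ (extChartAt I x₀).target)
    (hyr : y ∈ Metric.ball (extChartAt I x₀ x₀) r) :
    (extChartAt I x₀).symm y ∈ chartBall I x₀ r :=
  ⟨(extChartAt I x₀).map_target hy, by rwa [mem_preimage, (extChartAt I x₀).right_inv hy]⟩

theorem IsParallelFormAt.isFlatAt_of_mem_target
    {s : ∀ x : M, TangentSpace I x →L[ℝ] TangentSpace I x →L[ℝ] ℝ} {y : E}
    (hy : y ∈ (extChartAt I x₀).target) (h : IsParallelFormAt cov s ((extChartAt I x₀).symm y)) :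
    IsFlatAt (formConnection (christoffel cov x₀)) (formRep I x₀ s) y := by
  have := h.isFlatAt (extChartAt_symm_mem_source hy)
  rwa [(extChartAt I x₀).right_inv hy] at this

variable {s s' : ∀ x : M, TangentSpace I x →L[ℝ] TangentSpace I x →L[ℝ] ℝ}

theorem eq_on_chartBall_of_isParallelFormAt [T2Space M]
    (hcov : CovariantDerivative.ContMDiffCovariantDerivative cov ∞)
    (hr : Metric.closedBall (extChartAt I x₀ x₀) r ⊆ (extChartAt I x₀).target)
    (h : ∀ x ∈ chartBall I x₀ r, IsParallelFormAt cov s x)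
    (h' : ∀ x ∈ chartBall I x₀ r, IsParallelFormAt cov s' x)
    {x₁ : M} (hx₁ : x₁ ∈ chartBall I x₀ r) (he : s x₁ = s' x₁) (hx : x ∈ chartBall I x₀ r) :
    s x = s' x := by
  have hb := Metric.ball_subset_closedBall.trans hr
  have h1 := eqOn_ball_of_isFlatAt (contDiffOn_formConnection (contDiffOn_christoffel cov hcov x₀))
    hr (s := formRep I x₀ s) (s' := formRep I x₀ s')
    (fun y hy ↦ (h _ (extChartAt_symm_mem_chartBall (hb hy) hy)).isFlatAt_of_mem_target (hb hy))
    (fun y hy ↦ (h' _ (extChartAt_symm_mem_chartBall (hb hy) hy)).isFlatAt_of_mem_target (hb hy))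
    hx₁.2 (by
      have := mem_source_of_mem_chartBall hx₁
      rw [formRep_extChartAt this, formRep_extChartAt this, he]) hx.2
  have hxs := mem_source_of_mem_chartBall hx
  rw [formRep_extChartAt hxs, formRep_extChartAt hxs] at h1
  rw [← formCoordSymm_formCoord hxs (s x), h1, formCoordSymm_formCoord hxs]

/-- The two forms may come from different charts, so they are compared in a third one, centred at
`x`. -/
theorem eventually_eq_of_isParallelFormAt [T2Space M]
    (hcov : CovariantDerivative.ContMDiffCovariantDerivative cov ∞)
    (h : ∀ᶠ y in nhds x, IsParallelFormAt cov s y)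
    (h' : ∀ᶠ y in nhds x, IsParallelFormAt cov s' y) (he : s x = s' x) :
    ∀ᶠ y in nhds x, s y = s' y := by
  have hc := continuousAt_extChartAt_symm (I := I) x
  have h1 : {y | IsParallelFormAt cov s y ∧ IsParallelFormAt cov s' y} ∈
      nhds ((extChartAt I x).symm (extChartAt I x x)) := by
    rw [extChartAt_to_inv]; exact h.and h'
  obtain ⟨r, hr, hrs⟩ := Metric.nhds_basis_closedBall.mem_iff.1
    (Filter.inter_mem (extChartAt_target_mem_nhds (I := I) x) (hc.preimage_mem_nhds h1))
  have hP (z : M) (hz : z ∈ chartBall I x r) :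
      IsParallelFormAt cov s z ∧ IsParallelFormAt cov s' z := by
    have := (hrs (Metric.ball_subset_closedBall hz.2)).2
    rwa [mem_preimage, (extChartAt I x).left_inv hz.1] at this
  filter_upwards [isOpen_chartBall.mem_nhds (self_mem_chartBall (I := I) (x₀ := x) hr)] with z hz
  exact eq_on_chartBall_of_isParallelFormAt hcov (fun y hy ↦ (hrs hy).1) (fun z hz ↦ (hP z hz).1)
    (fun z hz ↦ (hP z hz).2) (self_mem_chartBall hr) he hz

theorem contMDiff_of_isParallelFormAt [T2Space M]
    (hcov : CovariantDerivative.ContMDiffCovariantDerivative cov ∞)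
    (h : ∀ x, IsParallelFormAt cov s x) :
    ContMDiff I (I.prod 𝓘(ℝ, E →L[ℝ] E →L[ℝ] ℝ)) ∞
      (fun x ↦ TotalSpace.mk' (E →L[ℝ] E →L[ℝ] ℝ)
        (E := fun x : M ↦ TangentSpace I x →L[ℝ] TangentSpace I x →L[ℝ] ℝ) x (s x)) := by
  intro x
  have hx := mem_chart_source H x
  rw [contMDiffAt_section]
  have h1 : (fun x' ↦ (trivializationAt (E →L[ℝ] E →L[ℝ] ℝ)
      (fun x : M ↦ TangentSpace I x →L[ℝ] TangentSpace I x →L[ℝ] ℝ) x ⟨x', s x'⟩).2) =ᶠ[nhds x]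
      fun x' ↦ formCoord I x x' (s x') := by
    filter_upwards [(chartAt H x).open_source.mem_nhds hx] with x' hx'
    exact congrArg Prod.snd (trivializationAt_form_apply hx' (s x'))
  refine ContMDiffAt.congr_of_eventuallyEq ?_ h1
  rw [contMDiffAt_iff_contDiffAt_comp_extChartAt_symm hx]
  exact (contDiffOn_of_isFlatAt (isOpen_extChartAt_target x)
    (contDiffOn_formConnection (contDiffOn_christoffel cov hcov x))
    (fun y hy ↦ (h _).isFlatAt_of_mem_target hy)).contDiffAt (extChartAt_target_mem_nhds x)

/-- On a small chart ball nondegeneracy at one point implies it at every other, so the set where it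
holds is both open and closed. -/
theorem nondegenerate_of_isParallelFormAt [T2Space M] [PreconnectedSpace M]
    (hcov : CovariantDerivative.ContMDiffCovariantDerivative cov ∞)
    (h : ∀ x, IsParallelFormAt cov s x) (hx₀ : ∀ ξ, s x₀ ξ = 0 → ξ = 0) (x : M) :
    ∀ ξ, s x ξ = 0 → ξ = 0 := by
  have hrep {x₀ x : M} (hx : x ∈ (chartAt H x₀).source) :
      (∀ ξ, formRep I x₀ s (extChartAt I x₀ x) ξ = 0 → ξ = 0) ↔ ∀ ξ, s x ξ = 0 → ξ = 0 := by
    rw [formRep_extChartAt hx]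
    constructor
    · intro h1 ξ hξ
      have := h1 (tangentCoord I x₀ x ξ) (by
        ext η
        rw [formCoord_apply, tangentCoordSymm_coord hx, hξ]
        rfl)
      rw [← tangentCoordSymm_coord hx ξ, this, map_zero]
    · intro h1 ξ hξ
      have := h1 (tangentCoordSymm I x₀ x ξ) (by
        ext η
        rw [← tangentCoordSymm_coord hx η]
        exact DFunLike.congr_fun hξ (tangentCoord I x₀ x η))
      rw [← tangentCoord_symm (I := I) hx ξ, this, map_zero]
  have hloc (x₀ : M) : ∃ U ∈ nhds x₀, ∀ y ∈ U, ∀ z ∈ U, (∀ ξ, s y ξ = 0 → ξ = 0) →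
      ∀ ξ, s z ξ = 0 → ξ = 0 := by
    obtain ⟨r, hr, hrs, hnd⟩ := exists_ball_nondegenerate_of_isFlatAt
      (isOpen_extChartAt_target (I := I) x₀) (contDiffOn_christoffel cov hcov x₀)
      (mem_extChartAt_target x₀)
    refine ⟨chartBall I x₀ r, isOpen_chartBall.mem_nhds (self_mem_chartBall hr),
      fun y hy z hz ↦ ?_⟩
    rw [← hrep (mem_source_of_mem_chartBall hy), ← hrep (mem_source_of_mem_chartBall hz)]
    exact hnd _ (fun w hw ↦ (h _).isFlatAt_of_mem_target (hrs hw)) _ hy.2 _ hz.2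
  have hclopen : IsClopen {x | ∀ ξ, s x ξ = 0 → ξ = 0} := by
    constructor
    · rw [← isOpen_compl_iff, isOpen_iff_mem_nhds]
      intro x hx
      obtain ⟨U, hU, h⟩ := hloc x
      filter_upwards [hU] with y hy hy'
      exact hx (h y hy x (mem_of_mem_nhds hU) hy')
    · rw [isOpen_iff_mem_nhds]
      intro x hx
      obtain ⟨U, hU, h⟩ := hloc x
      filter_upwards [hU] with y hy
      exact h x (mem_of_mem_nhds hU) y hy hx
  have hx : x ∈ {x | ∀ ξ, s x ξ = 0 → ξ = 0} := by
    rw [hclopen.eq_univ ⟨x₀, hx₀⟩]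
    exact mem_univ x
  exact hx

end ParallelForms

/-! ### Local parallel forms, the global form and the metric. -/

section LocalFamily

variable {E : Type*} [NormedAddCommGroup E] [NormedSpace ℝ E] [FiniteDimensional ℝ E]
  {H : Type*} [TopologicalSpace H] {I : ModelWithCorners ℝ E H} [I.Boundaryless]
  {M : Type*} [TopologicalSpace M] [ChartedSpace H M] [IsManifold I ∞ M] [IsManifold I 1 M]
  [IsManifold I 2 M] [IsManifold I.tangent 1 (TangentBundle I M)]
  {cov : CovariantDerivative I E (TangentSpace I : M → Type _)}
  {S : (v : TangentBundle I M) → TangentSpace I.tangent v}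
  {m₀ : M} {g₀ : TangentSpace I m₀ →L[ℝ] TangentSpace I m₀ →L[ℝ] ℝ} {x₀ : M}

variable (cov S g₀) in
/-- The fibre at `x` of the closure of the set of forms obtained from `g₀` by transport. -/
def closedTransportedForms (x : M) : Set (TangentSpace I x →L[ℝ] TangentSpace I x →L[ℝ] ℝ) :=
  {g | (⟨x, g⟩ : FormBundle I M) ∈ closure (transportedForms cov S m₀ g₀)}

theorem exists_local_parallel_forms [T2Space M]
    (hcov : CovariantDerivative.ContMDiffCovariantDerivative cov ∞) (hsymm : cov.torsion = 0)
    (hS : IsSpray S)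
    (hR : ∀ (a b : ℝ) (γ : ℝ → M), γ a = m₀ → IsPiecewiseSpraySolution S γ a b →
      ∀ P : TangentSpace I m₀ ≃ₗ[ℝ] TangentSpace I (γ b),
        IsParallelTransport cov γ a b P →
        ∀ (v w : TangentSpace I (γ b)) (ξ η : TangentSpace I m₀),
          g₀ (P.symm (curvatureAt cov (γ b) v w (P ξ))) η =
            - g₀ ξ (P.symm (curvatureAt cov (γ b) v w (P η)))) (x₀ : M) :
    ∃ r > 0, Metric.closedBall (extChartAt I x₀ x₀) r ⊆ (extChartAt I x₀).target ∧
      ∃ σ : (TangentSpace I x₀ →L[ℝ] TangentSpace I x₀ →L[ℝ] ℝ) →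
          ∀ x : M, TangentSpace I x →L[ℝ] TangentSpace I x →L[ℝ] ℝ,
        (∀ g ∈ closedTransportedForms cov S g₀ x₀, σ g x₀ = g ∧ ∀ x ∈ chartBall I x₀ r,
          σ g x ∈ closedTransportedForms cov S g₀ x ∧ IsParallelFormAt cov (σ g) x) ∧
        ∀ x ∈ chartBall I x₀ r, ∀ g ∈ closedTransportedForms cov S g₀ x,
          ∃ g' ∈ closedTransportedForms cov S g₀ x₀, σ g' x = g := by
  -- The closure is taken in the total space and then read in the chart; by continuity of
  -- `formChartSymm` it is relatively closed over the chart target.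
  let K : Set (E × (E →L[ℝ] E →L[ℝ] ℝ)) := {z | z.1 ∈ (extChartAt I x₀).target ∧
    formChartSymm I x₀ z ∈ closure (transportedForms cov S m₀ g₀)}
  have hΓ := contDiffOn_christoffel cov hcov x₀
  have hΩ := isOpen_extChartAt_target (I := I) x₀
  have hK (x : M) (hx : x ∈ (chartAt H x₀).source)
      (g : TangentSpace I x →L[ℝ] TangentSpace I x →L[ℝ] ℝ) :
      (extChartAt I x₀ x, formCoord I x₀ x g) ∈ K ↔ g ∈ closedTransportedForms cov S g₀ x := by
    have h1 : formChartSymm I x₀ (extChartAt I x₀ x, formCoord I x₀ x g) =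
      (⟨x, g⟩ : FormBundle I M) := formChartSymm_formChart (p := ⟨x, g⟩) hx
    have h2 := (extChartAt I x₀).map_source (x := x) (by rwa [extChartAt_source])
    simp only [K, mem_ofPred_eq, h1, h2, true_and, closedTransportedForms]
  obtain ⟨r, hr, hrΩ, τ, h1, h2⟩ := exists_flat_sections (A := formConnection (christoffel cov x₀))
    (K := K) hΩ (contDiffOn_formConnection hΓ)
    (fun z hz hzK ↦ ⟨hz, closure_mono (t := closure (transportedForms cov S m₀ g₀))
      (image_subset_iff.2 fun z hz ↦ hz.2)
      (mem_closure_image (continuousAt_formChartSymm hz) hzK) |> fun h ↦ by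
        rwa [closure_closure] at h⟩)
    (fun z hz _ u ↦ exists_curve_mem_closure_transportedForms hcov hS hz.1 hz.2 u)
    (fun z hz _ ↦ isIntegrableAt_formConnection
      ((hΓ.contDiffAt (hΩ.mem_nhds hz.1)).differentiableAt (by simp))
      (skew_of_mem_closure_transportedForms hcov hsymm hR hz.1 hz.2))
    (mem_extChartAt_target x₀)
  have hx₀ := mem_chart_source H x₀
  refine ⟨r, hr, hrΩ, fun g x ↦ formCoordSymm I x₀ x (τ (formCoord I x₀ x₀ g)
    (extChartAt I x₀ x)), fun g hg ↦ ⟨?_, fun x hx ↦ ?_⟩, fun x hx g hg ↦ ?_⟩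
  · beta_reduce
    rw [(h1 _ ((hK x₀ hx₀ g).2 hg)).1, formCoordSymm_formCoord hx₀]
  · have hxs := mem_source_of_mem_chartBall hx
    have h3 := (h1 _ ((hK x₀ hx₀ g).2 hg)).2 _ hx.2
    refine ⟨?_, ?_⟩
    · rw [← hK x hxs, formCoord_formCoordSymm hxs]
      exact h3.1
    · refine isParallelFormAt_of_isFlatAt hxs ?_
      have he : formRep I x₀ (fun x ↦ formCoordSymm I x₀ x (τ (formCoord I x₀ x₀ g)
          (extChartAt I x₀ x))) =ᶠ[nhds (extChartAt I x₀ x)] τ (formCoord I x₀ x₀ g) := by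
        filter_upwards [hΩ.mem_nhds ((extChartAt I x₀).map_source hx.1)] with y hy
        rw [formRep, formCoord_formCoordSymm (extChartAt_symm_mem_source hy),
          (extChartAt I x₀).right_inv hy]
      have h4 := HasFDerivAt.congr_of_eventuallyEq h3.2 he
      rwa [← he.eq_of_nhds] at h4
  · have hxs := mem_source_of_mem_chartBall hx
    obtain ⟨g', hg', he⟩ := h2 _ hx.2 _ ((hK x hxs g).2 hg)
    refine ⟨formCoordSymm I x₀ x₀ g', ?_, ?_⟩
    · rwa [← hK x₀ hx₀, formCoord_formCoordSymm hx₀]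
    · simp only [formCoord_formCoordSymm hx₀]
      rw [he, formCoordSymm_formCoord hxs]

theorem exists_parallel_form [T2Space M] [SimplyConnectedSpace M] [LocallyPathConnectedSpace M]
    (hcov : CovariantDerivative.ContMDiffCovariantDerivative cov ∞) (hsymm : cov.torsion = 0)
    (hS : IsSpray S)
    (hR : ∀ (a b : ℝ) (γ : ℝ → M), γ a = m₀ → IsPiecewiseSpraySolution S γ a b →
      ∀ P : TangentSpace I m₀ ≃ₗ[ℝ] TangentSpace I (γ b),
        IsParallelTransport cov γ a b P →
        ∀ (v w : TangentSpace I (γ b)) (ξ η : TangentSpace I m₀),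
          g₀ (P.symm (curvatureAt cov (γ b) v w (P ξ))) η =
            - g₀ ξ (P.symm (curvatureAt cov (γ b) v w (P η)))) :
    ∃ s : ∀ x : M, TangentSpace I x →L[ℝ] TangentSpace I x →L[ℝ] ℝ, s m₀ = g₀ ∧
      ∀ x, s x ∈ closedTransportedForms cov S g₀ x ∧ IsParallelFormAt cov s x := by
  choose r hr hrΩ σ h1 h2 using exists_local_parallel_forms hcov hsymm hS hR
  have hpar (x₀ : M) (g) (hg : g ∈ closedTransportedForms cov S g₀ x₀) (x : M)
      (hx : x ∈ chartBall I x₀ (r x₀)) : ∀ᶠ y in nhds x, IsParallelFormAt cov (σ x₀ g) y := by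
    filter_upwards [isOpen_chartBall.mem_nhds hx] with y hy
    exact ((h1 x₀ g hg).2 y hy).2
  have hfam : IsLocalSectionFamily (closedTransportedForms cov S g₀)
      (fun x₀ ↦ chartBall I x₀ (r x₀)) σ :=
    { isOpen := fun x₀ ↦ isOpen_chartBall
      mem := fun x₀ ↦ self_mem_chartBall (hr x₀)
      self := fun x₀ g hg ↦ (h1 x₀ g hg).1
      mapsTo := fun x₀ g hg x hx ↦ ((h1 x₀ g hg).2 x hx).1
      surj := h2
      inj := fun x₀ x hx g hg g' hg' he ↦ by
        rw [← (h1 x₀ g hg).1, ← (h1 x₀ g' hg').1]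
        exact eq_on_chartBall_of_isParallelFormAt hcov (hrΩ x₀)
          (fun x hx ↦ ((h1 x₀ g hg).2 x hx).2) (fun x hx ↦ ((h1 x₀ g' hg').2 x hx).2) hx he
          (self_mem_chartBall (hr x₀))
      eventually_eq := fun x₀ g hg x₁ g' hg' x hx hx' he ↦
        eventually_eq_of_isParallelFormAt (I := I) hcov (hpar x₀ g hg x hx) (hpar x₁ g' hg' x hx') he }
  -- Monodromy applies to the fibres of the closure, which contains `g₀`. The section obtained is
  -- locally one of the `σ x`, and being parallel at `x` depends only on the germ there.
  obtain ⟨s, hs0, hs⟩ := hfam.exists_global_section m₀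
    (mem_closure_transportedForms_base hcov hS)
  refine ⟨s, hs0, fun x ↦ ⟨(hs x).1, fun ξ η hξ hη ↦ ?_⟩⟩
  have hx := self_mem_chartBall (I := I) (x₀ := x) (hr x)
  have h3 := ((h1 x _ (hs x).1).2 x hx).2 ξ η hξ hη
  rw [(h1 x _ (hs x).1).1] at h3
  have he : (fun y ↦ s y (ξ y) (η y)) =ᶠ[nhds x] fun y ↦ σ x (s x) y (ξ y) (η y) := by
    filter_upwards [(hs x).2] with y hy
    rw [hy]
  exact ⟨h3.1.congr_of_eventuallyEq he, fun v ↦ by rw [he.mfderiv_eq]; exact h3.2 v⟩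

/-- A bilinear form on `T_{m₀}M` that makes the curvature operators, transported along all piecewise
solutions of a spray, skew-adjoint extends to a metric with the given Levi-Civita connection. -/
theorem exists_isLeviCivita [T2Space M] [CompleteSpace E] [SimplyConnectedSpace M]
    [LocallyPathConnectedSpace M]
    (hcov : CovariantDerivative.ContMDiffCovariantDerivative cov ∞) (hsymm : cov.torsion = 0)
    (hS : IsSpray S) (hg₀_symm : ∀ ξ η, g₀ ξ η = g₀ η ξ) (hg₀_nondeg : ∀ ξ, g₀ ξ = 0 → ξ = 0)
    (hR : ∀ (a b : ℝ) (γ : ℝ → M), γ a = m₀ → IsPiecewiseSpraySolution S γ a b →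
      ∀ P : TangentSpace I m₀ ≃ₗ[ℝ] TangentSpace I (γ b),
        IsParallelTransport cov γ a b P →
        ∀ (v w : TangentSpace I (γ b)) (ξ η : TangentSpace I m₀),
          g₀ (P.symm (curvatureAt cov (γ b) v w (P ξ))) η =
            - g₀ ξ (P.symm (curvatureAt cov (γ b) v w (P η)))) :
    ∃ g : SemiRiemannianMetric I M, g.form m₀ = g₀ ∧ IsLeviCivita cov g := by
  obtain ⟨s, hs0, hs⟩ := exists_parallel_form hcov hsymm hS hR
  have hpar x := (hs x).2
  have hnd := nondegenerate_of_isParallelFormAt hcov hpar (x₀ := m₀) (by rwa [hs0])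
  refine ⟨⟨s, fun x v w ↦ ?_, fun x v hv ↦ hnd x v (ContinuousLinearMap.ext hv),
    contMDiff_of_isParallelFormAt hcov hpar⟩, hs0, hsymm, fun X ξ η hX hξ hη x ↦ ?_⟩
  -- Symmetry holds because `s x` lies in the closure of transports of the symmetric form `g₀`.
  · have hx := mem_chart_source H x
    have := symm_of_mem_closure_transportedForms (x₀ := x) (cov := cov) (S := S) hg₀_symm
      (z := formChart I x ⟨x, s x⟩) (mem_extChartAt_target x)
      (by rw [formChartSymm_formChart hx]; exact (hs x).1)
      (tangentCoord I x x v) (tangentCoord I x x w)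
    simpa only [formChart, formCoord_apply, tangentCoordSymm_coord hx] using this
  · exact (hpar x ξ η ((hξ x).mdifferentiableAt (by simp)) ((hη x).mdifferentiableAt (by simp))).2 _

end LocalFamily

/-- A bilinear form on a finite-dimensional space, as a continuous bilinear form. -/
def LinearMap.BilinForm.toContinuousBilinear {V : Type*} [AddCommGroup V] [Module ℝ V]
    [TopologicalSpace V] [IsTopologicalAddGroup V] [ContinuousSMul ℝ V] [T2Space V]
    [FiniteDimensional ℝ V] (g : LinearMap.BilinForm ℝ V) : V →L[ℝ] V →L[ℝ] ℝ :=
  LinearMap.toContinuousLinearMap (LinearMap.toContinuousLinearMap.toLinearMap ∘ₗ g)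

end

theorem theorem4p7 {n : ℕ} {M : Type*} [TopologicalSpace M] [T2Space M]
    [ChartedSpace (EuclideanSpace ℝ (Fin n)) M] [IsManifold (𝓡 n) ∞ M]
    [SimplyConnectedSpace M]
    (cov : CovariantDerivative (𝓡 n) (EuclideanSpace ℝ (Fin n))
      (TangentSpace (𝓡 n) : M → Type _))
    (hcov : CovariantDerivative.ContMDiffCovariantDerivative cov ∞)
    (hsymm : cov.torsion = 0)
    (S : (v : TangentBundle (𝓡 n) M) → TangentSpace (𝓡 n).tangent v)
    (hS : IsSpray S)
    (m₀ : M) (g₀ : LinearMap.BilinForm ℝ (TangentSpace (𝓡 n) m₀))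
    (hg₀_symm : g₀.IsSymm) (hg₀_nondeg : g₀.Nondegenerate)
    (hR : ∀ (a b : ℝ) (γ : ℝ → M), γ a = m₀ → IsPiecewiseSpraySolution S γ a b →
      ∀ P : TangentSpace (𝓡 n) m₀ ≃ₗ[ℝ] TangentSpace (𝓡 n) (γ b),
        IsParallelTransport cov γ a b P →
        ∀ (v w : TangentSpace (𝓡 n) (γ b)) (ξ η : TangentSpace (𝓡 n) m₀),
          g₀ (P.symm (curvatureAt cov (γ b) v w (P ξ))) η =
            - g₀ ξ (P.symm (curvatureAt cov (γ b) v w (P η)))) :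
    ∃ g : SemiRiemannianMetric (𝓡 n) M,
      (∀ u v : TangentSpace (𝓡 n) m₀, g.form m₀ u v = g₀ u v) ∧ IsLeviCivita cov g := by
  have : LocallyPathConnectedSpace M :=
    ChartedSpace.locallyPathConnectedSpace (EuclideanSpace ℝ (Fin n)) M
  have : FiniteDimensional ℝ (TangentSpace (𝓡 n) m₀) :=
    inferInstanceAs (FiniteDimensional ℝ (EuclideanSpace ℝ (Fin n)))
  have : T2Space (TangentSpace (𝓡 n) m₀) :=
    inferInstanceAs (T2Space (EuclideanSpace ℝ (Fin n)))
  obtain ⟨g, hg, hLC⟩ := exists_isLeviCivita (g₀ := g₀.toContinuousBilinear) hcov hsymm hS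
    (fun ξ η ↦ hg₀_symm.eq ξ η) (fun ξ hξ ↦ hg₀_nondeg.1 ξ (DFunLike.congr_fun hξ)) hR
  exact ⟨g, fun u v ↦ DFunLike.congr_fun (DFunLike.congr_fun hg u) v, hLC⟩
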